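/- Let $X=(X_1,\dots,X_m)$ be an $m$-tuple of smooth vector fields $X_i=\sum_{j=1}^n a_{ij}\partial_{x_j}$ on $\mathbb R^n$, linearly independent at every point, and let $\Omega\subset\mathbb R^n$ be open. For $\varphi\in C^1_c(\Omega;\mathbb R^m)$ put $\operatorname{div}_X\varphi:=\sum_{i=1}^m\sum_{j=1}^n\partial_{x_j}(a_{ij}\varphi_i)$. A function $u\in L^1_{loc}(\Omega)$ belongs to $BV_{H,loc}(\Omega)$ if there is an $\mathbb R^m$-valued Radon measure $D_Hu$ on $\Omega$ with $\int_\Omega\varphi\cdot dD_Hu=-\int_\Omega u\,\operatorname{div}_X\varphi\,d\mathscr L^n$ for all $\varphi\in C^1_c(\Omega;\mathbb R^m)$; $u\in BV_H(\Omega)$ if moreover $u\in L^1(\Omega)$ and $|D_Hu|(\Omega)<\infty$. On $\mathbb R^n\times\mathbb R$ consider the family $\widetilde X=((X_1,0),\dots,(X_m,0),\partial_t)$, and write $D_{\widetilde H}$ for the corresponding derivative. Let $\pi(x,t)=x$. Let $u\in BV_H(\Omega)$, with subgraph $E_u=\{(x,t)\in\Omega\times\mathbb R:t<u(x)\}$.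 Write $D_Hu=\sigma_u|D_Hu|$ with $|\sigma_u|=1$ $|D_Hu|$-a.e., and $D_Hu=D_H^au+D_H^su$, where $D^a_Hu=Xu\,\mathscr L^n$ is absolutely continuous and $D^s_Hu$ is singular with respect to $\mathscr L^n$. Then $\chi_{E_u}\in BV_{\widetilde H,loc}(\Omega\times\mathbb R)$. Moreover, write $D_{\widetilde H}\chi_{E_u}=\nu_{E_u}|D_{\widetilde H}\chi_{E_u}|$ with $\nu_{E_u}$ Borel and $|\nu_{E_u}|=1$ $|D_{\widetilde H}\chi_{E_u}|$-a.e., and let $$S=\{(x,t)\in\Omega\times\mathbb R:(\nu_{E_u})_{m+1}(x,t)=0\},\qquad T=\{(x,t)\in\Omega\times\mathbb R:(\nu_{E_u})_{m+1}(x,t)\ne0\}.$$ Then $$\nu_{E_u}(x,t)=(\sigma_u(x),0)\quad\text{for }|D_{\widetilde H}\chi_{E_u}|\text{-a.e. }(x,t)\in S,$$ $$\nu_{E_u}(x,t)=\frac{(Xu(x),-1)}{\sqrt{1+|Xu(x)|^2}}\quad\text{for }|D_{\widetilde H}\chi_{E_u}|\text{-a.e. }(x,t)\in T,$$ $$\pi_\#(D_{\widetilde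 H}\chi_{E_u}\llcorner S)=(D_H^su,0),\qquad \pi_\#(D_{\widetilde H}\chi_{E_u}\llcorner T)=(D_H^au,-\mathscr L^n)$$ as $\mathbb R^{m+1}$-valued Radon measures on $\Omega$; in particular, $|D_{\widetilde H}\chi_{E_u}|(\pi^{-1}(B))<\infty$ for every Borel set $B$ contained in a compact subset of $\Omega$. -/

import Mathlib

open MeasureTheory Set Filter Topology
open scoped ENNReal ContDiff

/-- Borel sets that are relatively compact in `U`, i.e. contained in a compact subset of `U`. -/
def IsRelCompactBorel {E : Type*} [TopologicalSpace E] [MeasurableSpace E] (U B : Set E) : Prop :=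
  MeasurableSet B ∧ ∃ K, IsCompact K ∧ K ⊆ U ∧ B ⊆ K

/-- A `V`-valued Radon measure on `U`: a `V`-valued set function on the relatively compact Borel
subsets of `U`, countably additive on the Borel subsets of each compact `K ⊆ U`.
(The values of `toFun` on all other sets are irrelevant.) -/
structure RadonVectorMeasure {E : Type*} [TopologicalSpace E] [MeasurableSpace E]
    (U : Set E) (V : Type*) [NormedAddCommGroup V] where
  toFun : Set E → V
  hasSum_iUnion' : ∀ K : Set E, IsCompact K → K ⊆ U → ∀ B : ℕ → Set E,
    (∀ i, MeasurableSet (B i)) → (∀ i, B i ⊆ K) → Pairwise (fun i j => Disjoint (B i) (B j)) →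
      HasSum (fun i => toFun (B i)) (toFun (⋃ i, B i))

namespace RadonVectorMeasure

section Basic

variable {E : Type*} [TopologicalSpace E] [MeasurableSpace E] {U : Set E}
  {V : Type*} [NormedAddCommGroup V]

instance : CoeFun (RadonVectorMeasure U V) (fun _ => Set E → V) := ⟨RadonVectorMeasure.toFun⟩

theorem apply_empty (μ : RadonVectorMeasure U V) : μ ∅ = 0 := by
  have h := μ.hasSum_iUnion' ∅ isCompact_empty (empty_subset U) (fun _ => ∅)
    (fun _ => MeasurableSet.empty) (fun _ => Subset.rfl)
    (fun _ _ _ => disjoint_bot_left)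
  exact tendsto_nhds_unique tendsto_const_nhds h.summable.tendsto_atTop_zero

instance : Zero (RadonVectorMeasure U V) :=
  ⟨⟨fun _ => 0, fun _ _ _ _ _ _ _ => hasSum_zero⟩⟩

instance : Neg (RadonVectorMeasure U V) :=
  ⟨fun μ => ⟨fun B => -μ B, fun K hK hKU B hB hBK hd =>
    (μ.hasSum_iUnion' K hK hKU B hB hBK hd).neg⟩⟩

open Classical in
/-- The restriction `μ ⌞ S` to a Borel set `S` (zero if `S` is not Borel). -/
noncomputable def restrict (μ : RadonVectorMeasure U V) (S : Set E) : RadonVectorMeasure U V where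
  toFun B := if MeasurableSet S then μ (B ∩ S) else 0
  hasSum_iUnion' K hK hKU B hB hBK hd := by
    by_cases hS : MeasurableSet S
    · simp only [hS, if_true, iUnion_inter]
      exact μ.hasSum_iUnion' K hK hKU (fun i => B i ∩ S) (fun i => (hB i).inter hS)
        (fun i => inter_subset_left.trans (hBK i))
        (fun i j hij => (hd hij).mono inter_subset_left inter_subset_left)
    · simp only [hS, if_false]
      exact hasSum_zero

/-- A positive Radon measure, seen as a real-valued Radon measure on `U`. -/
noncomputable def ofMeasure (U : Set E) (ρ : Measure E) [IsFiniteMeasureOnCompacts ρ] :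
    RadonVectorMeasure U ℝ where
  toFun B := ρ.real B
  hasSum_iUnion' K hK hKU B hB hBK hd := by
    have hfin : ∑' i, ρ (B i) ≠ ⊤ := by
      rw [← measure_iUnion hd hB]
      exact ((measure_mono (iUnion_subset hBK)).trans_lt hK.measure_lt_top).ne
    have h := ENNReal.hasSum_toReal hfin
    simp only [Measure.real]
    rwa [measure_iUnion hd hB,
      ENNReal.tsum_toReal_eq fun i => ((measure_mono (hBK i)).trans_lt hK.measure_lt_top).ne]

/-- The largest size of `μ` on the traces of `B` on the compact subsets of `U`. -/
noncomputable def compactSup (μ : RadonVectorMeasure U V) (B : Set E) : ℝ≥0∞ :=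
  ⨆ K : {K : Set E // IsCompact K ∧ K ⊆ U}, ‖μ (B ∩ K)‖ₑ

theorem compactSup_empty (μ : RadonVectorMeasure U V) : μ.compactSup ∅ = 0 := by
  simp [compactSup, apply_empty]

end Basic

section Variation

variable {E : Type*} [TopologicalSpace E] [T2Space E] [MeasurableSpace E] [BorelSpace E]
  {U : Set E} {V : Type*} [NormedAddCommGroup V]

/-- The finite vector measure `B ↦ μ (B ∩ K)`, for a compact set `K ⊆ U`. -/
noncomputable def onCompact (μ : RadonVectorMeasure U V) (K : Set E) (hK : IsCompact K)
    (hKU : K ⊆ U) : VectorMeasure E V := by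
  classical exact
  { measureOf' := fun B => if MeasurableSet B then μ (B ∩ K) else 0
    empty' := by simp [apply_empty]
    not_measurable' := fun B hB => by simp [hB]
    m_iUnion' := fun B hB hd => by
      simp only [hB, MeasurableSet.iUnion hB, if_true, iUnion_inter]
      exact μ.hasSum_iUnion' K hK hKU (fun i => B i ∩ K)
        (fun i => (hB i).inter hK.measurableSet) (fun i => inter_subset_right)
        (fun i j hij => (hd hij).mono inter_subset_left inter_subset_left) }

theorem isSigmaSubadditive_compactSup (μ : RadonVectorMeasure U V) :
    IsSigmaSubadditiveSetFun μ.compactSup := by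
  intro s hs
  refine iSup_le fun K => ?_
  have h := μ.hasSum_iUnion' K.1 K.2.1 K.2.2 (fun i => (s i).1 ∩ K.1)
    (fun i => (s i).2.inter K.2.1.measurableSet) (fun i => inter_subset_right)
    (fun i j hij => (hs hij).mono inter_subset_left inter_subset_left)
  rw [← iUnion_inter] at h
  rw [← h.tsum_eq]
  refine enorm_tsum_le_tsum_enorm.trans (ENNReal.tsum_le_tsum fun i => ?_)
  exact le_iSup (fun K : {K : Set E // IsCompact K ∧ K ⊆ U} => ‖μ ((s i).1 ∩ K)‖ₑ) K

/-- The total variation `|μ|`, a positive Borel measure: `|μ|(B)` is the supremum of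
`∑ ‖μ (B_l ∩ K_l)‖` over the finite Borel partitions `(B_l)` of `B` and compact sets `K_l ⊆ U`,
i.e. the supremum of `∑ ‖μ (C_l)‖` over the finite families of disjoint relatively compact Borel
subsets `C_l` of `U ∩ B`. -/
noncomputable def variation (μ : RadonVectorMeasure U V) : Measure E :=
  preVariation μ.compactSup μ.isSigmaSubadditive_compactSup μ.compactSup_empty

/-- The decomposition into absolutely continuous and singular part with respect to `ρ`:
`μ = μa + μs` with `|μa| ≪ ρ` and `|μs| ⟂ ρ`. -/
structure IsLebesgueDecomposition (μ μa μs : RadonVectorMeasure U V) (ρ : Measure E) : Prop where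
  eq_add : ∀ B, IsRelCompactBorel U B → μ B = μa B + μs B
  absolutelyContinuous : μa.variation ≪ ρ
  mutuallySingular : μs.variation ⟂ₘ ρ

variable [NormedSpace ℝ V]

/-- `μ = f ρ` on `U`, with a locally integrable density `f`. -/
def HasDensity (μ : RadonVectorMeasure U V) (f : E → V) (ρ : Measure E) : Prop :=
  LocallyIntegrableOn f U ρ ∧ ∀ B, IsRelCompactBorel U B → μ B = ∫ x in B, f x ∂ρ

/-- Polar decomposition `μ = σ |μ|`, with `|σ| = 1` almost everywhere. -/
structure IsPolar (μ : RadonVectorMeasure U V) (σ : E → V) : Prop where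
  aestronglyMeasurable : AEStronglyMeasurable σ μ.variation
  norm_eq_one : ∀ᵐ x ∂μ.variation, ‖σ x‖ = 1
  eq_integral : ∀ B, IsRelCompactBorel U B → μ B = ∫ x in B, σ x ∂μ.variation

/-- `π_# μ = lam` as Radon measures on `W`: for every relatively compact Borel `B ⊆ W`, the set
`π⁻¹ B` has finite total variation, and its `μ`-measure, i.e. the limit of `μ (π⁻¹ B ∩ K)` along the
compact sets `K ↑ U`, is `lam B`. -/
def IsPushforward {F : Type*} [TopologicalSpace F] [MeasurableSpace F] {W : Set F}
    (π : E → F) (μ : RadonVectorMeasure U V) (lam : RadonVectorMeasure W V) : Prop :=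
  ∀ B, IsRelCompactBorel W B →
    μ.variation (π ⁻¹' B) < ⊤ ∧
      Tendsto (fun K : {K : Set E // IsCompact K ∧ K ⊆ U} => μ (π ⁻¹' B ∩ K)) atTop (𝓝 (lam B))

end Variation

end RadonVectorMeasure

/-- The vector `(v, t) ∈ ℝᵐ⁺¹`, for `v ∈ ℝᵐ` and `t ∈ ℝ`. -/
noncomputable def euclideanSnoc {m : ℕ} (v : EuclideanSpace ℝ (Fin m)) (t : ℝ) :
    EuclideanSpace ℝ (Fin (m + 1)) :=
  WithLp.toLp 2 (Fin.snoc (α := fun _ => ℝ) (fun i => v i) t)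

/-- The `ℝᵐ⁺¹`-valued measure `(μ, κ)`. -/
noncomputable def RadonVectorMeasure.snoc {E : Type*} [TopologicalSpace E] [MeasurableSpace E]
    {U : Set E} {m : ℕ} (μ : RadonVectorMeasure U (EuclideanSpace ℝ (Fin m)))
    (κ : RadonVectorMeasure U ℝ) : RadonVectorMeasure U (EuclideanSpace ℝ (Fin (m + 1))) where
  toFun B := euclideanSnoc (μ B) (κ B)
  hasSum_iUnion' K hK hKU B hB hBK hd := by
    have h1 := μ.hasSum_iUnion' K hK hKU B hB hBK hd
    have h2 := κ.hasSum_iUnion' K hK hKU B hB hBK hd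
    refine ((EuclideanSpace.equiv (Fin (m + 1)) ℝ).symm.hasSum).2 (Pi.hasSum.2 fun j => ?_)
    refine Fin.lastCases ?_ (fun i => ?_) j
    · simpa [euclideanSnoc] using h2
    · simpa [euclideanSnoc] using h1.mapL (EuclideanSpace.proj (𝕜 := ℝ) i)

section HVariation

variable {E : Type*} [NormedAddCommGroup E] [NormedSpace ℝ E]

/-- `div_X φ = ∑ᵢ ∑ⱼ ∂ⱼ (aᵢⱼ φᵢ)`, i.e. the sum over `i` of the divergences of the vector fields
`φᵢ Xᵢ`, the divergence of a vector field being the trace of its differential. -/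
noncomputable def divX {m : ℕ} (X : Fin m → E → E) (φ : E → EuclideanSpace ℝ (Fin m)) (x : E) : ℝ :=
  ∑ i, LinearMap.trace ℝ E (fderiv ℝ (fun y => φ y i • X i y) x).toLinearMap

variable [MeasureSpace E] [BorelSpace E]

/-- `D = D_H u = (D_{X₁} u, …, D_{X_m} u)` on `U` in the sense of distributions:
`∫ φ · dD = - ∫ u div_X φ` for all `φ ∈ C¹_c(U; ℝᵐ)`. -/
def IsHDerivative {m : ℕ} (X : Fin m → E → E) (U : Set E) (u : E → ℝ)
    (D : RadonVectorMeasure U (EuclideanSpace ℝ (Fin m))) : Prop :=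
  ∀ φ : E → EuclideanSpace ℝ (Fin m), ContDiff ℝ 1 φ →
    ∀ (hc : HasCompactSupport φ) (hs : tsupport φ ⊆ U),
      (D.onCompact (tsupport φ) hc hs).integral φ (innerSL ℝ) = -∫ x in U, u x * divX X φ x

/-- `u ∈ BV_{H,loc}(U)`. -/
def MemBVHLoc {m : ℕ} (X : Fin m → E → E) (U : Set E) (u : E → ℝ) : Prop :=
  LocallyIntegrableOn u U ∧
    ∃ D : RadonVectorMeasure U (EuclideanSpace ℝ (Fin m)), IsHDerivative X U u D

/-- `u ∈ BV_H(U)`. -/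
def MemBVH {m : ℕ} (X : Fin m → E → E) (U : Set E) (u : E → ℝ) : Prop :=
  IntegrableOn u U ∧
    ∃ D : RadonVectorMeasure U (EuclideanSpace ℝ (Fin m)),
      IsHDerivative X U u D ∧ D.variation U < ⊤

end HVariation

/-- The fields `(X₁, 0), …, (X_m, 0), ∂_t` on `E × ℝ`. -/
def extendedFields {E : Type*} [Zero E] {m : ℕ} (X : Fin m → E → E) :
    Fin (m + 1) → E × ℝ → E × ℝ :=
  Fin.snoc (α := fun _ => E × ℝ → E × ℝ) (fun i p => (X i p.1, 0)) (fun _ => (0, 1))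

/-- The subgraph `{(x, t) ∈ Ω × ℝ : t < u x}`. -/
def subgraph {E : Type*} (Ω : Set E) (u : E → ℝ) : Set (E × ℝ) :=
  {p | p.1 ∈ Ω ∧ p.2 < u p.1}

/-!
Let `M` be the total variation of the measure `(D_H u, -ℒⁿ)` on `Ω` and `τ` its polar vector. For
`v` of class `C¹`, the horizontal derivative of the indicator of the subgraph of `v` is the image
of `(Xv, -1) ℒⁿ` under the graph map `x ↦ (x, v x)`. Take for `v` the mollifications of `u`: by
Friedrichs' lemma the masses of `(Xv, -1) ℒⁿ` are asymptotically at most `M`, so the graph measures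
have weak limits. Hence `D = ν |D|`, the derivative of the indicator of the subgraph of `u`, is a
Radon measure with `|D|(K × ℝ) ≤ M K` for `K` compact. Testing `D` with `g x * η t` and letting `η`
increase to `1` shows that `π_# D = τ M`. So projecting `D` loses no mass, and the equality case of
`|⟨τ ∘ π, ν⟩| ≤ 1` yields `ν = τ ∘ π` almost everywhere and `π_# |D| = M`. Finally `τ = (σ_u, 0)` on
a Lebesgue null set carrying the singular part of `D_H u`, and `τ` is the normalization of
`(Xu, -1)` elsewhere.
-/

section VectorMeasure

variable {Y : Type*} [MeasurableSpace Y] {V : Type*} [NormedAddCommGroup V]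

theorem isFiniteMeasure_variation [NormedSpace ℝ V] [FiniteDimensional ℝ V]
    (μ : VectorMeasure Y V) : IsFiniteMeasure μ.variation := by
  let b := Module.finBasis ℝ V
  let coord (i) : V →L[ℝ] ℝ := (b.coord i).toContinuousLinearMap
  let c (i) : SignedMeasure Y :=
    μ.mapRange (coord i).toLinearMap.toAddMonoidHom (coord i).continuous
  have enorm_le (B : Set Y) : ‖μ B‖ₑ ≤ ∑ i, ‖c i B‖ₑ * ‖b i‖ₑ :=
    calc ‖μ B‖ₑ = ‖∑ i, b.repr (μ B) i • b i‖ₑ := by rw [b.sum_repr]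
      _ ≤ ∑ i, ‖b.repr (μ B) i • b i‖ₑ := enorm_sum_le _ _
      _ = ∑ i, ‖c i B‖ₑ * ‖b i‖ₑ := Finset.sum_congr rfl fun i _ => enorm_smul _ _
  have variation_le : μ.variation ≤ ∑ i, ‖b i‖₊ • (c i).totalVariation := by
    refine VectorMeasure.variation_le_of_forall_enorm_le fun B _ => (enorm_le B).trans ?_
    rw [Measure.coe_finsetSum, Finset.sum_apply]
    refine Finset.sum_le_sum fun i _ => ?_
    rw [mul_comm]
    exact mul_le_mul_right ((c i).enorm_le_totalVariation B) _
  exact ⟨(variation_le univ).trans_lt (measure_lt_top _ _)⟩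

theorem isFiniteMeasure_variation_withDensityᵥ [NormedSpace ℝ V] [CompleteSpace V]
    {P : Measure Y} {h : Y → V} (hh : Integrable h P) :
    IsFiniteMeasure (P.withDensityᵥ h).variation := by
  rw [Measure.variation_withDensityᵥ hh]
  exact ⟨by simpa [hasFiniteIntegral_iff_enorm] using hh.2⟩

variable [InnerProductSpace ℝ V]

theorem norm_inner_le_mul_of_norm_le {v w : V} {C : ℝ} (hv : ‖v‖ ≤ C) :
    ‖inner ℝ v w‖ ≤ C * ‖w‖ :=
  (norm_inner_le_norm v w).trans (mul_le_mul_of_nonneg_right hv (norm_nonneg w))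

theorem integrable_inner_of_norm_le {P : Measure Y} {f h : Y → V} (hh : Integrable h P)
    (hf : AEStronglyMeasurable f P) {C : ℝ} (hC : ∀ x, ‖f x‖ ≤ C) :
    Integrable (fun x => inner ℝ (f x) (h x)) P :=
  (hh.norm.const_mul C).mono' (hf.inner hh.1)
    (Eventually.of_forall fun x => norm_inner_le_mul_of_norm_le (hC x))

variable [CompleteSpace V] {P : Measure Y} {h : Y → V}

theorem integral_withDensityᵥ_innerSL_simpleFunc (hh : Integrable h P) (g : SimpleFunc Y V) :
    (P.withDensityᵥ h).integral g (innerSL ℝ) = ∫ x, inner ℝ (g x) (h x) ∂P := by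
  have := isFiniteMeasure_variation_withDensityᵥ hh
  have integrable_inner (g : SimpleFunc Y V) : Integrable (fun x => inner ℝ (g x) (h x)) P :=
    integrable_inner_of_norm_le hh g.stronglyMeasurable.aestronglyMeasurable
      g.exists_forall_norm_le.choose_spec
  induction g using SimpleFunc.induction with
  | @const c s hs =>
    classical
    have inner_indicator : (fun x => inner ℝ (s.indicator (Function.const Y c) x) (h x))
        = s.indicator (fun x => inner ℝ c (h x)) := by
      ext x
      by_cases hx : x ∈ s <;> simp [hx]
    rw [SimpleFunc.coe_piecewise, SimpleFunc.coe_const, SimpleFunc.coe_const, Function.const_zero,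
      Set.piecewise_eq_indicator, inner_indicator, integral_indicator hs]
    refine (VectorMeasure.integral_indicator_const _ hs).trans ?_
    rw [withDensityᵥ_apply hh hs]
    exact (integral_inner hh.integrableOn c).symm
  | @add f g _ hf hg =>
    rw [SimpleFunc.coe_add, VectorMeasure.integral_add f.integrable_of_isFiniteMeasure
      g.integrable_of_isFiniteMeasure, hf, hg,
      ← integral_add (integrable_inner f) (integrable_inner g)]
    simp only [Pi.add_apply, inner_add_left]

theorem integral_withDensityᵥ_innerSL (hh : Integrable h P) {f : Y → V}
    (hf : StronglyMeasurable f) {C : ℝ} (hC : ∀ x, ‖f x‖ ≤ C) :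
    (P.withDensityᵥ h).integral f (innerSL ℝ) = ∫ x, inner ℝ (f x) (h x) ∂P := by
  have := isFiniteMeasure_variation_withDensityᵥ hh
  have approx_le (n x) : ‖hf.approxBounded C n x‖ ≤ C :=
    hf.norm_approxBounded_le ((norm_nonneg _).trans (hC x)) n x
  have tendsto_approx (x) : Tendsto (fun n => hf.approxBounded C n x) atTop (𝓝 (f x)) :=
    hf.tendsto_approxBounded_of_norm_le (hC x)
  have tendsto_left : Tendsto
      (fun n => (P.withDensityᵥ h).integral (hf.approxBounded C n) (innerSL ℝ)) atTop
      (𝓝 ((P.withDensityᵥ h).integral f (innerSL ℝ))) :=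
    VectorMeasure.tendsto_integral_of_dominated_convergence (fun _ => C)
      (fun n => (hf.approxBounded C n).stronglyMeasurable.aestronglyMeasurable)
      (integrable_const _) (fun n => Eventually.of_forall (approx_le n))
      (Eventually.of_forall tendsto_approx)
  have tendsto_right : Tendsto (fun n => ∫ x, inner ℝ (hf.approxBounded C n x) (h x) ∂P) atTop
      (𝓝 (∫ x, inner ℝ (f x) (h x) ∂P)) :=
    tendsto_integral_of_dominated_convergence (fun x => C * ‖h x‖)
      (fun n => (hf.approxBounded C n).stronglyMeasurable.aestronglyMeasurable.inner hh.1)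
      (hh.norm.const_mul C)
      (fun n => Eventually.of_forall fun x => norm_inner_le_mul_of_norm_le (approx_le n x))
      (Eventually.of_forall fun x => (tendsto_approx x).inner tendsto_const_nhds)
  exact tendsto_nhds_unique
    (tendsto_left.congr fun n => integral_withDensityᵥ_innerSL_simpleFunc hh _) tendsto_right

end VectorMeasure

namespace IsRelCompactBorel

variable {E : Type*} [TopologicalSpace E] [MeasurableSpace E] {U B C K : Set E}

theorem mono (hB : IsRelCompactBorel U B) (hC : MeasurableSet C) (h : C ⊆ B) :
    IsRelCompactBorel U C := by
  obtain ⟨K, hK, hKU, hBK⟩ := hB.2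
  exact ⟨hC, K, hK, hKU, h.trans hBK⟩

theorem inter (hB : IsRelCompactBorel U B) (hC : MeasurableSet C) : IsRelCompactBorel U (B ∩ C) :=
  hB.mono (hB.1.inter hC) inter_subset_left

theorem subset (hB : IsRelCompactBorel U B) : B ⊆ U := by
  obtain ⟨K, -, hKU, hBK⟩ := hB.2
  exact hBK.trans hKU

theorem of_isCompact [T2Space E] [BorelSpace E] (hK : IsCompact K) (hKU : K ⊆ U) :
    IsRelCompactBorel U K :=
  ⟨hK.measurableSet, K, hK, hKU, Subset.rfl⟩

theorem measure_lt_top (hB : IsRelCompactBorel U B) {P : Measure E}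
    (hP : ∀ K, IsCompact K → K ⊆ U → P K < ⊤) : P B < ⊤ := by
  obtain ⟨K, hK, hKU, hBK⟩ := hB.2
  exact (measure_mono hBK).trans_lt (hP K hK hKU)

theorem integrableOn (hB : IsRelCompactBorel U B) {V : Type*} [NormedAddCommGroup V] {f : E → V}
    {P : Measure E} (hf : LocallyIntegrableOn f U P) : IntegrableOn f B P := by
  obtain ⟨K, hK, hKU, hBK⟩ := hB.2
  exact (hf.integrableOn_compact_subset hKU hK).mono_set hBK

end IsRelCompactBorel

namespace RadonVectorMeasure

variable {E : Type*} [TopologicalSpace E] [MeasurableSpace E] {U : Set E}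
  {V : Type*} [NormedAddCommGroup V]

theorem restrict_apply (μ : RadonVectorMeasure U V) {S : Set E} (hS : MeasurableSet S)
    (B : Set E) : μ.restrict S B = μ (B ∩ S) :=
  if_pos hS

theorem enorm_le_compactSup (μ : RadonVectorMeasure U V) {B : Set E}
    (hB : IsRelCompactBorel U B) : ‖μ B‖ₑ ≤ μ.compactSup B := by
  obtain ⟨K, hK, hKU, hBK⟩ := hB.2
  have h := le_iSup (fun K : {K : Set E // IsCompact K ∧ K ⊆ U} => ‖μ (B ∩ K)‖ₑ) ⟨K, hK, hKU⟩
  rwa [inter_eq_left.2 hBK] at h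

variable [T2Space E] [BorelSpace E]

theorem onCompact_apply (μ : RadonVectorMeasure U V) {K : Set E} (hK : IsCompact K)
    (hKU : K ⊆ U) {B : Set E} (hB : MeasurableSet B) : μ.onCompact K hK hKU B = μ (B ∩ K) :=
  if_pos hB

theorem onCompact_apply_of_subset (μ : RadonVectorMeasure U V) {K : Set E} (hK : IsCompact K)
    (hKU : K ⊆ U) {B : Set E} (hB : MeasurableSet B) (hBK : B ⊆ K) :
    μ.onCompact K hK hKU B = μ B := by
  rw [μ.onCompact_apply hK hKU hB, inter_eq_left.2 hBK]

theorem apply_union (μ : RadonVectorMeasure U V) {A B : Set E} (hA : IsRelCompactBorel U A)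
    (hB : IsRelCompactBorel U B) (hd : Disjoint A B) : μ (A ∪ B) = μ A + μ B := by
  obtain ⟨K, hK, hKU, hAK⟩ := hA.2
  obtain ⟨L, hL, hLU, hBL⟩ := hB.2
  have hKL := hK.union hL
  have hKLU := union_subset hKU hLU
  have h := (μ.onCompact (K ∪ L) hKL hKLU).of_union hd hA.1 hB.1
  rwa [μ.onCompact_apply_of_subset hKL hKLU (hA.1.union hB.1) (union_subset_union hAK hBL),
    μ.onCompact_apply_of_subset hKL hKLU hA.1 (hAK.trans subset_union_left),
    μ.onCompact_apply_of_subset hKL hKLU hB.1 (hBL.trans subset_union_right)] at h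

theorem variation_eq_preVariationFun (μ : RadonVectorMeasure U V) {s : Set E}
    (hs : MeasurableSet s) : μ.variation s = preVariationFun μ.compactSup s := by
  rw [variation, preVariation_apply, VectorMeasure.ennrealToMeasure_apply hs,
    ennrealPreVariation_apply]

theorem variation_apply_le (μ : RadonVectorMeasure U V) {s : Set E} (hs : MeasurableSet s)
    {P : Measure E} (h : ∀ B, IsRelCompactBorel U B → B ⊆ s → ‖μ B‖ₑ ≤ P B) :
    μ.variation s ≤ P s := by
  rw [variation_eq_preVariationFun μ hs, preVariationFun_apply _ hs, iSup_le_iff]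
  intro partition
  calc
    ∑ B ∈ partition.parts, μ.compactSup B ≤ ∑ B ∈ partition.parts, P B := by
      refine Finset.sum_le_sum fun B hB => iSup_le fun K => ?_
      have hBs : (B : Set E) ⊆ s := partition.le hB
      exact (h _ ⟨B.2.inter K.2.1.measurableSet, K, K.2.1, K.2.2, inter_subset_right⟩
        (inter_subset_left.trans hBs)).trans (measure_mono inter_subset_left)
    _ = P (⋃ B ∈ partition.parts, B) := by
      refine (measure_biUnion_finset ?_ fun B _ => B.property).symm
      intro A hA B hB hAB
      simpa [disjoint_iff, Subtype.ext_iff] using partition.disjoint hA hB hAB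
    _ ≤ P s := measure_mono (iUnion₂_subset fun _ hB => Subtype.coe_le_coe.2 (partition.le hB))

theorem enorm_le_variation (μ : RadonVectorMeasure U V) {B : Set E} (hB : IsRelCompactBorel U B) :
    ‖μ B‖ₑ ≤ μ.variation B := by
  rcases B.eq_empty_or_nonempty with rfl | hne
  · simp [apply_empty]
  refine (μ.enorm_le_compactSup hB).trans ?_
  rw [variation_eq_preVariationFun μ hB.1]
  have hB_ne_bot : (⟨B, hB.1⟩ : Subtype (MeasurableSet (α := E))) ≠ ⊥ :=
    fun h => hne.ne_empty (congrArg Subtype.val h)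
  simpa using preVariation.sum_le μ.compactSup hB.1 (Finpartition.indiscrete hB_ne_bot)

theorem apply_eq_zero (μ : RadonVectorMeasure U V) {B : Set E} (hB : IsRelCompactBorel U B)
    (h : μ.variation B = 0) : μ B = 0 :=
  enorm_eq_zero.1 (le_antisymm (h ▸ μ.enorm_le_variation hB) zero_le)

theorem variation_compl (μ : RadonVectorMeasure U V) (hU : MeasurableSet U) :
    μ.variation Uᶜ = 0 := by
  refine le_antisymm (μ.variation_apply_le hU.compl (P := 0) fun B hB hBU => ?_) zero_le
  have hB_empty : B = ∅ := subset_empty_iff.1 fun x hx => hBU hx (hB.subset hx)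
  simp [hB_empty, apply_empty]

theorem variation_restrict_le (μ : RadonVectorMeasure U V) {S : Set E} (hS : MeasurableSet S)
    {s : Set E} (hs : MeasurableSet s) : (μ.restrict S).variation s ≤ μ.variation s := by
  refine variation_apply_le _ hs fun B hB _ => ?_
  rw [μ.restrict_apply hS]
  exact (μ.enorm_le_variation (hB.inter hS)).trans (measure_mono inter_subset_left)

theorem variation_lt_top [NormedSpace ℝ V] [FiniteDimensional ℝ V] (μ : RadonVectorMeasure U V)
    {K : Set E} (hK : IsCompact K) (hKU : K ⊆ U) : μ.variation K < ⊤ := by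
  have := isFiniteMeasure_variation (μ.onCompact K hK hKU)
  refine (μ.variation_apply_le hK.measurableSet
    (P := (μ.onCompact K hK hKU).variation) fun B hB hBK => ?_).trans_lt (measure_lt_top _ _)
  rw [← μ.onCompact_apply_of_subset hK hKU hB.1 hBK]
  exact (μ.onCompact K hK hKU).enorm_measure_le_variation B

theorem onCompact_integral_eq [InnerProductSpace ℝ V] [CompleteSpace V]
    (μ : RadonVectorMeasure U V) {K : Set E} (hK : IsCompact K) (hKU : K ⊆ U) {P : Measure E}
    {h : E → V} (hh : IntegrableOn h K P)
    (hμ : ∀ B, MeasurableSet B → B ⊆ K → μ B = ∫ x in B, h x ∂P)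
    {f : E → V} (hf : StronglyMeasurable f) {C : ℝ} (hC : ∀ x, ‖f x‖ ≤ C) :
    (μ.onCompact K hK hKU).integral f (innerSL ℝ) = ∫ x in K, inner ℝ (f x) (h x) ∂P := by
  have onCompact_eq : μ.onCompact K hK hKU = (P.restrict K).withDensityᵥ h := by
    ext B hB
    rw [withDensityᵥ_apply hh hB, μ.onCompact_apply hK hKU hB,
      hμ _ (hB.inter hK.measurableSet) inter_subset_right, Measure.restrict_restrict hB]
  rw [onCompact_eq, integral_withDensityᵥ_innerSL hh hf hC]

end RadonVectorMeasure

section Divergence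

variable {E : Type*} [NormedAddCommGroup E] [NormedSpace ℝ E]

/-- The divergence of a vector field, i.e. the trace of its differential. -/
noncomputable def fieldDiv (Y : E → E) (x : E) : ℝ :=
  LinearMap.trace ℝ E (fderiv ℝ Y x).toLinearMap

theorem fieldDiv_of_notMem_tsupport {Y : E → E} {x : E} (hx : x ∉ tsupport Y) :
    fieldDiv Y x = 0 := by
  rw [fieldDiv, fderiv_of_notMem_tsupport ℝ hx, ContinuousLinearMap.toLinearMap_zero, map_zero]

theorem hasCompactSupport_fieldDiv {Y : E → E} (hc : HasCompactSupport Y) :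
    HasCompactSupport (fieldDiv Y) :=
  HasCompactSupport.intro hc fun _ hx => fieldDiv_of_notMem_tsupport hx

theorem hasCompactSupport_apply {ι α : Type*} [TopologicalSpace α]
    {φ : α → EuclideanSpace ℝ ι} (hc : HasCompactSupport φ) (i : ι) :
    HasCompactSupport fun x => φ x i :=
  hc.comp_left (g := fun v : EuclideanSpace ℝ ι => v i) rfl

theorem tsupport_apply_smul_subset {m : ℕ} (X : Fin m → E → E) (φ : E → EuclideanSpace ℝ (Fin m))
    (i : Fin m) : tsupport (fun y => φ y i • X i y) ⊆ tsupport φ :=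
  closure_mono fun y hy hφy => hy (by simp [hφy])

theorem divX_of_notMem_tsupport {m : ℕ} {X : Fin m → E → E} {φ : E → EuclideanSpace ℝ (Fin m)}
    {x : E} (hx : x ∉ tsupport φ) : divX X φ x = 0 :=
  Finset.sum_eq_zero fun i _ =>
    fieldDiv_of_notMem_tsupport fun h => hx (tsupport_apply_smul_subset X φ i h)

theorem hasCompactSupport_divX {m : ℕ} {X : Fin m → E → E} {φ : E → EuclideanSpace ℝ (Fin m)}
    (hc : HasCompactSupport φ) : HasCompactSupport (divX X φ) :=
  HasCompactSupport.intro hc fun _ hx => divX_of_notMem_tsupport hx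

theorem contDiff_extendedFields {m : ℕ} {X : Fin m → E → E} (hX : ∀ i, ContDiff ℝ 1 (X i))
    (i : Fin (m + 1)) : ContDiff ℝ 1 (extendedFields X i) := by
  refine Fin.lastCases ?_ (fun i => ?_) i
  · simpa [extendedFields] using contDiff_const
  · have : ContDiff ℝ 1 fun p : E × ℝ => (X i p.1, (0 : ℝ)) :=
      ((hX i).comp contDiff_fst).prodMk contDiff_const
    simpa [extendedFields] using this

theorem divX_extendedFields {m : ℕ} (X : Fin m → E → E)
    (φ : E × ℝ → EuclideanSpace ℝ (Fin (m + 1))) (p : E × ℝ) :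
    divX (extendedFields X) φ p =
      ∑ i : Fin m, fieldDiv (fun q : E × ℝ => φ q i.castSucc • (X i q.1, (0 : ℝ))) p
      + fieldDiv (fun q => φ q (Fin.last m) • ((0 : E), (1 : ℝ))) p := by
  simp only [divX, Fin.sum_univ_castSucc, fieldDiv, extendedFields, Fin.snoc_castSucc,
    Fin.snoc_last]

variable [FiniteDimensional ℝ E]

/-- The trace, as a continuous linear functional on endomorphisms. It gives the continuity of the
divergence and lets the divergence commute with integrals. -/
noncomputable def traceCLM (E : Type*) [NormedAddCommGroup E] [NormedSpace ℝ E]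
    [FiniteDimensional ℝ E] : (E →L[ℝ] E) →L[ℝ] ℝ :=
  LinearMap.toContinuousLinearMap ((LinearMap.trace ℝ E).comp (ContinuousLinearMap.coeLM ℝ))

theorem fieldDiv_eq_traceCLM (Y : E → E) (x : E) : fieldDiv Y x = traceCLM E (fderiv ℝ Y x) := rfl

theorem continuous_fieldDiv {Y : E → E} (hY : ContDiff ℝ 1 Y) : Continuous (fieldDiv Y) :=
  (traceCLM E).continuous.comp (hY.continuous_fderiv one_ne_zero)

theorem traceCLM_smulRight (f : E →L[ℝ] ℝ) (v : E) : traceCLM E (f.smulRight v) = f v :=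
  LinearMap.trace_smulRight f.toLinearMap v

theorem fieldDiv_smul {g : E → ℝ} {Y : E → E} {x : E} (hg : DifferentiableAt ℝ g x)
    (hY : DifferentiableAt ℝ Y x) :
    fieldDiv (fun y => g y • Y y) x = g x * fieldDiv Y x + fderiv ℝ g x (Y x) := by
  rw [fieldDiv_eq_traceCLM, fderiv_fun_smul hg hY, map_add, map_smul, smul_eq_mul,
    traceCLM_smulRight, fieldDiv_eq_traceCLM]

theorem fieldDiv_smul_const {g : E → ℝ} {x : E} (hg : DifferentiableAt ℝ g x) (w : E) :
    fieldDiv (fun y => g y • w) x = fderiv ℝ g x w := by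
  simp [fieldDiv_smul hg (differentiableAt_const w), fieldDiv_eq_traceCLM]

theorem fieldDiv_prodMk_zero {Y : E → E} {p : E × ℝ} (hY : DifferentiableAt ℝ Y p.1) :
    fieldDiv (fun q : E × ℝ => (Y q.1, (0 : ℝ))) p = fieldDiv Y p.1 := by
  have hasFDerivAt_extend : HasFDerivAt (fun q : E × ℝ => (Y q.1, (0 : ℝ)))
      (((fderiv ℝ Y p.1).comp (ContinuousLinearMap.fst ℝ E ℝ)).prod 0) p :=
    (hY.hasFDerivAt.comp p hasFDerivAt_fst).prodMk (hasFDerivAt_const _ _)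
  have factor : (((fderiv ℝ Y p.1).comp (ContinuousLinearMap.fst ℝ E ℝ)).prod
      (0 : E × ℝ →L[ℝ] ℝ)).toLinearMap
      = (LinearMap.inl ℝ E ℝ).comp ((fderiv ℝ Y p.1).toLinearMap.comp (LinearMap.fst ℝ E ℝ)) := by
    ext <;> simp
  rw [fieldDiv, hasFDerivAt_extend.fderiv, factor, LinearMap.trace_comp_comm',
    LinearMap.comp_assoc, LinearMap.fst_comp_inl, LinearMap.comp_id, fieldDiv]

theorem fieldDiv_smul_prodMk_zero {f : E × ℝ → ℝ} {Y : E → E} {p : E × ℝ}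
    (hf : DifferentiableAt ℝ f p) (hY : DifferentiableAt ℝ Y p.1) :
    fieldDiv (fun q : E × ℝ => f q • (Y q.1, (0 : ℝ))) p
      = f p * fieldDiv Y p.1 + fderiv ℝ f p (Y p.1, 0) := by
  have hY' : DifferentiableAt ℝ (fun q : E × ℝ => (Y q.1, (0 : ℝ))) p :=
    (hY.comp p differentiableAt_fst).prodMk (differentiableAt_const _)
  rw [fieldDiv_smul hf hY', fieldDiv_prodMk_zero hY]

theorem continuous_divX {m : ℕ} {X : Fin m → E → E} (hX : ∀ i, ContDiff ℝ 1 (X i))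
    {φ : E → EuclideanSpace ℝ (Fin m)} (hφ : ContDiff ℝ 1 φ) : Continuous (divX X φ) :=
  continuous_finsetSum _ fun i _ =>
    continuous_fieldDiv (Y := fun y => φ y i • X i y) (ContDiff.smul (by fun_prop) (hX i))

variable [MeasureSpace E] [BorelSpace E] [(volume : Measure E).IsAddHaarMeasure] {V : E → E}

theorem integral_fderiv_eq_zero (hV : ContDiff ℝ 1 V) (hc : HasCompactSupport V) :
    ∫ x, fderiv ℝ V x = 0 := by
  have integrable_fderiv : Integrable (fderiv ℝ V) :=
    (hV.continuous_fderiv one_ne_zero).integrable_of_hasCompactSupport (hc.fderiv ℝ)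
  ext1 v
  rw [ContinuousLinearMap.integral_apply integrable_fderiv]
  simpa using integral_smul_fderiv_eq_neg_fderiv_smul_of_integrable (𝕜 := ℝ)
    (μ := (volume : Measure E)) (f := fun _ : E => (1 : ℝ)) (g := V) (v := v)
    (by simp) (by simpa using integrable_fderiv.apply_continuousLinearMap v)
    (by simpa using hV.continuous.integrable_of_hasCompactSupport hc)
    (fun x _ => differentiableAt_const _) (fun x _ => hV.differentiable one_ne_zero x)

theorem integral_fieldDiv_eq_zero (hV : ContDiff ℝ 1 V) (hc : HasCompactSupport V) :
    ∫ x, fieldDiv V x = 0 := by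
  have integrable_fderiv : Integrable (fderiv ℝ V) :=
    (hV.continuous_fderiv one_ne_zero).integrable_of_hasCompactSupport (hc.fderiv ℝ)
  simp_rw [fieldDiv_eq_traceCLM]
  rw [ContinuousLinearMap.integral_comp_comm _ integrable_fderiv, integral_fderiv_eq_zero hV hc,
    map_zero]

end Divergence

section Graph

theorem measurableSet_lt_graph {E : Type*} [MeasurableSpace E] {v : E → ℝ} (hv : Measurable v) :
    MeasurableSet {p : E × ℝ | p.2 < v p.1} :=
  measurableSet_lt measurable_snd (hv.comp measurable_fst)

theorem hasCompactSupport_slice {E V : Type*} [TopologicalSpace E] [T2Space E] [Zero V]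
    {f : E × ℝ → V} (hc : HasCompactSupport f) (w : E → ℝ) :
    HasCompactSupport fun x => f (x, w x) :=
  HasCompactSupport.intro (hc.isCompact.image continuous_fst)
    fun _ hx => image_eq_zero_of_notMem_tsupport fun h => hx ⟨_, h, rfl⟩

/-- The shear `(x, s) ↦ (x, s + v x)`, which straightens the graph of `v`. -/
def shear {E : Type*} [TopologicalSpace E] (v : E → ℝ) (hv : Continuous v) :
    E × ℝ ≃ₜ E × ℝ where
  toFun p := (p.1, p.2 + v p.1)
  invFun p := (p.1, p.2 - v p.1)
  left_inv p := by simp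
  right_inv p := by simp
  continuous_toFun := by fun_prop
  continuous_invFun := by fun_prop

theorem integral_lt_graph {E : Type*} [MeasureSpace E] [SFinite (volume : Measure E)] {v : E → ℝ}
    (hv : Measurable v) {H : E × ℝ → ℝ} (hH : Integrable H) :
    ∫ p in {p : E × ℝ | p.2 < v p.1}, H p = ∫ x, ∫ t in Iio (v x), H (x, t) := by
  have hm := measurableSet_lt_graph hv
  rw [← integral_indicator hm, Measure.volume_eq_prod, integral_prod _ (hH.indicator hm)]
  refine integral_congr_ae (Eventually.of_forall fun x => ?_)
  simp only
  rw [← integral_indicator measurableSet_Iio]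
  rfl

variable {E : Type*} [NormedAddCommGroup E] [NormedSpace ℝ E]

theorem hasCompactSupport_fderiv_apply {f : E → ℝ} (hc : HasCompactSupport f) (w : E → E) :
    HasCompactSupport fun p => fderiv ℝ f p (w p) :=
  (hc.fderiv (𝕜 := ℝ)).mono fun p hp h0 => hp (by simp [h0])

theorem fderiv_comp_graph_apply {f : E × ℝ → ℝ} {v : E → ℝ} {x : E}
    (hf : DifferentiableAt ℝ f (x, v x)) (hv : DifferentiableAt ℝ v x) (w : E) :
    fderiv ℝ (fun x => f (x, v x)) x w
      = fderiv ℝ f (x, v x) (w, 0) + fderiv ℝ f (x, v x) (0, 1) * fderiv ℝ v x w := by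
  have hasFDerivAt_comp : HasFDerivAt (fun x => f (x, v x))
      ((fderiv ℝ f (x, v x)).comp ((ContinuousLinearMap.id ℝ E).prod (fderiv ℝ v x))) x :=
    hf.hasFDerivAt.comp x ((hasFDerivAt_id x).prodMk hv.hasFDerivAt)
  have split : ((w, fderiv ℝ v x w) : E × ℝ) = (w, 0) + fderiv ℝ v x w • ((0 : E), (1 : ℝ)) := by
    simp
  rw [hasFDerivAt_comp.fderiv, ContinuousLinearMap.comp_apply, ContinuousLinearMap.prod_apply,
    ContinuousLinearMap.id_apply, split, map_add, map_smul, smul_eq_mul, mul_comm]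

theorem integral_Iio_fderiv_snd {f : E × ℝ → ℝ} (hf : ContDiff ℝ 1 f) (hc : HasCompactSupport f)
    (x : E) (b : ℝ) : ∫ t in Iio b, fderiv ℝ f (x, t) (0, 1) = f (x, b) := by
  have isClosedEmbedding_slice : IsClosedEmbedding fun t : ℝ => (x, t) :=
    (Isometry.of_dist_eq fun s t => by simp [Prod.dist_eq]).isClosedEmbedding
  have hasDerivAt_slice (t : ℝ) :
      HasDerivAt (fun t => f (x, t)) (fderiv ℝ f (x, t) (0, 1)) t :=
    (hf.differentiable one_ne_zero (x, t)).hasFDerivAt.comp_hasDerivAt t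
      ((hasDerivAt_const t x).prodMk (hasDerivAt_id t))
  have tendsto_zero : Tendsto (fun t => f (x, t)) atBot (𝓝 0) := by
    have := (hc.comp_isClosedEmbedding isClosedEmbedding_slice).is_zero_at_infty
    rw [cocompact_eq_atBot_atTop] at this
    exact this.mono_left le_sup_left
  have continuous_deriv : Continuous fun t : ℝ => fderiv ℝ f (x, t) (0, 1) := by
    have := hf.continuous_fderiv one_ne_zero
    fun_prop
  have integrable_deriv : Integrable fun t : ℝ => fderiv ℝ f (x, t) (0, 1) :=
    continuous_deriv.integrable_of_hasCompactSupport
      ((hasCompactSupport_fderiv_apply hc fun _ => (0, 1)).comp_isClosedEmbedding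
        isClosedEmbedding_slice)
  rw [← integral_Iic_eq_integral_Iio, integral_Iic_of_hasDerivAt_of_tendsto'
    (fun t _ => hasDerivAt_slice t) integrable_deriv.integrableOn tendsto_zero, sub_zero]

/-- The horizontal derivatives `(X₁ v, …, X_m v, -1)` of `(x, t) ↦ v x - t`. -/
noncomputable def graphGradient {m : ℕ} (X : Fin m → E → E) (v : E → ℝ) (x : E) :
    EuclideanSpace ℝ (Fin (m + 1)) :=
  euclideanSnoc (WithLp.toLp 2 fun i => fderiv ℝ v x (X i x)) (-1)

theorem inner_graphGradient {m : ℕ} (X : Fin m → E → E) (v : E → ℝ) (x : E)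
    (w : EuclideanSpace ℝ (Fin (m + 1))) :
    inner ℝ w (graphGradient X v x)
      = ∑ i : Fin m, w i.castSucc * fderiv ℝ v x (X i x) - w (Fin.last m) := by
  rw [PiLp.inner_apply, Fin.sum_univ_castSucc]
  simp [graphGradient, euclideanSnoc, mul_comm, sub_eq_add_neg]

variable [FiniteDimensional ℝ E]
  [MeasureSpace E] [BorelSpace E] [(volume : Measure E).IsAddHaarMeasure] {v : E → ℝ}

theorem integral_lt_graph_eq_shear (hv : Continuous v) {H : E × ℝ → ℝ}
    (hH : Continuous H) (hc : HasCompactSupport H) :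
    ∫ p in {p : E × ℝ | p.2 < v p.1}, H p = ∫ s in Iio (0 : ℝ), ∫ x, H (x, s + v x) := by
  have := FiniteDimensional.proper_real E
  have integral_slice (x : E) :
      ∫ t in Iio (v x), H (x, t) = ∫ s in Iio (0 : ℝ), H (x, s + v x) := by
    rw [← integral_indicator measurableSet_Iio, ← integral_indicator measurableSet_Iio,
      ← integral_add_right_eq_self _ (v x)]
    congr 1
    ext s
    simp [indicator]
  have integrable_shear : Integrable fun p : E × ℝ => H (p.1, p.2 + v p.1) :=
    (hH.comp (shear v hv).continuous).integrable_of_hasCompactSupport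
      (hc.comp_homeomorph (shear v hv))
  rw [integral_lt_graph hv.measurable (hH.integrable_of_hasCompactSupport hc)]
  simp_rw [integral_slice]
  refine integral_integral_swap (f := fun x s => H (x, s + v x)) ?_
  have prod_restrict : (volume : Measure E).prod ((volume : Measure ℝ).restrict (Iio 0))
      = (volume : Measure (E × ℝ)).restrict (univ ×ˢ Iio 0) := by
    rw [Measure.volume_eq_prod, ← Measure.prod_restrict, Measure.restrict_univ]
  rw [prod_restrict]
  exact integrable_shear.integrableOn

theorem integral_lt_graph_fderiv_snd (hv : Continuous v) {f : E × ℝ → ℝ}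
    (hf : ContDiff ℝ 1 f) (hc : HasCompactSupport f) {c : E → ℝ} (hcc : Continuous c) :
    ∫ p in {p : E × ℝ | p.2 < v p.1}, fderiv ℝ f p (0, 1) * c p.1 = ∫ x, f (x, v x) * c x := by
  have := FiniteDimensional.proper_real E
  have := hf.continuous_fderiv one_ne_zero
  have integrable_mul : Integrable fun p : E × ℝ => fderiv ℝ f p (0, 1) * c p.1 :=
    Continuous.integrable_of_hasCompactSupport (by fun_prop)
      (hasCompactSupport_fderiv_apply hc _).mul_right
  rw [integral_lt_graph hv.measurable integrable_mul]
  simp_rw [integral_mul_const, integral_Iio_fderiv_snd hf hc]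

theorem integral_graph_fieldDiv {f : E × ℝ → ℝ} (hf : ContDiff ℝ 1 f) (hc : HasCompactSupport f)
    {Y : E → E} (hY : ContDiff ℝ 1 Y) (hv : ContDiff ℝ 1 v) :
    ∫ x, fieldDiv (fun q : E × ℝ => f q • (Y q.1, (0 : ℝ))) (x, v x)
      = - ∫ x, fderiv ℝ f (x, v x) (0, 1) * fderiv ℝ v x (Y x) := by
  have contDiff_field : ContDiff ℝ 1 fun q : E × ℝ => f q • (Y q.1, (0 : ℝ)) := by fun_prop
  have contDiff_slice : ContDiff ℝ 1 fun x => f (x, v x) := by fun_prop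
  have := hf.continuous_fderiv one_ne_zero
  have := hv.continuous_fderiv one_ne_zero
  have fieldDiv_slice (x : E) : fieldDiv (fun x => f (x, v x) • Y x) x
      = fieldDiv (fun q : E × ℝ => f q • (Y q.1, (0 : ℝ))) (x, v x)
        + fderiv ℝ f (x, v x) (0, 1) * fderiv ℝ v x (Y x) := by
    have hfx := hf.differentiable one_ne_zero (x, v x)
    have hYx := hY.differentiable one_ne_zero x
    rw [fieldDiv_smul (contDiff_slice.differentiable one_ne_zero x) hYx,
      fderiv_comp_graph_apply hfx (hv.differentiable one_ne_zero x),
      fieldDiv_smul_prodMk_zero hfx hYx, add_assoc]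
  have integrable_fieldDiv : Integrable fun x =>
      fieldDiv (fun q : E × ℝ => f q • (Y q.1, (0 : ℝ))) (x, v x) :=
    Continuous.integrable_of_hasCompactSupport
      ((continuous_fieldDiv contDiff_field).comp (continuous_id.prodMk hv.continuous))
      (hasCompactSupport_slice (hasCompactSupport_fieldDiv hc.smul_right) v)
  have integrable_fderiv_mul :
      Integrable fun x => fderiv ℝ f (x, v x) (0, 1) * fderiv ℝ v x (Y x) :=
    Continuous.integrable_of_hasCompactSupport (by fun_prop)
      (hasCompactSupport_slice (hasCompactSupport_fderiv_apply hc fun _ => (0, 1)) v).mul_right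
  have integral_slice : ∫ x, fieldDiv (fun x => f (x, v x) • Y x) x = 0 :=
    integral_fieldDiv_eq_zero (contDiff_slice.smul hY) (hasCompactSupport_slice hc v).smul_right
  simp_rw [fieldDiv_slice] at integral_slice
  rw [integral_add integrable_fieldDiv integrable_fderiv_mul] at integral_slice
  exact eq_neg_of_add_eq_zero_left integral_slice

theorem integral_lt_graph_fieldDiv (hv : ContDiff ℝ 1 v) {f : E × ℝ → ℝ}
    (hf : ContDiff ℝ 1 f) (hc : HasCompactSupport f) {Y : E → E} (hY : ContDiff ℝ 1 Y) :
    ∫ p in {p : E × ℝ | p.2 < v p.1}, fieldDiv (fun q : E × ℝ => f q • (Y q.1, (0 : ℝ))) p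
      = - ∫ x, f (x, v x) * fderiv ℝ v x (Y x) := by
  have continuous_fderiv_v : Continuous fun x => fderiv ℝ v x (Y x) :=
    (hv.continuous_fderiv one_ne_zero).clm_apply hY.continuous
  have := hf.continuous_fderiv one_ne_zero
  have contDiff_field : ContDiff ℝ 1 fun q : E × ℝ => f q • (Y q.1, (0 : ℝ)) := by fun_prop
  rw [← integral_lt_graph_fderiv_snd hv.continuous hf hc continuous_fderiv_v,
    integral_lt_graph_eq_shear hv.continuous (continuous_fieldDiv contDiff_field)
      (hasCompactSupport_fieldDiv hc.smul_right),
    integral_lt_graph_eq_shear (H := fun p => fderiv ℝ f p (0, 1) * fderiv ℝ v p.1 (Y p.1))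
      hv.continuous (by fun_prop) (hasCompactSupport_fderiv_apply hc _).mul_right,
    ← integral_neg]
  refine integral_congr_ae (Eventually.of_forall fun s => ?_)
  simpa using integral_graph_fieldDiv hf hc hY (contDiff_const (c := s) |>.add hv)

theorem integral_lt_graph_divX {m : ℕ} {X : Fin m → E → E} (hX : ∀ i, ContDiff ℝ 1 (X i))
    (hv : ContDiff ℝ 1 v) {φ : E × ℝ → EuclideanSpace ℝ (Fin (m + 1))}
    (hφ : ContDiff ℝ 1 φ) (hc : HasCompactSupport φ) :
    ∫ p in {p : E × ℝ | p.2 < v p.1}, divX (extendedFields X) φ p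
      = - ∫ x, inner ℝ (φ (x, v x)) (graphGradient X v x) := by
  have contDiff_apply (i) : ContDiff ℝ 1 fun q => φ q i := by fun_prop
  have hcφ (i) := hasCompactSupport_apply hc i
  have contDiff_slice (i) : ContDiff ℝ 1 fun x => φ (x, v x) i := by fun_prop
  have hcSlice (i) := hasCompactSupport_slice (hcφ i) v
  have integrable_fieldDiv {f : E × ℝ → ℝ} (hf : ContDiff ℝ 1 f) (hcf : HasCompactSupport f)
      {Y : E × ℝ → E × ℝ} (hY : ContDiff ℝ 1 Y) : IntegrableOn (fieldDiv fun q => f q • Y q)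
        {p | p.2 < v p.1} :=
    ((continuous_fieldDiv (hf.smul hY)).integrable_of_hasCompactSupport
      (hasCompactSupport_fieldDiv hcf.smul_right)).integrableOn
  have integrable_horizontal (i : Fin m) :
      Integrable fun x => φ (x, v x) i.castSucc * fderiv ℝ v x (X i x) :=
    ((contDiff_slice _).continuous.mul ((hv.continuous_fderiv one_ne_zero).clm_apply
      (hX i).continuous)).integrable_of_hasCompactSupport (hcSlice _).mul_right
  have integral_last := integral_lt_graph_fderiv_snd hv.continuous (contDiff_apply (Fin.last m))
    (hcφ _) (c := fun _ => 1) continuous_const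
  simp only [mul_one] at integral_last
  simp_rw [divX_extendedFields, inner_graphGradient]
  rw [integral_add, integral_finsetSum, integral_sub, integral_finsetSum]
  · simp_rw [integral_lt_graph_fieldDiv hv (contDiff_apply _) (hcφ _) (hX _),
      fieldDiv_smul_const ((contDiff_apply (Fin.last m)).differentiable one_ne_zero _),
      integral_last, Finset.sum_neg_distrib]
    ring
  · exact fun i _ => integrable_horizontal i
  · exact integrable_finsetSum _ fun i _ => integrable_horizontal i
  · exact (contDiff_slice _).continuous.integrable_of_hasCompactSupport (hcSlice _)
  · exact fun i _ => integrable_fieldDiv (contDiff_apply _) (hcφ _) (by fun_prop)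
  · exact integrable_finsetSum _ fun i _ =>
      integrable_fieldDiv (contDiff_apply _) (hcφ _) (by fun_prop)
  · exact integrable_fieldDiv (contDiff_apply _) (hcφ _) contDiff_const

end Graph

section Mollification

theorem tendsto_lintegral_translate_sub {E : Type*} [NormedAddCommGroup E] [ProperSpace E]
    [MeasureSpace E] [BorelSpace E] [(volume : Measure E).IsAddHaarMeasure] {w : E → ℝ}
    (hw : Integrable w) :
    Tendsto (fun h : E => ∫⁻ x, ‖w (x - h) - w x‖ₑ) (𝓝 0) (𝓝 0) := by
  have memLp_w : MemLp w 1 (volume : Measure E) := memLp_one_iff_integrable.2 hw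
  let W : Lp ℝ 1 (volume : Measure E) := memLp_w.toLp w
  let translate : E → C(E, E) := fun h => ⟨fun x => x - h, by fun_prop⟩
  have continuous_translate : Continuous translate :=
    (ContinuousMap.mk (fun p : E × E => p.2 - p.1) (by fun_prop)).curry.continuous
  have measurePreserving_translate (h : E) :
      MeasurePreserving (translate h) (volume : Measure E) volume :=
    measurePreserving_sub_right _ h
  let translateLp (h : E) := Lp.compMeasurePreserving _ (measurePreserving_translate h) W
  have continuous_translateLp : Continuous translateLp :=
    Continuous.compMeasurePreservingLp continuous_const continuous_translate
      measurePreserving_translate ENNReal.one_ne_top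
  have lintegral_eq_edist (h : E) : ∫⁻ x, ‖w (x - h) - w x‖ₑ = edist (translateLp h) W := by
    rw [Lp.edist_def, eLpNorm_one_eq_lintegral_enorm]
    refine lintegral_congr_ae ?_
    filter_upwards [Lp.coeFn_compMeasurePreserving W (measurePreserving_translate h),
      memLp_w.coeFn_toLp,
      (measurePreserving_translate h).quasiMeasurePreserving.ae_eq_comp memLp_w.coeFn_toLp]
      with x hx_comp hx hx_translate
    rw [Pi.sub_apply, hx_comp, hx, hx_translate]
    rfl
  have translateLp_zero : translateLp 0 = W :=
    edist_eq_zero.1 (by simpa using (lintegral_eq_edist 0).symm)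
  simp_rw [lintegral_eq_edist]
  simpa [translateLp_zero] using
    (continuous_translateLp.tendsto 0).edist (tendsto_const_nhds (x := W))

variable {E : Type*} [NormedAddCommGroup E] [NormedSpace ℝ E] [MeasureSpace E]

/-- A `C¹` probability density supported in the closed unit ball, used as a mollification
kernel. -/
structure IsMollifier (ρ : E → ℝ) : Prop where
  contDiff : ContDiff ℝ 1 ρ
  nonneg : ∀ z, 0 ≤ ρ z
  eq_zero : ∀ z, z ∉ Metric.closedBall (0 : E) 1 → ρ z = 0
  integral_eq_one : ∫ z, ρ z = 1

/-- The rescaled kernel `z ↦ ε⁻ⁿ ρ (z / ε)`. -/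
noncomputable def scaledKernel {E : Type*} [AddCommGroup E] [Module ℝ E] (ρ : E → ℝ) (ε : ℝ)
    (z : E) : ℝ :=
  (ε ^ Module.finrank ℝ E)⁻¹ * ρ (ε⁻¹ • z)

/-- The mollification of `w` at scale `ε`, i.e. its convolution with the rescaled kernel. -/
noncomputable def mollify (ρ : E → ℝ) (ε : ℝ) (w : E → ℝ) (x : E) : ℝ :=
  ∫ y, w y * scaledKernel ρ ε (x - y)

theorem mollify_eq_convolution (ρ : E → ℝ) (ε : ℝ) (w : E → ℝ) :
    mollify ρ ε w = convolution w (scaledKernel ρ ε) (ContinuousLinearMap.lsmul ℝ ℝ) volume := rfl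

namespace IsMollifier

variable {ρ : E → ℝ}

theorem tsupport_subset (hρ : IsMollifier ρ) : tsupport ρ ⊆ Metric.closedBall 0 1 :=
  closure_minimal (fun z hz => not_imp_comm.1 (hρ.eq_zero z) hz) Metric.isClosed_closedBall

theorem fderiv_eq_zero (hρ : IsMollifier ρ) {z : E} (hz : z ∉ Metric.closedBall (0 : E) 1) :
    fderiv ℝ ρ z = 0 :=
  fderiv_of_notMem_tsupport ℝ fun h => hz (hρ.tsupport_subset h)

theorem contDiff_scaledKernel (hρ : IsMollifier ρ) (ε : ℝ) : ContDiff ℝ 1 (scaledKernel ρ ε) :=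
  contDiff_const.mul (hρ.contDiff.comp (contDiff_const_smul _))

theorem scaledKernel_nonneg (hρ : IsMollifier ρ) {ε : ℝ} (hε : 0 < ε) (z : E) :
    0 ≤ scaledKernel ρ ε z :=
  mul_nonneg (by positivity) (hρ.nonneg _)

theorem scaledKernel_eq_zero (hρ : IsMollifier ρ) {ε : ℝ} (hε : 0 < ε) {z : E} (hz : ε < ‖z‖) :
    scaledKernel ρ ε z = 0 := by
  rw [scaledKernel, hρ.eq_zero, mul_zero]
  rw [mem_closedBall_zero_iff, norm_smul, norm_inv, Real.norm_of_nonneg hε.le, not_le,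
    ← div_eq_inv_mul, one_lt_div hε]
  exact hz

theorem tsupport_scaledKernel_subset (hρ : IsMollifier ρ) {ε : ℝ} (hε : 0 < ε) :
    tsupport (scaledKernel ρ ε) ⊆ Metric.closedBall 0 ε := by
  refine closure_minimal (fun z hz => ?_) Metric.isClosed_closedBall
  rw [mem_closedBall_zero_iff]
  exact not_lt.1 fun h => hz (hρ.scaledKernel_eq_zero hε h)

theorem fderiv_scaledKernel (hρ : IsMollifier ρ) (ε : ℝ) (z v : E) :
    fderiv ℝ (scaledKernel ρ ε) z v
      = (ε ^ Module.finrank ℝ E)⁻¹ * fderiv ℝ ρ (ε⁻¹ • z) (ε⁻¹ • v) := by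
  have hasFDerivAt_kernel := (((hρ.contDiff.differentiable one_ne_zero (ε⁻¹ • z)).hasFDerivAt).comp
    z ((hasFDerivAt_id z).const_smul ε⁻¹)).const_mul (ε ^ Module.finrank ℝ E)⁻¹
  refine (congrArg (· v) hasFDerivAt_kernel.fderiv).trans ?_
  simp

variable [FiniteDimensional ℝ E]

theorem hasCompactSupport (hρ : IsMollifier ρ) : HasCompactSupport ρ := by
  have := FiniteDimensional.proper_real E
  exact HasCompactSupport.intro (isCompact_closedBall 0 1) hρ.eq_zero

theorem hasCompactSupport_scaledKernel (hρ : IsMollifier ρ) {ε : ℝ} (hε : 0 < ε) :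
    HasCompactSupport (scaledKernel ρ ε) := by
  have := FiniteDimensional.proper_real E
  exact (isCompact_closedBall 0 ε).of_isClosed_subset (isClosed_tsupport _)
    (hρ.tsupport_scaledKernel_subset hε)

theorem exists_forall_norm_le (hρ : IsMollifier ρ) :
    ∃ C, 0 ≤ C ∧ ∀ z, ‖ρ z‖ ≤ C ∧ ‖fderiv ℝ ρ z‖ ≤ C := by
  obtain ⟨C, hC⟩ := hρ.contDiff.continuous.bounded_above_of_compact_support hρ.hasCompactSupport
  obtain ⟨D, hD⟩ := (hρ.contDiff.continuous_fderiv one_ne_zero).bounded_above_of_compact_support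
    (hρ.hasCompactSupport.fderiv ℝ)
  exact ⟨max C D, ((norm_nonneg _).trans (hC 0)).trans (le_max_left _ _),
    fun z => ⟨(hC z).trans (le_max_left _ _), (hD z).trans (le_max_right _ _)⟩⟩

variable [BorelSpace E]

theorem contDiff_mollify (hρ : IsMollifier ρ) {ε : ℝ} (hε : 0 < ε) {w : E → ℝ}
    (hw : Integrable w) : ContDiff ℝ 1 (mollify ρ ε w) := by
  rw [mollify_eq_convolution]
  exact (hρ.hasCompactSupport_scaledKernel hε).contDiff_convolution_right _
    hw.locallyIntegrable (hρ.contDiff_scaledKernel ε)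

end IsMollifier

variable [FiniteDimensional ℝ E] [BorelSpace E] [(volume : Measure E).IsAddHaarMeasure]

theorem exists_isMollifier (E : Type*) [NormedAddCommGroup E] [NormedSpace ℝ E] [MeasureSpace E]
    [FiniteDimensional ℝ E] [BorelSpace E] [(volume : Measure E).IsAddHaarMeasure] :
    ∃ ρ : E → ℝ, IsMollifier ρ := by
  let f : ContDiffBump (0 : E) := ⟨1 / 2, 1, by norm_num, by norm_num⟩
  refine ⟨f.normed volume, f.contDiff_normed, f.nonneg_normed, fun z hz => ?_, f.integral_normed⟩
  exact image_eq_zero_of_notMem_tsupport (by rwa [f.tsupport_normed_eq])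

theorem tendsto_lintegral_lintegral_translate_sub {w : E → ℝ} (hw : Integrable w)
    (hwm : Measurable w) {ε : ℕ → ℝ} (hε : Tendsto ε atTop (𝓝 0)) :
    Tendsto (fun k => ∫⁻ x, ∫⁻ z in Metric.closedBall (0 : E) 1, ‖w (x - ε k • z) - w x‖ₑ)
      atTop (𝓝 0) := by
  have := FiniteDimensional.proper_real E
  have measurable_sub (k) : Measurable fun p : E × E => ‖w (p.1 - ε k • p.2) - w p.1‖ₑ :=
    ((hwm.comp (by fun_prop : Continuous fun p : E × E => p.1 - ε k • p.2).measurable).sub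
      (hwm.comp measurable_fst)).enorm
  have swap (k) : ∫⁻ x, ∫⁻ z in Metric.closedBall (0 : E) 1, ‖w (x - ε k • z) - w x‖ₑ
      = ∫⁻ z in Metric.closedBall (0 : E) 1, ∫⁻ x, ‖w (x - ε k • z) - w x‖ₑ :=
    lintegral_lintegral_swap (measurable_sub k).aemeasurable
  have translate_le (h : E) : ∫⁻ x, ‖w (x - h) - w x‖ₑ ≤ 2 * ∫⁻ x, ‖w x‖ₑ :=
    calc ∫⁻ x, ‖w (x - h) - w x‖ₑ ≤ ∫⁻ x, (‖w (x - h)‖ₑ + ‖w x‖ₑ) :=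
          lintegral_mono fun x => enorm_sub_le
      _ = (∫⁻ x, ‖w (x - h)‖ₑ) + ∫⁻ x, ‖w x‖ₑ := lintegral_add_right _ hwm.enorm
      _ = 2 * ∫⁻ x, ‖w x‖ₑ := by
        rw [lintegral_sub_right_eq_self (fun x => ‖w x‖ₑ), two_mul]
  have tendsto_translate (z : E) :
      Tendsto (fun k => ∫⁻ x, ‖w (x - ε k • z) - w x‖ₑ) atTop (𝓝 0) :=
    (tendsto_lintegral_translate_sub hw).comp (by simpa using hε.smul_const z)
  simp_rw [swap]
  simpa using tendsto_lintegral_of_dominated_convergence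
    (μ := (volume : Measure E).restrict (Metric.closedBall 0 1)) (f := fun _ => 0)
    (F := fun k z => ∫⁻ x, ‖w (x - ε k • z) - w x‖ₑ)
    (fun _ => 2 * ∫⁻ x, ‖w x‖ₑ) (fun k => (measurable_sub k).lintegral_prod_left')
    (fun k => Eventually.of_forall fun z => translate_le _)
    (by
      rw [lintegral_const, Measure.restrict_apply_univ]
      exact ENNReal.mul_ne_top (ENNReal.mul_ne_top ENNReal.ofNat_ne_top hw.2.ne)
        (isCompact_closedBall _ _).measure_lt_top.ne)
    (Eventually.of_forall tendsto_translate)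

theorem integral_eq_pow_mul_integral_sub_smul (f : E → ℝ) (x : E) {ε : ℝ} (hε : 0 < ε) :
    ∫ y, f y = ε ^ Module.finrank ℝ E * ∫ z, f (x - ε • z) := by
  rw [Measure.integral_comp_smul_of_nonneg volume (fun y => f (x - y)) ε (hR := hε.le),
    integral_sub_left_eq_self f volume x, smul_eq_mul, ← mul_assoc, mul_inv_cancel₀, one_mul]
  positivity

theorem mollify_apply (ρ : E → ℝ) {ε : ℝ} (hε : 0 < ε) (w : E → ℝ) (x : E) :
    mollify ρ ε w x = ∫ z, w (x - ε • z) * ρ z := by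
  rw [mollify, integral_eq_pow_mul_integral_sub_smul _ x hε, ← integral_const_mul]
  refine integral_congr_ae (Eventually.of_forall fun z => ?_)
  simp only [scaledKernel, sub_sub_cancel, smul_smul, inv_mul_cancel₀ hε.ne', one_smul]
  field_simp

theorem enorm_integral_mul_sub_le {w κ : E → ℝ} {C : ℝ} (hw : Integrable w) (x : E)
    {ε : ℝ} (hε : 0 < ε) (hκ : Continuous κ) (hκC : ∀ z, ‖κ z‖ ≤ C)
    (hκ0 : ∀ z, z ∉ Metric.closedBall (0 : E) 1 → κ z = 0) :
    ‖(∫ z, w (x - ε • z) * κ z) - w x * ∫ z, κ z‖ₑ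
      ≤ ENNReal.ofReal C * ∫⁻ z in Metric.closedBall (0 : E) 1, ‖w (x - ε • z) - w x‖ₑ := by
  have := FiniteDimensional.proper_real E
  have integrable_κ : Integrable κ := hκ.integrable_of_hasCompactSupport
    (HasCompactSupport.intro (isCompact_closedBall 0 1) hκ0)
  have integrable_w : Integrable fun z => w (x - ε • z) :=
    (integrable_comp_smul_iff volume (fun y => w (x - y)) hε.ne').2 (hw.comp_sub_left x)
  have difference_eq :
      (∫ z, w (x - ε • z) * κ z) - w x * ∫ z, κ z = ∫ z, (w (x - ε • z) - w x) * κ z := by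
    simp_rw [sub_mul]
    rw [integral_sub (integrable_w.mul_bdd integrable_κ.1 (Eventually.of_forall hκC))
      (integrable_κ.const_mul _), integral_const_mul]
  rw [difference_eq]
  refine (enorm_integral_le_lintegral_enorm _).trans ?_
  rw [← lintegral_const_mul' _ _ ENNReal.ofReal_ne_top,
    ← lintegral_indicator measurableSet_closedBall]
  refine lintegral_mono fun z => ?_
  by_cases hz : z ∈ Metric.closedBall (0 : E) 1
  · rw [indicator_of_mem hz, enorm_mul, mul_comm]
    gcongr
    rw [← ofReal_norm]
    exact ENNReal.ofReal_le_ofReal (hκC z)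
  · simp [hκ0 z hz]

namespace IsMollifier

variable {ρ : E → ℝ}

theorem fderiv_mollify (hρ : IsMollifier ρ) {ε : ℝ} (hε : 0 < ε) {w : E → ℝ}
    (hw : Integrable w) (x v : E) :
    fderiv ℝ (mollify ρ ε w) x v = ∫ y, w y * fderiv ℝ (scaledKernel ρ ε) (x - y) v := by
  have hk := hρ.contDiff_scaledKernel ε
  have hkc := hρ.hasCompactSupport_scaledKernel hε
  rw [mollify_eq_convolution, (hkc.hasFDerivAt_convolution_right _ hw.locallyIntegrable
    hk x).fderiv, convolution_precompR_apply _ hw.locallyIntegrable (hkc.fderiv ℝ)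
    (hk.continuous_fderiv one_ne_zero)]
  rfl

theorem integral_scaledKernel (hρ : IsMollifier ρ) {ε : ℝ} (hε : 0 < ε) (x : E) :
    ∫ y, scaledKernel ρ ε (x - y) = 1 := by
  simpa [mollify, hρ.integral_eq_one] using mollify_apply ρ hε (fun _ => 1) x

theorem tendsto_lintegral_mollify_sub (hρ : IsMollifier ρ) {w : E → ℝ} (hw : Integrable w)
    (hwm : Measurable w) {ε : ℕ → ℝ} (hε0 : ∀ k, 0 < ε k) (hε : Tendsto ε atTop (𝓝 0)) :
    Tendsto (fun k => ∫⁻ x, ‖mollify ρ (ε k) w x - w x‖ₑ) atTop (𝓝 0) := by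
  obtain ⟨C, -, hCρ⟩ := hρ.exists_forall_norm_le
  have tendsto_bound := ENNReal.Tendsto.const_mul
    (tendsto_lintegral_lintegral_translate_sub hw hwm hε) (a := ENNReal.ofReal C)
    (Or.inr ENNReal.ofReal_ne_top)
  rw [mul_zero] at tendsto_bound
  refine tendsto_of_tendsto_of_tendsto_of_le_of_le tendsto_const_nhds tendsto_bound
    (fun _ => zero_le) fun k => ?_
  simp only
  rw [← lintegral_const_mul' _ _ ENNReal.ofReal_ne_top]
  refine lintegral_mono fun x => ?_
  simpa [hρ.integral_eq_one, mollify_apply ρ (hε0 k)] using enorm_integral_mul_sub_le hw x (hε0 k)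
    hρ.contDiff.continuous (fun z => (hCρ z).1) hρ.eq_zero

end IsMollifier

end Mollification

section Commutator

variable {E : Type*} [NormedAddCommGroup E] [NormedSpace ℝ E]

theorem norm_inv_smul_sub_le {Y : E → E} {x z : E} {L ε : ℝ}
    (hY : ∀ y ∈ Metric.closedBall x 1, DifferentiableAt ℝ Y y)
    (hL : ∀ y ∈ Metric.closedBall x 1, ‖fderiv ℝ Y y‖ ≤ L) (hε : 0 < ε)
    (hz : ‖z‖ ≤ 1) (hxz : x - ε • z ∈ Metric.closedBall x 1) :
    ‖ε⁻¹ • (Y x - Y (x - ε • z))‖ ≤ L := by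
  have hx : x ∈ Metric.closedBall x 1 := Metric.mem_closedBall_self zero_le_one
  have norm_sub_le : ‖Y x - Y (x - ε • z)‖ ≤ L * ε := by
    refine ((convex_closedBall x 1).norm_image_sub_le_of_norm_fderiv_le hY hL hxz hx).trans ?_
    rw [sub_sub_cancel, norm_smul, Real.norm_of_nonneg hε.le]
    exact mul_le_mul_of_nonneg_left (mul_le_of_le_one_right hε.le hz)
      ((norm_nonneg _).trans (hL x hx))
  rwa [norm_smul, norm_inv, Real.norm_of_nonneg hε.le, ← div_eq_inv_mul, div_le_iff₀ hε]

theorem tendsto_inv_smul_sub {Y : E → E} {x : E} (hY : DifferentiableAt ℝ Y x) {ε : ℕ → ℝ}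
    (hε0 : ∀ k, ε k ≠ 0) (hε : Tendsto ε atTop (𝓝 0)) (z : E) :
    Tendsto (fun k => (ε k)⁻¹ • (Y x - Y (x - ε k • z))) atTop (𝓝 (fderiv ℝ Y x z)) := by
  have hasDerivAt_line : HasDerivAt (fun t : ℝ => x - t • z) (-z) 0 := by
    simpa using ((hasDerivAt_id (0 : ℝ)).smul_const z).const_sub x
  have hasFDerivAt_Y : HasFDerivAt Y (fderiv ℝ Y x) (x - (0 : ℝ) • z) := by
    simpa using hY.hasFDerivAt
  have tendsto_slope := ((hasDerivAt_iff_tendsto_slope_zero.1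
    (hasFDerivAt_Y.comp_hasDerivAt (0 : ℝ) hasDerivAt_line)).comp
    (tendsto_nhdsWithin_iff.2 ⟨hε, Eventually.of_forall hε0⟩)).neg
  rw [map_neg, neg_neg] at tendsto_slope
  refine tendsto_slope.congr fun k => ?_
  simp [← smul_neg]

/-- The kernel `z ↦ ⟨∇ρ(z), (Y(x) - Y(x - εz))/ε⟩ + ρ(z) div Y(x - εz)` of the commutator of
mollification with the derivative along `Y`, in the rescaled variable `z = (x - y)/ε`. -/
noncomputable def commutatorKernel (ρ : E → ℝ) (Y : E → E) (ε : ℝ) (x z : E) : ℝ :=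
  fderiv ℝ ρ z (ε⁻¹ • (Y x - Y (x - ε • z))) + ρ z * fieldDiv Y (x - ε • z)

variable [MeasureSpace E]

/-- The commutator `Y(ρ_ε * w) - ρ_ε * (Y w)` of mollification with the derivative along `Y`,
with the derivative of `w` moved onto the kernel so that it makes sense for integrable `w`. -/
noncomputable def mollifyCommutator (ρ : E → ℝ) (Y : E → E) (w : E → ℝ) (ε : ℝ) (x : E) : ℝ :=
  ∫ z, w (x - ε • z) * commutatorKernel ρ Y ε x z

namespace IsMollifier

variable {ρ : E → ℝ} {Y : E → E}

theorem commutatorKernel_eq_zero (hρ : IsMollifier ρ) (ε : ℝ) (x : E) {z : E}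
    (hz : z ∉ Metric.closedBall (0 : E) 1) : commutatorKernel ρ Y ε x z = 0 := by
  simp [commutatorKernel, hρ.fderiv_eq_zero hz, hρ.eq_zero z hz]

variable [FiniteDimensional ℝ E]

theorem fieldDiv_scaledKernel_smul (hρ : IsMollifier ρ) (hY : ContDiff ℝ 1 Y) (ε : ℝ) (x y : E) :
    fieldDiv (fun y' => scaledKernel ρ ε (x - y') • Y y') y
      = scaledKernel ρ ε (x - y) * fieldDiv Y y - fderiv ℝ (scaledKernel ρ ε) (x - y) (Y y) := by
  have hasFDerivAt_kernel : HasFDerivAt (fun y' => scaledKernel ρ ε (x - y'))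
      (-fderiv ℝ (scaledKernel ρ ε) (x - y)) y := by
    convert! (((hρ.contDiff_scaledKernel ε).differentiable one_ne_zero (x - y)).hasFDerivAt).comp
      y ((hasFDerivAt_id y).const_sub x) using 1
    ext v
    simp
  rw [fieldDiv_smul hasFDerivAt_kernel.differentiableAt (hY.differentiable one_ne_zero y),
    hasFDerivAt_kernel.fderiv]
  simp [sub_eq_add_neg]

theorem continuous_commutatorKernel (hρ : IsMollifier ρ) (hY : ContDiff ℝ 1 Y)
    (ε : ℝ) : Continuous fun p : E × E => commutatorKernel ρ Y ε p.1 p.2 := by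
  have := hρ.contDiff.continuous
  have := hρ.contDiff.continuous_fderiv one_ne_zero
  have := hY.continuous
  have := continuous_fieldDiv hY
  unfold commutatorKernel
  fun_prop

theorem exists_forall_norm_commutatorKernel_le (hρ : IsMollifier ρ) (hY : ContDiff ℝ 1 Y)
    {K : Set E} (hK : IsCompact K) : ∃ C, 0 ≤ C ∧ ∀ ε, 0 < ε → ε ≤ 1 → ∀ x ∈ K, ∀ z,
      ‖commutatorKernel ρ Y ε x z‖ ≤ C := by
  have := FiniteDimensional.proper_real E
  obtain ⟨C, hC, hCρ⟩ := hρ.exists_forall_norm_le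
  have hK' : IsCompact (Metric.cthickening 1 K) := hK.cthickening
  obtain ⟨L, hL⟩ := hK'.exists_bound_of_continuousOn
    (hY.continuous_fderiv one_ne_zero).continuousOn
  obtain ⟨D, hD⟩ := hK'.exists_bound_of_continuousOn (continuous_fieldDiv hY).continuousOn
  refine ⟨C * max L 0 + C * max D 0, by positivity, fun ε hε hε1 x hx z => ?_⟩
  by_cases hz : z ∈ Metric.closedBall (0 : E) 1
  swap
  · rw [hρ.commutatorKernel_eq_zero ε x hz, norm_zero]
    positivity
  rw [mem_closedBall_zero_iff] at hz
  have ball_subset : Metric.closedBall x 1 ⊆ Metric.cthickening 1 K :=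
    Metric.closedBall_subset_cthickening hx 1
  have hxz : x - ε • z ∈ Metric.closedBall x 1 := by
    rw [Metric.mem_closedBall, dist_eq_norm, sub_sub_cancel_left, norm_neg, norm_smul,
      Real.norm_of_nonneg hε.le]
    exact mul_le_one₀ hε1 (norm_nonneg _) hz
  refine (norm_add_le _ _).trans (add_le_add ?_ ?_)
  · refine ((fderiv ℝ ρ z).le_opNorm _).trans (mul_le_mul (hCρ z).2 ?_ (norm_nonneg _) hC)
    exact (norm_inv_smul_sub_le (fun y _ => hY.differentiable one_ne_zero y)
      (fun y hy => hL y (ball_subset hy)) hε hz hxz).trans (le_max_left _ _)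
  · rw [norm_mul]
    exact mul_le_mul (hCρ z).1 ((hD _ (ball_subset hxz)).trans (le_max_left _ _))
      (norm_nonneg _) hC

variable [BorelSpace E] [(volume : Measure E).IsAddHaarMeasure]

theorem fderiv_mollify_add_integral (hρ : IsMollifier ρ) (hY : ContDiff ℝ 1 Y) {w : E → ℝ}
    (hw : Integrable w) {ε : ℝ} (hε : 0 < ε) (x : E) :
    fderiv ℝ (mollify ρ ε w) x (Y x)
      + ∫ y, w y * fieldDiv (fun y' => scaledKernel ρ ε (x - y') • Y y') y
      = mollifyCommutator ρ Y w ε x := by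
  have hk := hρ.contDiff_scaledKernel ε
  have hkc := hρ.hasCompactSupport_scaledKernel hε
  have integrable_mul {c : E → ℝ} (hc : Continuous c) (hcc : HasCompactSupport c) :
      Integrable fun y => w y * c y :=
    hw.mul_bdd hc.aestronglyMeasurable
      (Eventually.of_forall (hc.bounded_above_of_compact_support hcc).choose_spec)
  have hasCompactSupport_sub {c : E → ℝ} (hc : HasCompactSupport c) :
      HasCompactSupport fun y => c (x - y) :=
    hc.comp_homeomorph (Homeomorph.subLeft x)
  have continuous_fderiv : Continuous fun y => fderiv ℝ (scaledKernel ρ ε) (x - y) (Y x) := by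
    have := hk.continuous_fderiv one_ne_zero
    fun_prop
  have contDiff_field : ContDiff ℝ 1 fun y => scaledKernel ρ ε (x - y) • Y y :=
    (hk.comp (contDiff_const.sub contDiff_id)).smul hY
  rw [hρ.fderiv_mollify hε hw, ← integral_add
    (integrable_mul continuous_fderiv
      (hasCompactSupport_sub (hasCompactSupport_fderiv_apply hkc fun _ => Y x)))
    (integrable_mul (continuous_fieldDiv contDiff_field)
      (hasCompactSupport_fieldDiv (hasCompactSupport_sub hkc).smul_right)),
    mollifyCommutator, integral_eq_pow_mul_integral_sub_smul _ x hε, ← integral_const_mul]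
  refine integral_congr_ae (Eventually.of_forall fun z => ?_)
  simp only
  rw [hρ.fieldDiv_scaledKernel_smul hY, hρ.fderiv_scaledKernel, hρ.fderiv_scaledKernel,
    commutatorKernel, scaledKernel, sub_sub_cancel, smul_smul, inv_mul_cancel₀ hε.ne', one_smul,
    smul_sub, map_sub]
  field_simp
  ring

/-- This is the integral of the divergence of `z ↦ ρ(z) Y'(x) z`. -/
theorem integral_commutatorKernel_limit (hρ : IsMollifier ρ) (x : E) :
    ∫ z, (fderiv ℝ ρ z (fderiv ℝ Y x z) + ρ z * fieldDiv Y x) = 0 := by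
  have contDiff_linear : ContDiff ℝ 1 (fderiv ℝ Y x) := (fderiv ℝ Y x).contDiff
  rw [← integral_fieldDiv_eq_zero (V := fun z => ρ z • fderiv ℝ Y x z)
    (hρ.contDiff.smul contDiff_linear) hρ.hasCompactSupport.smul_right]
  refine integral_congr_ae (Eventually.of_forall fun z => ?_)
  simp only
  rw [fieldDiv_smul (hρ.contDiff.differentiable one_ne_zero z)
    (contDiff_linear.differentiable one_ne_zero z), add_comm]
  simp [fieldDiv]

theorem tendsto_integral_commutatorKernel (hρ : IsMollifier ρ) (hY : ContDiff ℝ 1 Y)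
    {ε : ℕ → ℝ} (hε0 : ∀ k, 0 < ε k) (hε1 : ∀ k, ε k ≤ 1) (hε : Tendsto ε atTop (𝓝 0)) (x : E) :
    Tendsto (fun k => ∫ z, commutatorKernel ρ Y (ε k) x z) atTop (𝓝 0) := by
  have := FiniteDimensional.proper_real E
  obtain ⟨C, -, hCb⟩ := hρ.exists_forall_norm_commutatorKernel_le hY (isCompact_singleton (x := x))
  rw [← hρ.integral_commutatorKernel_limit (Y := Y) x]
  refine tendsto_integral_of_dominated_convergence
    ((Metric.closedBall (0 : E) 1).indicator fun _ => C) (fun k => ?_) ?_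
    (fun k => Eventually.of_forall fun z => ?_) (Eventually.of_forall fun z => ?_)
  · exact ((hρ.continuous_commutatorKernel hY (ε k)).comp
      (by fun_prop : Continuous fun z : E => (x, z))).aestronglyMeasurable
  · exact (integrable_indicator_iff measurableSet_closedBall).2
      (integrableOn_const (isCompact_closedBall _ _).measure_lt_top.ne)
  · by_cases hz : z ∈ Metric.closedBall (0 : E) 1
    · rw [indicator_of_mem hz]
      exact hCb _ (hε0 k) (hε1 k) x rfl z
    · rw [indicator_of_notMem hz, hρ.commutatorKernel_eq_zero _ _ hz, norm_zero]
  · have tendsto_point : Tendsto (fun k => x - ε k • z) atTop (𝓝 x) := by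
      simpa using (hε.smul_const z).const_sub x
    exact (((fderiv ℝ ρ z).continuous.tendsto _).comp (tendsto_inv_smul_sub
      (hY.differentiable one_ne_zero x) (fun k => (hε0 k).ne') hε z)).add
      (((continuous_fieldDiv hY).tendsto x).comp tendsto_point |>.const_mul _)

theorem tendsto_lintegral_mul_integral_commutatorKernel (hρ : IsMollifier ρ)
    (hY : ContDiff ℝ 1 Y) {w : E → ℝ} (hw : Integrable w) (hwm : Measurable w) {ε : ℕ → ℝ}
    (hε0 : ∀ k, 0 < ε k) (hε1 : ∀ k, ε k ≤ 1) (hε : Tendsto ε atTop (𝓝 0))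
    {K : Set E} (hK : IsCompact K) :
    Tendsto (fun k => ∫⁻ x in K, ‖w x * ∫ z, commutatorKernel ρ Y (ε k) x z‖ₑ) atTop (𝓝 0) := by
  have := FiniteDimensional.proper_real E
  obtain ⟨C, -, hCb⟩ := hρ.exists_forall_norm_commutatorKernel_le hY hK
  set B := C * volume.real (Metric.closedBall (0 : E) 1)
  have enorm_integral_le (k) (x) (hx : x ∈ K) :
      ‖∫ z, commutatorKernel ρ Y (ε k) x z‖ₑ ≤ ENNReal.ofReal B := by
    rw [← setIntegral_eq_integral_of_forall_compl_eq_zero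
      fun z hz => hρ.commutatorKernel_eq_zero (ε k) x hz, ← ofReal_norm]
    exact ENNReal.ofReal_le_ofReal (norm_setIntegral_le_of_norm_le_const
      (isCompact_closedBall _ _).measure_lt_top fun z _ => hCb _ (hε0 k) (hε1 k) x hx z)
  have measurable_integral (k) : Measurable fun x => ∫ z, commutatorKernel ρ Y (ε k) x z :=
    (hρ.continuous_commutatorKernel hY
      (ε k)).stronglyMeasurable.integral_prod_right'.measurable
  simpa using tendsto_lintegral_of_dominated_convergence (μ := (volume : Measure E).restrict K)
    (F := fun k x => ‖w x * ∫ z, commutatorKernel ρ Y (ε k) x z‖ₑ) (f := fun _ => 0)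
    (fun x => ‖w x‖ₑ * ENNReal.ofReal B)
    (fun k => (hwm.mul (measurable_integral k)).enorm)
    (fun k => (ae_restrict_iff' hK.measurableSet).2 (Eventually.of_forall fun x hx => by
      simpa only [enorm_mul] using mul_le_mul_right (enorm_integral_le k x hx) _))
    (by
      rw [lintegral_mul_const _ hwm.enorm]
      exact ENNReal.mul_ne_top hw.integrableOn.2.ne ENNReal.ofReal_ne_top)
    (Eventually.of_forall fun x => by
      simpa using
        ((hρ.tendsto_integral_commutatorKernel hY hε0 hε1 hε x).const_mul (w x)).enorm)

/-- Friedrichs' lemma. The commutator kernels are uniformly bounded with integrals tending to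
zero, so the commutator is controlled by the `L¹` modulus of continuity of `w`. -/
theorem tendsto_lintegral_mollifyCommutator (hρ : IsMollifier ρ) (hY : ContDiff ℝ 1 Y) {w : E → ℝ}
    (hw : Integrable w) (hwm : Measurable w) {ε : ℕ → ℝ} (hε0 : ∀ k, 0 < ε k)
    (hε1 : ∀ k, ε k ≤ 1) (hε : Tendsto ε atTop (𝓝 0)) {K : Set E} (hK : IsCompact K) :
    Tendsto (fun k => ∫⁻ x in K, ‖mollifyCommutator ρ Y w (ε k) x‖ₑ) atTop (𝓝 0) := by
  have := FiniteDimensional.proper_real E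
  obtain ⟨C, -, hCb⟩ := hρ.exists_forall_norm_commutatorKernel_le hY hK
  have continuous_kernel (k x) : Continuous (commutatorKernel ρ Y (ε k) x) :=
    (hρ.continuous_commutatorKernel hY (ε k)).comp (by fun_prop : Continuous fun z : E => (x, z))
  have tendsto_modulus := ENNReal.Tendsto.const_mul
    (tendsto_lintegral_lintegral_translate_sub hw hwm hε) (a := ENNReal.ofReal C)
    (Or.inr ENNReal.ofReal_ne_top)
  have tendsto_bound := tendsto_modulus.add
    (hρ.tendsto_lintegral_mul_integral_commutatorKernel hY hw hwm hε0 hε1 hε hK)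
  rw [mul_zero, add_zero] at tendsto_bound
  refine tendsto_of_tendsto_of_tendsto_of_le_of_le tendsto_const_nhds tendsto_bound
    (fun _ => zero_le) fun k => ?_
  have measurable_mul_integral :
      Measurable fun x => ‖w x * ∫ z, commutatorKernel ρ Y (ε k) x z‖ₑ :=
    (hwm.mul (hρ.continuous_commutatorKernel hY
      (ε k)).stronglyMeasurable.integral_prod_right'.measurable).enorm
  simp only
  rw [← lintegral_const_mul' _ _ ENNReal.ofReal_ne_top]
  refine le_trans ?_ (add_le_add_left (setLIntegral_le_lintegral K _) _)
  rw [← lintegral_add_right _ measurable_mul_integral]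
  refine setLIntegral_mono' hK.measurableSet fun x hx => ?_
  rw [← sub_add_cancel (mollifyCommutator ρ Y w (ε k) x)
    (w x * ∫ z, commutatorKernel ρ Y (ε k) x z)]
  exact (enorm_add_le _ _).trans (add_le_add_left (enorm_integral_mul_sub_le hw x (hε0 k)
    (continuous_kernel k x) (hCb _ (hε0 k) (hε1 k) x hx)
    fun z hz => hρ.commutatorKernel_eq_zero _ _ hz) _)

end IsMollifier

end Commutator

section GraphMeasure

@[simp]
theorem euclideanSnoc_castSucc {m : ℕ} (v : EuclideanSpace ℝ (Fin m)) (t : ℝ) (i : Fin m) :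
    euclideanSnoc v t i.castSucc = v i := by
  simp [euclideanSnoc]

@[simp]
theorem euclideanSnoc_last {m : ℕ} (v : EuclideanSpace ℝ (Fin m)) (t : ℝ) :
    euclideanSnoc v t (Fin.last m) = t := by
  simp [euclideanSnoc]

theorem enorm_le_sum_enorm_apply {ι : Type*} [Fintype ι] (v : EuclideanSpace ℝ ι) :
    ‖v‖ₑ ≤ ∑ i, ‖v i‖ₑ := by
  classical
  calc ‖v‖ₑ = ‖∑ i, EuclideanSpace.single i (v i)‖ₑ := by
        congr 1
        ext j
        simp [Pi.single_apply]
    _ ≤ ∑ i, ‖EuclideanSpace.single i (v i)‖ₑ := enorm_sum_le _ _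
    _ = ∑ i, ‖v i‖ₑ := by simp_rw [← ofReal_norm, PiLp.norm_single]

variable {E : Type*} [NormedAddCommGroup E] [NormedSpace ℝ E] {m : ℕ} {X : Fin m → E → E}

/-- The divergence, along the family `X` of vector fields on `E`, of the first `m` components
of `g`. -/
noncomputable def horizontalDiv (X : Fin m → E → E) (g : E → EuclideanSpace ℝ (Fin (m + 1)))
    (x : E) : ℝ :=
  ∑ i : Fin m, fieldDiv (fun y => g y i.castSucc • X i y) x

theorem horizontalDiv_smul_single_castSucc (X : Fin m → E → E) (f : E → ℝ) (i : Fin m) (x : E) :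
    horizontalDiv X (fun y => f y • EuclideanSpace.single i.castSucc (1 : ℝ)) x
      = fieldDiv (fun y => f y • X i y) x := by
  rw [horizontalDiv, Finset.sum_eq_single i (fun l _ hl => by simp [fieldDiv, hl]) (by simp)]
  simp

theorem horizontalDiv_smul_single_last (X : Fin m → E → E) (f : E → ℝ) (x : E) :
    horizontalDiv X (fun y => f y • EuclideanSpace.single (Fin.last m) (1 : ℝ)) x = 0 :=
  Finset.sum_eq_zero fun i _ => by simp [fieldDiv, (Fin.castSucc_lt_last i).ne]

variable [MeasureSpace E]

/-- `τ M` is the polar-type representation, with `|τ| ≤ 1`, of the vector measure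
`(D_H w, -ℒⁿ)` on `Ω`, which is the limit of the graph gradients of mollifications of `w`. -/
structure IsGraphMeasure (X : Fin m → E → E) (Ω : Set E) (w : E → ℝ) (M : Measure E)
    (τ : E → EuclideanSpace ℝ (Fin (m + 1))) : Prop where
  measurable : Measurable τ
  norm_le_one : ∀ x, ‖τ x‖ ≤ 1
  lt_top : ∀ K, IsCompact K → K ⊆ Ω → M K < ⊤
  integral_inner : ∀ g : E → EuclideanSpace ℝ (Fin (m + 1)), ContDiff ℝ 1 g →
    HasCompactSupport g → tsupport g ⊆ Ω →
    ∫ x, inner ℝ (g x) (τ x) ∂M = -(∫ x, w x * horizontalDiv X g x) - ∫ x, g x (Fin.last m)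

variable {Ω : Set E} {w : E → ℝ} {M : Measure E} {τ : E → EuclideanSpace ℝ (Fin (m + 1))}
  {ρ : E → ℝ}

theorem IsMollifier.scaledKernel_sub_eq_zero (hρ : IsMollifier ρ) {ε : ℝ} (hε : 0 < ε) {x y : E}
    (hy : y ∉ Metric.closedBall x ε) : scaledKernel ρ ε (x - y) = 0 := by
  refine hρ.scaledKernel_eq_zero hε ?_
  rwa [Metric.mem_closedBall, dist_comm, dist_eq_norm, not_le] at hy

theorem IsMollifier.tsupport_scaledKernel_sub_subset (hρ : IsMollifier ρ) {ε : ℝ} (hε : 0 < ε)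
    (x : E) : tsupport (fun y => scaledKernel ρ ε (x - y)) ⊆ Metric.closedBall x ε :=
  closure_minimal (fun _ hy => not_imp_comm.1 (hρ.scaledKernel_sub_eq_zero hε) hy)
    Metric.isClosed_closedBall

variable [BorelSpace E]

theorem IsGraphMeasure.integrable_smul (h : IsGraphMeasure X Ω w M τ) {f : E → ℝ}
    (hf : Continuous f) (hc : HasCompactSupport f) (hs : tsupport f ⊆ Ω) :
    Integrable (fun y => f y • τ y) M := by
  obtain ⟨C, hC⟩ := hf.bounded_above_of_compact_support hc
  have integrableOn_tsupport : IntegrableOn (fun y => f y • τ y) (tsupport f) M := by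
    refine Measure.integrableOn_of_bounded (M := C) (h.lt_top _ hc hs).ne
      (hf.measurable.smul h.measurable).aestronglyMeasurable (Eventually.of_forall fun y => ?_)
    rw [norm_smul]
    exact (mul_le_of_le_one_right (norm_nonneg _) (h.norm_le_one y)).trans (hC y)
  refine (integrableOn_iff_integrable_of_support_subset fun y hy => ?_).1 integrableOn_tsupport
  exact subset_tsupport f fun hfy => hy (by simp [hfy])

theorem IsGraphMeasure.integral_smul_apply (h : IsGraphMeasure X Ω w M τ) {f : E → ℝ}
    (hf : ContDiff ℝ 1 f) (hc : HasCompactSupport f) (hs : tsupport f ⊆ Ω) (j : Fin (m + 1)) :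
    (∫ y, f y • τ y ∂M) j
      = -(∫ y, w y * horizontalDiv X (fun y => f y • EuclideanSpace.single j (1 : ℝ)) y)
        - ∫ y, (f y • EuclideanSpace.single j (1 : ℝ)) (Fin.last m) := by
  rw [← h.integral_inner (fun y => f y • EuclideanSpace.single j (1 : ℝ))
    (hf.smul contDiff_const) hc.smul_right ((tsupport_smul_subset_left _ _).trans hs)]
  refine ((EuclideanSpace.proj (𝕜 := ℝ) j).integral_comp_comm
    (h.integrable_smul hf.continuous hc hs)).symm.trans ?_
  refine integral_congr_ae (Eventually.of_forall fun y => ?_)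
  simp [real_inner_smul_left, EuclideanSpace.inner_single_left]

variable [FiniteDimensional ℝ E]

theorem IsMollifier.measurable_mollifyCommutator {Y : E → E} (hρ : IsMollifier ρ)
    (hY : ContDiff ℝ 1 Y) (hwm : Measurable w) (ε : ℝ)
    [SFinite (volume : Measure E)] : Measurable (mollifyCommutator ρ Y w ε) := by
  have measurable_kernel := (hρ.continuous_commutatorKernel hY ε).measurable
  have measurable_w : Measurable fun p : E × E => w (p.1 - ε • p.2) :=
    hwm.comp (by fun_prop : Continuous fun p : E × E => p.1 - ε • p.2).measurable
  exact (measurable_w.mul measurable_kernel).stronglyMeasurable.integral_prod_right'.measurable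

variable [(volume : Measure E).IsAddHaarMeasure]

theorem IsGraphMeasure.graphGradient_mollify (h : IsGraphMeasure X Ω w M τ)
    (hρ : IsMollifier ρ) (hX : ∀ i, ContDiff ℝ 1 (X i)) (hw : Integrable w) {ε : ℝ} (hε : 0 < ε)
    {x : E} (hx : Metric.closedBall x ε ⊆ Ω) :
    graphGradient X (mollify ρ ε w) x = (∫ y, scaledKernel ρ ε (x - y) • τ y ∂M)
      + euclideanSnoc (WithLp.toLp 2 fun i => mollifyCommutator ρ (X i) w ε x) 0 := by
  have := FiniteDimensional.proper_real E
  have contDiff_kernel : ContDiff ℝ 1 fun y => scaledKernel ρ ε (x - y) :=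
    (hρ.contDiff_scaledKernel ε).comp (contDiff_const.sub contDiff_id)
  have tsupport_subset := hρ.tsupport_scaledKernel_sub_subset hε x
  have hasCompactSupport_kernel : HasCompactSupport fun y => scaledKernel ρ ε (x - y) :=
    (isCompact_closedBall x ε).of_isClosed_subset (isClosed_tsupport _) tsupport_subset
  ext j
  rw [PiLp.add_apply, h.integral_smul_apply contDiff_kernel hasCompactSupport_kernel
    (tsupport_subset.trans hx)]
  refine Fin.lastCases ?_ (fun i => ?_) j
  · simp [horizontalDiv_smul_single_last, graphGradient, hρ.integral_scaledKernel hε]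
  · simp only [horizontalDiv_smul_single_castSucc, graphGradient, euclideanSnoc_castSucc,
      ← hρ.fderiv_mollify_add_integral (hX i) hw hε x]
    simp [(Fin.castSucc_lt_last i).ne']

theorem IsGraphMeasure.enorm_graphGradient_mollify_le (h : IsGraphMeasure X Ω w M τ)
    (hρ : IsMollifier ρ) (hX : ∀ i, ContDiff ℝ 1 (X i)) (hw : Integrable w) {ε : ℝ} (hε : 0 < ε)
    {K : Set E} (hKΩ : K ⊆ Ω) {x : E} (hx : Metric.closedBall x ε ⊆ K) :
    ‖graphGradient X (mollify ρ ε w) x‖ₑ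
      ≤ (∫⁻ y in K, ENNReal.ofReal (scaledKernel ρ ε (x - y)) ∂M)
        + ∑ i, ‖mollifyCommutator ρ (X i) w ε x‖ₑ := by
  rw [h.graphGradient_mollify hρ hX hw hε (hx.trans hKΩ),
    ← setIntegral_eq_integral_of_forall_compl_eq_zero (s := K) fun y hy => by
      rw [hρ.scaledKernel_sub_eq_zero hε fun hyx => hy (hx hyx), zero_smul]]
  refine (enorm_add_le _ _).trans (add_le_add ?_ ?_)
  · refine (enorm_integral_le_lintegral_enorm _).trans (lintegral_mono fun y => ?_)
    rw [← ofReal_norm]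
    refine ENNReal.ofReal_le_ofReal ?_
    rw [norm_smul, Real.norm_of_nonneg (hρ.scaledKernel_nonneg hε _)]
    exact mul_le_of_le_one_right (hρ.scaledKernel_nonneg hε _) (h.norm_le_one y)
  · refine (enorm_le_sum_enorm_apply _).trans ?_
    rw [Fin.sum_univ_castSucc]
    simp

theorem IsMollifier.lintegral_scaledKernel (hρ : IsMollifier ρ) {ε : ℝ} (hε : 0 < ε) (y : E) :
    ∫⁻ x, ENNReal.ofReal (scaledKernel ρ ε (x - y)) = 1 := by
  rw [lintegral_sub_right_eq_self (fun x => ENNReal.ofReal (scaledKernel ρ ε x)) y,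
    ← ofReal_integral_eq_lintegral_ofReal]
  · rw [← integral_sub_left_eq_self (scaledKernel ρ ε) volume 0, hρ.integral_scaledKernel hε 0,
      ENNReal.ofReal_one]
  · exact (hρ.contDiff_scaledKernel ε).continuous.integrable_of_hasCompactSupport
      (hρ.hasCompactSupport_scaledKernel hε)
  · exact Eventually.of_forall fun x => hρ.scaledKernel_nonneg hε x

theorem IsMollifier.lintegral_mul_scaledKernel_le (hρ : IsMollifier ρ) {ε : ℝ} (hε : 0 < ε)
    {g : E → ℝ} {η : ℝ} {y : E} (hη : ∀ x ∈ Metric.closedBall y ε, g x ≤ g y + η) :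
    ∫⁻ x, ENNReal.ofReal (g x) * ENNReal.ofReal (scaledKernel ρ ε (x - y))
      ≤ ENNReal.ofReal (g y) + ENNReal.ofReal η :=
  calc ∫⁻ x, ENNReal.ofReal (g x) * ENNReal.ofReal (scaledKernel ρ ε (x - y))
      ≤ ∫⁻ x, (ENNReal.ofReal (g y) + ENNReal.ofReal η)
          * ENNReal.ofReal (scaledKernel ρ ε (x - y)) := by
        refine lintegral_mono fun x => ?_
        by_cases hx : x ∈ Metric.closedBall y ε
        · exact mul_le_mul_left
            ((ENNReal.ofReal_le_ofReal (hη x hx)).trans ENNReal.ofReal_add_le) _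
        · rw [hρ.scaledKernel_eq_zero hε (by rwa [mem_closedBall_iff_norm, not_le] at hx)]
          simp
    _ = ENNReal.ofReal (g y) + ENNReal.ofReal η := by
        rw [lintegral_const_mul' _ _ (by finiteness), hρ.lintegral_scaledKernel hε, mul_one]

theorem IsMollifier.lintegral_mul_lintegral_scaledKernel_le (hρ : IsMollifier ρ) {ε : ℝ}
    (hε : 0 < ε) (N : Measure E) [SFinite N] {g : E → ℝ} (hg : Measurable g) {η : ℝ}
    (hη : ∀ y, ∀ x ∈ Metric.closedBall y ε, g x ≤ g y + η) :
    ∫⁻ x, ENNReal.ofReal (g x) * ∫⁻ y, ENNReal.ofReal (scaledKernel ρ ε (x - y)) ∂N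
      ≤ (∫⁻ y, ENNReal.ofReal (g y) ∂N) + ENNReal.ofReal η * N univ := by
  have measurable_kernel :
      Measurable fun p : E × E => ENNReal.ofReal (scaledKernel ρ ε (p.1 - p.2)) := by
    have := (hρ.contDiff_scaledKernel ε).continuous
    exact (by fun_prop : Continuous fun p : E × E =>
      scaledKernel ρ ε (p.1 - p.2)).measurable.ennreal_ofReal
  have measurable_g : Measurable fun x => ENNReal.ofReal (g x) := hg.ennreal_ofReal
  calc ∫⁻ x, ENNReal.ofReal (g x) * ∫⁻ y, ENNReal.ofReal (scaledKernel ρ ε (x - y)) ∂N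
      = ∫⁻ y, (∫⁻ x, ENNReal.ofReal (g x) * ENNReal.ofReal (scaledKernel ρ ε (x - y))) ∂N := by
        rw [← lintegral_lintegral_swap
          ((measurable_g.comp measurable_fst).mul measurable_kernel).aemeasurable]
        exact lintegral_congr fun x =>
          (lintegral_const_mul' _ _ ENNReal.ofReal_ne_top).symm
    _ ≤ ∫⁻ y, (ENNReal.ofReal (g y) + ENNReal.ofReal η) ∂N :=
        lintegral_mono fun y => hρ.lintegral_mul_scaledKernel_le hε (hη y)
    _ = (∫⁻ y, ENNReal.ofReal (g y) ∂N) + ENNReal.ofReal η * N univ := by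
        rw [lintegral_add_left measurable_g, lintegral_const]

theorem IsGraphMeasure.lintegral_mul_enorm_graphGradient_mollify_le
    (h : IsGraphMeasure X Ω w M τ) (hρ : IsMollifier ρ) (hX : ∀ i, ContDiff ℝ 1 (X i))
    (hw : Integrable w) (hwm : Measurable w) {ε : ℝ} (hε : 0 < ε) {K : Set E}
    (hK : IsCompact K) (hKΩ : K ⊆ Ω) {g : E → ℝ} (hg : Continuous g)
    (hgK : ∀ x ∈ tsupport g, Metric.closedBall x ε ⊆ K) {C η : ℝ} (hC : ∀ x, g x ≤ C)
    (hη : ∀ y, ∀ x ∈ Metric.closedBall y ε, g x ≤ g y + η) :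
    ∫⁻ x, ENNReal.ofReal (g x) * ‖graphGradient X (mollify ρ ε w) x‖ₑ
      ≤ (∫⁻ x, ENNReal.ofReal (g x) ∂M) + ENNReal.ofReal η * M K
        + ENNReal.ofReal C * ∑ i, ∫⁻ x in tsupport g, ‖mollifyCommutator ρ (X i) w ε x‖ₑ := by
  have := FiniteDimensional.proper_real E
  have := isFiniteMeasure_restrict.2 (h.lt_top K hK hKΩ).ne
  have measurableSet_tsupport : MeasurableSet (tsupport g) := (isClosed_tsupport g).measurableSet
  have measurable_comm (i) : Measurable fun x => ‖mollifyCommutator ρ (X i) w ε x‖ₑ :=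
    (hρ.measurable_mollifyCommutator (hX i) hwm ε).enorm
  let smoothed x := ENNReal.ofReal (g x) *
    ∫⁻ y in K, ENNReal.ofReal (scaledKernel ρ ε (x - y)) ∂M
  let error x := ENNReal.ofReal C * ∑ i, ‖mollifyCommutator ρ (X i) w ε x‖ₑ
  have measurable_error : Measurable error :=
    (Finset.measurable_fun_sum _ fun i _ => measurable_comm i).const_mul _
  have pointwise_le (x) : ENNReal.ofReal (g x) * ‖graphGradient X (mollify ρ ε w) x‖ₑ
      ≤ smoothed x + (tsupport g).indicator error x := by
    by_cases hx : x ∈ tsupport g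
    · have gradient_le := h.enorm_graphGradient_mollify_le hρ hX hw hε hKΩ (hgK x hx)
      refine (mul_le_mul_right gradient_le _).trans ?_
      rw [mul_add, indicator_of_mem hx]
      exact add_le_add_right (mul_le_mul_left (ENNReal.ofReal_le_ofReal (hC x)) _) _
    · simp [image_eq_zero_of_notMem_tsupport hx]
  refine (lintegral_mono pointwise_le).trans ?_
  rw [lintegral_add_right _ (measurable_error.indicator measurableSet_tsupport),
    lintegral_indicator measurableSet_tsupport, lintegral_const_mul' _ _ ENNReal.ofReal_ne_top,
    lintegral_finsetSum _ fun i _ => measurable_comm i]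
  refine add_le_add_left ((hρ.lintegral_mul_lintegral_scaledKernel_le hε _ hg.measurable
    hη).trans ?_) _
  rw [Measure.restrict_apply_univ]
  gcongr
  exact Measure.restrict_le_self

theorem IsGraphMeasure.eventually_lintegral_mul_enorm_graphGradient_mollify_le
    (h : IsGraphMeasure X Ω w M τ) (hΩ : IsOpen Ω)
    (hρ : IsMollifier ρ) (hX : ∀ i, ContDiff ℝ 1 (X i)) (hw : Integrable w) (hwm : Measurable w)
    {ε : ℕ → ℝ} (hε0 : ∀ k, 0 < ε k) (hε1 : ∀ k, ε k ≤ 1) (hε : Tendsto ε atTop (𝓝 0))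
    {g : E → ℝ} (hg : Continuous g) (hgc : HasCompactSupport g)
    (hgs : tsupport g ⊆ Ω) {δ : ℝ≥0∞} (hδ : 0 < δ) :
    ∀ᶠ k in atTop, ∫⁻ x, ENNReal.ofReal (g x) * ‖graphGradient X (mollify ρ (ε k) w) x‖ₑ
      ≤ (∫⁻ x, ENNReal.ofReal (g x) ∂M) + δ := by
  have := FiniteDimensional.proper_real E
  obtain ⟨C, hC⟩ := hg.bounded_above_of_compact_support hgc
  obtain ⟨r, hr, hrΩ⟩ := hgc.isCompact.exists_cthickening_subset_open hΩ hgs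
  set K := Metric.cthickening r (tsupport g)
  have hK : IsCompact K := hgc.isCompact.cthickening
  have hδ' : 0 < δ / 2 := ENNReal.half_pos hδ.ne'
  obtain ⟨η, hη, hηδ⟩ := ENNReal.exists_nnreal_pos_mul_lt (h.lt_top _ hK hrΩ).ne hδ'.ne'
  obtain ⟨s, hs, hsg⟩ := Metric.uniformContinuous_iff.1
    (hgc.uniformContinuous_of_continuous hg) η hη
  have tendsto_error : Tendsto (fun k => ENNReal.ofReal C *
      ∑ i, ∫⁻ x in tsupport g, ‖mollifyCommutator ρ (X i) w (ε k) x‖ₑ) atTop (𝓝 0) := by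
    simpa using ENNReal.Tendsto.const_mul (tendsto_finsetSum Finset.univ fun i _ =>
      hρ.tendsto_lintegral_mollifyCommutator (hX i) hw hwm hε0 hε1 hε hgc.isCompact)
      (a := ENNReal.ofReal C) (Or.inr ENNReal.ofReal_ne_top)
  filter_upwards [tendsto_error.eventually (gt_mem_nhds hδ'),
    hε.eventually (gt_mem_nhds (lt_min hr hs))] with k hk hkε
  have closedBall_subset (x) (hx : x ∈ tsupport g) : Metric.closedBall x (ε k) ⊆ K :=
    (Metric.closedBall_subset_closedBall (hkε.trans_le (min_le_left _ _)).le).trans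
      (Metric.closedBall_subset_cthickening hx r)
  have oscillation_le (y) (x) (hx : x ∈ Metric.closedBall y (ε k)) : g x ≤ g y + η := by
    have dist_lt : dist x y < s :=
      (Metric.mem_closedBall.1 hx).trans_lt (hkε.trans_le (min_le_right _ _))
    linarith [(abs_lt.1 (Real.dist_eq _ _ ▸ hsg dist_lt)).2]
  refine (h.lintegral_mul_enorm_graphGradient_mollify_le hρ hX hw hwm (hε0 k) hK hrΩ hg
    closedBall_subset (fun x => (le_abs_self _).trans (hC x)) oscillation_le).trans ?_
  rw [ENNReal.ofReal_coe_nnreal, ← ENNReal.add_halves δ, ← add_assoc]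
  gcongr

end GraphMeasure

/-- Continuous functions with compact support in `U`. -/
structure IsCompactlySupportedIn {Z V : Type*} [TopologicalSpace Z] [TopologicalSpace V] [Zero V]
    (U : Set Z) (φ : Z → V) : Prop where
  continuous : Continuous φ
  hasCompactSupport : HasCompactSupport φ
  tsupport_subset : tsupport φ ⊆ U

namespace IsCompactlySupportedIn

variable {Z : Type*} [TopologicalSpace Z] {U : Set Z}

theorem const_smul {φ : Z → ℝ} (hφ : IsCompactlySupportedIn U φ) (c : ℝ) :
    IsCompactlySupportedIn U (c • φ) :=
  ⟨hφ.continuous.const_smul c, hφ.hasCompactSupport.smul_left (f := fun _ => c),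
    (tsupport_smul_subset_right (fun _ => c) φ).trans hφ.tsupport_subset⟩

theorem extend [T2Space Z] (hU : IsOpen U) {f : U → ℝ} (hf : Continuous f)
    (hc : HasCompactSupport f) : IsCompactlySupportedIn U (Function.extend Subtype.val f 0) :=
  ⟨hc.continuous_extend_zero hU hf, hc.extend_zero continuous_subtype_val,
    (hc.tsupport_extend_zero_subset continuous_subtype_val).trans (Subtype.coe_image_subset _ _)⟩

theorem extend_domRestrict {φ : Z → ℝ} (hφ : IsCompactlySupportedIn U φ) :
    Function.extend Subtype.val (U.domRestrict φ) 0 = φ := by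
  classical
  ext z
  by_cases hz : z ∈ U
  · exact Subtype.val_injective.extend_apply (U.domRestrict φ) 0 ⟨z, hz⟩
  · rw [Function.extend_apply' _ _ _ fun ⟨y, hy⟩ => hz (hy ▸ y.2),
      image_eq_zero_of_notMem_tsupport fun h => hz (hφ.tsupport_subset h), Pi.zero_apply]

theorem hasCompactSupport_domRestrict [R1Space Z] {φ : Z → ℝ} (hφ : IsCompactlySupportedIn U φ) :
    HasCompactSupport (U.domRestrict φ) := by
  refine HasCompactSupport.intro (K := Subtype.val ⁻¹' tsupport φ) ?_ fun x hx =>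
    image_eq_zero_of_notMem_tsupport (f := φ) hx
  rw [Subtype.isCompact_iff, Subtype.image_preimage_coe, inter_eq_right.2 hφ.tsupport_subset]
  exact hφ.hasCompactSupport

theorem comp_norm {V : Type*} [NormedAddCommGroup V] {φ : Z → V}
    (hφ : IsCompactlySupportedIn U φ) : IsCompactlySupportedIn U fun z => ‖φ z‖ := by
  have tsupport_eq : tsupport (fun z => ‖φ z‖) = tsupport φ := by
    simp [tsupport, Function.support]
  exact ⟨hφ.continuous.norm, hφ.hasCompactSupport.norm, tsupport_eq ▸ hφ.tsupport_subset⟩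

theorem comp_clm {V W : Type*} [NormedAddCommGroup V] [NormedSpace ℝ V] [NormedAddCommGroup W]
    [NormedSpace ℝ W] {φ : Z → V} (hφ : IsCompactlySupportedIn U φ) (L : V →L[ℝ] W) :
    IsCompactlySupportedIn U fun z => L (φ z) :=
  ⟨L.continuous.comp hφ.continuous, hφ.hasCompactSupport.comp_left (map_zero L),
    (tsupport_comp_subset (map_zero L) φ).trans hφ.tsupport_subset⟩

theorem apply {ι : Type*} {φ : Z → EuclideanSpace ℝ ι} (hφ : IsCompactlySupportedIn U φ) (j : ι) :
    IsCompactlySupportedIn U fun z => φ z j := by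
  have subset : tsupport (fun z => φ z j) ⊆ tsupport φ :=
    closure_mono fun z (hz : φ z j ≠ 0) h0 => hz (by simp [h0])
  have := hφ.continuous
  exact ⟨by fun_prop, hφ.hasCompactSupport.of_isClosed_subset (isClosed_tsupport _) subset,
    subset.trans hφ.tsupport_subset⟩

theorem smul_prod {Y V : Type*} [TopologicalSpace Y] [NormedAddCommGroup V] [NormedSpace ℝ V]
    {W : Set Y} {g : Z → V} {ψ : Y → ℝ} (hg : IsCompactlySupportedIn U g)
    (hψ : IsCompactlySupportedIn W ψ) :
    IsCompactlySupportedIn (U ×ˢ W) fun p : Z × Y => ψ p.2 • g p.1 := by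
  have subset : tsupport (fun p : Z × Y => ψ p.2 • g p.1) ⊆ tsupport g ×ˢ tsupport ψ :=
    closure_minimal (fun p hp => ⟨subset_tsupport _ (right_ne_zero_of_smul hp),
      subset_tsupport _ (left_ne_zero_of_smul hp)⟩)
      ((isClosed_tsupport _).prod (isClosed_tsupport _))
  exact ⟨(hψ.continuous.comp continuous_snd).smul (hg.continuous.comp continuous_fst),
    (hg.hasCompactSupport.isCompact.prod hψ.hasCompactSupport.isCompact).of_isClosed_subset
      (isClosed_tsupport _) subset,
    subset.trans (prod_mono hg.tsupport_subset hψ.tsupport_subset)⟩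

theorem integrable {V : Type*} [NormedAddCommGroup V] [MeasurableSpace Z]
    [OpensMeasurableSpace Z] {φ : Z → V} (hφ : IsCompactlySupportedIn U φ) {μ : Measure Z}
    (hμ : ∀ K, IsCompact K → K ⊆ U → μ K < ⊤) : Integrable φ μ := by
  obtain ⟨C, hC⟩ := hφ.hasCompactSupport.exists_bound_of_continuous hφ.continuous
  refine (integrableOn_iff_integrable_of_support_subset (subset_tsupport φ)).1 ?_
  exact Measure.integrableOn_of_bounded (M := C)
    (hμ _ hφ.hasCompactSupport hφ.tsupport_subset).ne
    (hφ.continuous.stronglyMeasurable_of_hasCompactSupport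
      hφ.hasCompactSupport).aestronglyMeasurable (Eventually.of_forall hC)

end IsCompactlySupportedIn

theorem exists_contDiff_cutoff {Z : Type*} [NormedAddCommGroup Z] [NormedSpace ℝ Z]
    [FiniteDimensional ℝ Z] {K U : Set Z} (hK : IsCompact K) (hU : IsOpen U) (hKU : K ⊆ U) :
    ∃ χ : Z → ℝ, ContDiff ℝ ∞ χ ∧ IsCompactlySupportedIn U χ ∧ (∀ z ∈ K, χ z = 1) ∧
      ∀ z, 0 ≤ χ z ∧ χ z ≤ 1 := by
  have := FiniteDimensional.proper_real Z
  obtain ⟨K', hK', hKK', hK'U⟩ := exists_compact_between hK hU hKU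
  obtain ⟨χ, hχ0, hχ1, hχ01⟩ := exists_contMDiffMap_zero_one_of_isClosed (n := ⊤)
    (modelWithCornersSelf ℝ Z) (isOpen_interior (s := K')).isClosed_compl hK.isClosed
    (disjoint_compl_left_iff_subset.2 hKK')
  have hχ : ContDiff ℝ ∞ χ := contMDiff_iff_contDiff.1 χ.contMDiff
  have subset : tsupport χ ⊆ K' := by
    refine closure_minimal (fun x hx => ?_) hK'.isClosed
    by_contra hn
    exact hx (hχ0 fun h => hn (interior_subset h))
  exact ⟨χ, hχ, ⟨hχ.continuous, hK'.of_isClosed_subset (isClosed_tsupport _) subset,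
    subset.trans hK'U⟩, fun z hz => hχ1 hz, fun z => hχ01 z⟩

section Riesz

variable {Z : Type*} [TopologicalSpace Z] [T2Space Z] [LocallyCompactSpace Z] [MeasurableSpace Z]
  [BorelSpace Z] {U : Set Z}

theorem exists_measure_integral_eq [SecondCountableTopology Z] (hU : IsOpen U)
    {Λ : (Z → ℝ) → ℝ}
    (map_add : ∀ φ ψ, IsCompactlySupportedIn U φ → IsCompactlySupportedIn U ψ →
      Λ (φ + ψ) = Λ φ + Λ ψ)
    (map_smul : ∀ φ (c : ℝ), IsCompactlySupportedIn U φ → Λ (c • φ) = c * Λ φ)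
    (nonneg : ∀ φ, IsCompactlySupportedIn U φ → 0 ≤ φ → 0 ≤ Λ φ) :
    ∃ μ : Measure Z, SigmaFinite μ ∧ (∀ K, IsCompact K → K ⊆ U → μ K < ⊤) ∧
      ∀ φ, IsCompactlySupportedIn U φ → ∫ z, φ z ∂μ = Λ φ := by
  classical
  have : LocallyCompactSpace U := hU.locallyCompactSpace
  have isCompactlySupportedIn_extend (f : CompactlySupportedContinuousMap U ℝ) :
      IsCompactlySupportedIn U (Function.extend Subtype.val f 0) :=
    .extend hU f.continuous f.hasCompactSupport
  let ΛU : CompactlySupportedContinuousMap U ℝ →ₚ[ℝ] ℝ := PositiveLinearMap.mk₀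
    { toFun := fun f => Λ (Function.extend Subtype.val f 0)
      map_add' := fun f g => by
        rw [← map_add _ _ (isCompactlySupportedIn_extend f) (isCompactlySupportedIn_extend g),
          ← Function.extend_add, add_zero]
        rfl
      map_smul' := fun c f => by
        rw [RingHom.id_apply, smul_eq_mul, ← map_smul _ c (isCompactlySupportedIn_extend f),
          ← Function.extend_smul, smul_zero]
        rfl }
    fun f hf => nonneg _ (isCompactlySupportedIn_extend f) fun z => by
      rw [Function.extend_def]
      split
      · exact hf _
      · rfl
  have embedding : MeasurableEmbedding (Subtype.val : U → Z) := .subtype_coe hU.measurableSet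
  have : SigmaFinite (RealRMK.rieszMeasure ΛU) := inferInstance
  refine ⟨(RealRMK.rieszMeasure ΛU).map Subtype.val, embedding.sigmaFinite_map,
    fun K hK hKU => ?_, fun φ hφ => ?_⟩
  · rw [embedding.map_apply]
    have : IsCompact (Subtype.val ⁻¹' K : Set U) := by
      rwa [Subtype.isCompact_iff, Subtype.image_preimage_coe, inter_eq_right.2 hKU]
    exact this.measure_lt_top
  · let f : CompactlySupportedContinuousMap U ℝ :=
      ⟨⟨U.domRestrict φ, hφ.continuous.comp continuous_subtype_val⟩,
        hφ.hasCompactSupport_domRestrict⟩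
    rw [embedding.integral_map]
    exact (RealRMK.integral_rieszMeasure ΛU f).trans (congrArg Λ hφ.extend_domRestrict)

theorem exists_tendsto_of_eventually_abs_le {ι : Type*} (F : Ultrafilter ι) {f : ι → ℝ} {C : ℝ}
    (h : ∀ᶠ k in (F : Filter ι), |f k| ≤ C) : ∃ l, Tendsto f F (𝓝 l) := by
  obtain ⟨l, -, hl⟩ := (isCompact_Icc (a := -C) (b := C)).ultrafilter_le_nhds (F.map f) (by
    rw [Ultrafilter.coe_map, le_principal_iff]
    exact h.mono fun k hk => abs_le.1 hk)
  exact ⟨l, hl⟩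

theorem exists_measure_tendsto_integral [SecondCountableTopology Z] (hU : IsOpen U) {ι : Type*}
    (L : ι → (Z → ℝ) → ℝ) (F : Ultrafilter ι)
    (map_add : ∀ k φ ψ, IsCompactlySupportedIn U φ → IsCompactlySupportedIn U ψ →
      L k (φ + ψ) = L k φ + L k ψ)
    (map_smul : ∀ k φ (c : ℝ), IsCompactlySupportedIn U φ → L k (c • φ) = c * L k φ)
    (nonneg : ∀ k φ, IsCompactlySupportedIn U φ → 0 ≤ φ → 0 ≤ L k φ)
    (bounded : ∀ φ, IsCompactlySupportedIn U φ →
      ∃ C : ℝ, ∀ᶠ k in (F : Filter ι), |L k φ| ≤ C) :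
    ∃ μ : Measure Z, SigmaFinite μ ∧ (∀ K, IsCompact K → K ⊆ U → μ K < ⊤) ∧
      ∀ φ, IsCompactlySupportedIn U φ → Tendsto (fun k => L k φ) F (𝓝 (∫ z, φ z ∂μ)) := by
  have exists_limit φ (hφ : IsCompactlySupportedIn U φ) :
      ∃ l, Tendsto (fun k => L k φ) F (𝓝 l) :=
    (bounded φ hφ).elim fun _ hC => exists_tendsto_of_eventually_abs_le F hC
  choose! Λ hΛ using exists_limit
  obtain ⟨μ, hμσ, hμ, integral_eq⟩ := exists_measure_integral_eq hU (Λ := Λ)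
    (fun φ ψ hφ hψ => by
      have hadd : IsCompactlySupportedIn U (φ + ψ) :=
        ⟨hφ.continuous.add hψ.continuous, hφ.hasCompactSupport.add hψ.hasCompactSupport,
          (tsupport_add φ ψ).trans (union_subset hφ.tsupport_subset hψ.tsupport_subset)⟩
      refine tendsto_nhds_unique (hΛ _ hadd) ?_
      exact ((hΛ φ hφ).add (hΛ ψ hψ)).congr fun k => (map_add k φ ψ hφ hψ).symm)
    (fun φ c hφ => by
      refine tendsto_nhds_unique (hΛ _ (hφ.const_smul c)) ?_
      exact ((hΛ φ hφ).const_mul c).congr fun k => (map_smul k φ c hφ).symm)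
    (fun φ hφ h0 => ge_of_tendsto (hΛ φ hφ) (Eventually.of_forall fun k => nonneg k φ hφ h0))
  exact ⟨μ, hμσ, hμ, fun φ hφ => (integral_eq φ hφ).symm ▸ hΛ φ hφ⟩

end Riesz

section GraphLimit

theorem IsCompactlySupportedIn.exists_forall_abs_le {E Y : Type*} [NormedAddCommGroup E]
    [NormedSpace ℝ E] [FiniteDimensional ℝ E] [TopologicalSpace Y] {Ω : Set E} {φ : E × Y → ℝ}
    (hφ : IsCompactlySupportedIn (Ω ×ˢ univ) φ) (hΩ : IsOpen Ω) :
    ∃ g : E → ℝ, IsCompactlySupportedIn Ω g ∧ ∀ x t, |φ (x, t)| ≤ g x := by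
  obtain ⟨χ, -, hχ, hχ1, hχ01⟩ := exists_contDiff_cutoff
    (hφ.hasCompactSupport.isCompact.image continuous_fst) hΩ
    (image_subset_iff.2 fun p hp => (hφ.tsupport_subset hp).1)
  obtain ⟨C, hC⟩ := hφ.continuous.bounded_above_of_compact_support hφ.hasCompactSupport
  refine ⟨C • χ, hχ.const_smul C, fun x t => ?_⟩
  by_cases hx : (x, t) ∈ tsupport φ
  · simpa [hχ1 x ⟨_, hx, rfl⟩] using hC (x, t)
  · rw [image_eq_zero_of_notMem_tsupport hx, abs_zero]
    exact mul_nonneg ((norm_nonneg _).trans (hC (x, t))) (hχ01 x).1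

theorem le_measure_of_forall_cutoff {E : Type*} [NormedAddCommGroup E] [NormedSpace ℝ E]
    [FiniteDimensional ℝ E] [MeasurableSpace E] [BorelSpace E] {Ω : Set E} (hΩ : IsOpen Ω)
    {M : Measure E} (hM : ∀ K, IsCompact K → K ⊆ Ω → M K < ⊤) {K : Set E} (hK : IsCompact K)
    (hKΩ : K ⊆ Ω) {c : ℝ≥0∞}
    (hc : ∀ g : E → ℝ, IsCompactlySupportedIn Ω g → (∀ x ∈ K, g x = 1) →
      (∀ x, 0 ≤ g x ∧ g x ≤ 1) → c ≤ ∫⁻ x, ENNReal.ofReal (g x) ∂M) : c ≤ M K := by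
  have := FiniteDimensional.proper_real E
  obtain ⟨r, hr, hrΩ⟩ := hK.exists_cthickening_subset_open hΩ hKΩ
  have tendsto_cthickening :
      Tendsto (fun s => M (Metric.cthickening s K)) (𝓝[>] 0) (𝓝 (M K)) :=
    (tendsto_measure_cthickening_of_isClosed ⟨r, hr, (hM _ hK.cthickening hrΩ).ne⟩
      hK.isClosed).mono_left nhdsWithin_le_nhds
  refine ge_of_tendsto tendsto_cthickening ?_
  filter_upwards [Ioo_mem_nhdsGT hr] with s hs
  obtain ⟨g, -, hg, hg1, hg01⟩ := exists_contDiff_cutoff hK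
    (Metric.isOpen_thickening (δ := s) (E := K)) (Metric.self_subset_thickening hs.1 K)
  have subset : tsupport g ⊆ Metric.cthickening s K :=
    hg.tsupport_subset.trans (Metric.thickening_subset_cthickening s K)
  refine (hc g ⟨hg.continuous, hg.hasCompactSupport,
    subset.trans ((Metric.cthickening_mono hs.2.le K).trans hrΩ)⟩ hg1 hg01).trans ?_
  rw [← setLIntegral_one, ← lintegral_indicator Metric.isClosed_cthickening.measurableSet]
  refine lintegral_mono fun x => ?_
  by_cases hx : x ∈ Metric.cthickening s K
  · rw [indicator_of_mem hx]
    exact ENNReal.ofReal_le_one.2 (hg01 x).2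
  · rw [image_eq_zero_of_notMem_tsupport fun h => hx (subset h)]
    simp

theorem measure_prod_univ_le_of_forall_isCompact {Y Z : Type*} [MeasurableSpace Y]
    [TopologicalSpace Z] [SigmaCompactSpace Z] [MeasurableSpace Z] {μ : Measure (Y × Z)} {K : Set Y}
    {c : ℝ≥0∞} (hc : ∀ L, IsCompact L → μ (K ×ˢ L) ≤ c) : μ (K ×ˢ univ) ≤ c := by
  rw [← iUnion_compactCovering, prod_iUnion, Monotone.measure_iUnion fun i j hij =>
    prod_mono le_rfl (compactCovering_subset Z hij)]
  exact iSup_le fun j => hc _ (isCompact_compactCovering Z j)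

theorem enorm_integral_graph_mul_le {E Y : Type*} [MeasureSpace E] {v : E → Y} {g a : E → ℝ}
    {φ : E × Y → ℝ} {b : E → ℝ≥0∞} (hab : ∀ x, ‖a x‖ₑ ≤ b x) (hφ : ∀ x t, |φ (x, t)| ≤ g x) :
    ‖∫ x, φ (x, v x) * a x‖ₑ ≤ ∫⁻ x, ENNReal.ofReal (g x) * b x := by
  refine (enorm_integral_le_lintegral_enorm _).trans (lintegral_mono fun x => ?_)
  rw [enorm_mul]
  refine mul_le_mul' ?_ (hab x)
  rw [← ofReal_norm]
  exact ENNReal.ofReal_le_ofReal (hφ x _)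

theorem integrable_graph_mul {E : Type*} [TopologicalSpace E] [T2Space E] [MeasureSpace E]
    [OpensMeasurableSpace E] [IsFiniteMeasureOnCompacts (volume : Measure E)] {Ω : Set E}
    {φ : E × ℝ → ℝ} (hφ : IsCompactlySupportedIn (Ω ×ˢ univ) φ) {v a : E → ℝ} (hv : Continuous v)
    (ha : Continuous a) : Integrable fun x => φ (x, v x) * a x :=
  Continuous.integrable_of_hasCompactSupport
    ((hφ.continuous.comp (continuous_id.prodMk hv)).mul ha)
    (hasCompactSupport_slice hφ.hasCompactSupport v).mul_right

/-- The measures `b k ℒⁿ` are asymptotically dominated by `M` on `Ω`, as is the case when they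
converge weakly to a measure below `M`. -/
def IsAsymptoticallyDominated {E : Type*} [TopologicalSpace E] [MeasureSpace E] (Ω : Set E)
    (b : ℕ → E → ℝ≥0∞) (M : Measure E) : Prop :=
  ∀ g : E → ℝ, IsCompactlySupportedIn Ω g → ∀ δ : ℝ≥0∞, 0 < δ →
    ∀ᶠ k in atTop, ∫⁻ x, ENNReal.ofReal (g x) * b k x ≤ (∫⁻ x, ENNReal.ofReal (g x) ∂M) + δ

theorem IsAsymptoticallyDominated.lintegral_mul_le {E Y : Type*} [TopologicalSpace E]
    [SecondCountableTopology E] [MeasureSpace E] [OpensMeasurableSpace E]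
    [TopologicalSpace Y] [MeasurableSpace Y] [OpensMeasurableSpace Y] {Ω : Set E}
    {b : ℕ → E → ℝ≥0∞} {M : Measure E}
    (hb : IsAsymptoticallyDominated Ω b M) {v : ℕ → E → Y} {F : Ultrafilter ℕ}
    (hF : (F : Filter ℕ) ≤ atTop) {a : ℕ → E → ℝ} (hab : ∀ k x, ‖a k x‖ₑ ≤ b k x)
    {μ : Measure (E × Y)} (hfin : ∀ K, IsCompact K → K ⊆ Ω ×ˢ univ → μ K < ⊤)
    (hμ : ∀ φ, IsCompactlySupportedIn (Ω ×ˢ univ) φ →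
      Tendsto (fun k => ∫ x, φ (x, v k x) * a k x) F (𝓝 (∫ p, φ p ∂μ)))
    {g : E → ℝ} (hg : IsCompactlySupportedIn Ω g) (hg0 : ∀ x, 0 ≤ g x) {ψ : Y → ℝ}
    (hψ : IsCompactlySupportedIn univ ψ) (hψ01 : ∀ t, 0 ≤ ψ t ∧ ψ t ≤ 1) :
    ∫⁻ p, ENNReal.ofReal (g p.1 * ψ p.2) ∂μ ≤ ∫⁻ x, ENNReal.ofReal (g x) ∂M := by
  have hgψ : IsCompactlySupportedIn (Ω ×ˢ univ) fun p : E × Y => g p.1 * ψ p.2 := by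
    simp_rw [mul_comm (g _)]
    exact hg.smul_prod hψ
  have nonneg (p : E × Y) : 0 ≤ g p.1 * ψ p.2 := mul_nonneg (hg0 _) (hψ01 _).1
  have abs_le x t : |g x * ψ t| ≤ g x := by
    rw [abs_of_nonneg (nonneg (x, t))]
    exact mul_le_of_le_one_right (hg0 x) (hψ01 t).2
  rw [← ofReal_integral_eq_lintegral_ofReal (hgψ.integrable hfin) (Eventually.of_forall nonneg)]
  refine le_of_forall_pos_le_add fun δ hδ => ?_
  refine le_of_tendsto ((ENNReal.continuous_ofReal.tendsto _).comp (hμ _ hgψ)) ?_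
  refine hF ((hb g hg δ hδ).mono fun k hk => le_trans ?_
    ((enorm_integral_graph_mul_le (v := v k) (φ := fun p => g p.1 * ψ p.2) (hab k) abs_le).trans
      hk))
  rw [← ofReal_norm]
  exact ENNReal.ofReal_le_ofReal (le_abs_self _)

variable {E : Type*} [NormedAddCommGroup E] [NormedSpace ℝ E] [FiniteDimensional ℝ E]
  [MeasureSpace E] [BorelSpace E] {Ω : Set E} {M : Measure E} {b : ℕ → E → ℝ≥0∞}
  {v a : ℕ → E → ℝ} {F : Ultrafilter ℕ}

theorem IsAsymptoticallyDominated.measure_prod_univ_le (hb : IsAsymptoticallyDominated Ω b M)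
    (hΩ : IsOpen Ω) (hM : ∀ K, IsCompact K → K ⊆ Ω → M K < ⊤) (hF : (F : Filter ℕ) ≤ atTop)
    (hab : ∀ k x, ‖a k x‖ₑ ≤ b k x) {μ : Measure (E × ℝ)}
    (hfin : ∀ K, IsCompact K → K ⊆ Ω ×ˢ univ → μ K < ⊤)
    (hμ : ∀ φ, IsCompactlySupportedIn (Ω ×ˢ univ) φ →
      Tendsto (fun k => ∫ x, φ (x, v k x) * a k x) F (𝓝 (∫ p, φ p ∂μ)))
    {K : Set E} (hK : IsCompact K) (hKΩ : K ⊆ Ω) : μ (K ×ˢ univ) ≤ M K := by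
  have := FiniteDimensional.proper_real E
  refine measure_prod_univ_le_of_forall_isCompact fun L hL => ?_
  obtain ⟨ψ, -, hψ, hψ1, hψ01⟩ := exists_contDiff_cutoff hL isOpen_univ (subset_univ L)
  refine le_measure_of_forall_cutoff hΩ hM hK hKΩ fun g hg hg1 hg01 => ?_
  refine le_trans ?_ (hb.lintegral_mul_le hF hab hfin hμ hg (fun x => (hg01 x).1) hψ hψ01)
  rw [← setLIntegral_one, ← lintegral_indicator (hK.measurableSet.prod hL.measurableSet)]
  refine lintegral_mono fun p => ?_
  by_cases hp : p ∈ K ×ˢ L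
  · rw [indicator_of_mem hp, hg1 _ hp.1, hψ1 _ hp.2]
    simp
  · simp [indicator_of_notMem hp]

variable [(volume : Measure E).IsAddHaarMeasure]

theorem IsAsymptoticallyDominated.exists_graph_limit_measure
    (hb : IsAsymptoticallyDominated Ω b M) (hΩ : IsOpen Ω)
    (hM : ∀ K, IsCompact K → K ⊆ Ω → M K < ⊤) (hF : (F : Filter ℕ) ≤ atTop)
    (hv : ∀ k, Continuous (v k)) (ha : ∀ k, Continuous (a k)) (ha0 : ∀ k x, 0 ≤ a k x)
    (hab : ∀ k x, ‖a k x‖ₑ ≤ b k x) :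
    ∃ μ : Measure (E × ℝ), SigmaFinite μ ∧ (∀ K, IsCompact K → K ⊆ Ω ×ˢ univ → μ K < ⊤) ∧
      ∀ φ, IsCompactlySupportedIn (Ω ×ˢ univ) φ →
        Tendsto (fun k => ∫ x, φ (x, v k x) * a k x) F (𝓝 (∫ p, φ p ∂μ)) := by
  have := FiniteDimensional.proper_real E
  refine exists_measure_tendsto_integral (hΩ.prod isOpen_univ)
    (fun k φ => ∫ x, φ (x, v k x) * a k x) F (fun k φ ψ hφ hψ => ?_) (fun k φ c _ => ?_)
    (fun k φ _ h0 => integral_nonneg fun x => mul_nonneg (h0 _) (ha0 _ _)) (fun φ hφ => ?_)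
  · simp only [Pi.add_apply, add_mul]
    exact integral_add (integrable_graph_mul hφ (hv k) (ha k))
      (integrable_graph_mul hψ (hv k) (ha k))
  · simp only [Pi.smul_apply, smul_eq_mul, mul_assoc]
    exact integral_const_mul _ _
  · obtain ⟨g, hg, abs_le⟩ := hφ.exists_forall_abs_le hΩ
    have lintegral_lt_top : ∫⁻ x, ENNReal.ofReal (g x) ∂M < ⊤ := by
      refine (lintegral_mono fun x => ?_).trans_lt
        ((hasFiniteIntegral_iff_norm g).1 (hg.integrable hM).2)
      exact ENNReal.ofReal_le_ofReal (le_abs_self _)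
    refine ⟨((∫⁻ x, ENNReal.ofReal (g x) ∂M) + 1).toReal,
      hF ((hb g hg 1 one_pos).mono fun k hk => ?_)⟩
    rw [← Real.norm_eq_abs, ← toReal_enorm]
    exact ENNReal.toReal_mono (ENNReal.add_ne_top.2 ⟨lintegral_lt_top.ne, ENNReal.one_ne_top⟩)
      ((enorm_integral_graph_mul_le (hab k) abs_le).trans hk)

end GraphLimit

section SubgraphLimit

theorem integrable_integral_Iio {E : Type*} [MeasureSpace E] {f : E → ℝ} (hf : Measurable f)
    {H : E × ℝ → ℝ} (hH : Integrable H) :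
    Integrable fun x => ∫ t in Iio (f x), H (x, t) := by
  have integrable_indicator : Integrable ({p : E × ℝ | p.2 < f p.1}.indicator H)
      ((volume : Measure E).prod (volume : Measure ℝ)) :=
    hH.indicator (measurableSet_lt_graph hf)
  refine integrable_indicator.integral_prod_left.congr (Eventually.of_forall fun x => ?_)
  simp only
  rw [← integral_indicator measurableSet_Iio]
  rfl

variable {E : Type*} [NormedAddCommGroup E] [NormedSpace ℝ E] {m : ℕ} {X : Fin m → E → E}

theorem continuous_graphGradient (hX : ∀ i, ContDiff ℝ 1 (X i))
    {v : E → ℝ} (hv : ContDiff ℝ 1 v) : Continuous (graphGradient X v) := by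
  refine (PiLp.continuous_toLp 2 _).comp (continuous_pi fun j => ?_)
  refine Fin.lastCases ?_ (fun i => ?_) j
  · simpa using continuous_const
  · simpa using (hv.continuous_fderiv one_ne_zero).clm_apply (hX i).continuous

variable [FiniteDimensional ℝ E] [MeasureSpace E] [BorelSpace E]
  [(volume : Measure E).IsAddHaarMeasure]

theorem enorm_integral_lt_graph_sub_le {w v : E → ℝ} (hw : Measurable w) (hv : Measurable v)
    {H : E × ℝ → ℝ} (hH : Continuous H) (hc : HasCompactSupport H) {C : ℝ}
    (hC : ∀ p, ‖H p‖ ≤ C) :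
    ‖(∫ p in {p : E × ℝ | p.2 < v p.1}, H p) - ∫ p in {p : E × ℝ | p.2 < w p.1}, H p‖ₑ
      ≤ ENNReal.ofReal C * ∫⁻ x, ‖v x - w x‖ₑ := by
  have := FiniteDimensional.proper_real E
  have integrable : Integrable H := hH.integrable_of_hasCompactSupport hc
  rw [integral_lt_graph hv integrable, integral_lt_graph hw integrable,
    ← integral_sub (integrable_integral_Iio hv integrable)
      (integrable_integral_Iio hw integrable)]
  refine (enorm_integral_le_lintegral_enorm _).trans ?_
  rw [← lintegral_const_mul' _ _ ENNReal.ofReal_ne_top]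
  refine lintegral_mono fun x => ?_
  have slice_embedding : IsClosedEmbedding fun t : ℝ => (x, t) :=
    (Isometry.of_dist_eq fun s t => by simp [Prod.dist_eq]).isClosedEmbedding
  have integrable_slice : Integrable fun t => H (x, t) :=
    (hH.comp slice_embedding.continuous).integrable_of_hasCompactSupport
      (hc.comp_isClosedEmbedding slice_embedding)
  have norm_integral_le := intervalIntegral.norm_integral_le_of_norm_le_const (a := w x)
    (b := v x) (f := fun t => H (x, t)) (C := C) fun t _ => hC (x, t)
  rw [← intervalIntegral.integral_Iic_sub_Iic integrable_slice.integrableOn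
    integrable_slice.integrableOn, integral_Iic_eq_integral_Iio,
    integral_Iic_eq_integral_Iio] at norm_integral_le
  rw [← ofReal_norm, ← ofReal_norm, ← ENNReal.ofReal_mul ((norm_nonneg _).trans (hC 0))]
  exact ENNReal.ofReal_le_ofReal norm_integral_le

variable {Ω : Set E} {w : E → ℝ} {M : Measure E} {τ : E → EuclideanSpace ℝ (Fin (m + 1))}
  {ρ : E → ℝ}

theorem IsMollifier.tendsto_integral_graphGradient (hρ : IsMollifier ρ)
    (hX : ∀ i, ContDiff ℝ 1 (X i)) (hw : Integrable w) (hwm : Measurable w) {ε : ℕ → ℝ}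
    (hε0 : ∀ k, 0 < ε k) (hε : Tendsto ε atTop (𝓝 0))
    {φ : E × ℝ → EuclideanSpace ℝ (Fin (m + 1))} (hφ : ContDiff ℝ 1 φ)
    (hc : HasCompactSupport φ) :
    Tendsto (fun k => ∫ x, inner ℝ (φ (x, mollify ρ (ε k) w x))
      (graphGradient X (mollify ρ (ε k) w) x)) atTop
      (𝓝 (-∫ p in {p : E × ℝ | p.2 < w p.1}, divX (extendedFields X) φ p)) := by
  have hcont : Continuous (divX (extendedFields X) φ) :=
    continuous_divX (contDiff_extendedFields hX) hφ
  have hcs := hasCompactSupport_divX (X := extendedFields X) hc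
  obtain ⟨C, hC⟩ := hcont.bounded_above_of_compact_support hcs
  have smooth k := hρ.contDiff_mollify (hε0 k) hw
  have tendsto_subgraph : Tendsto (fun k => ∫ p in {p : E × ℝ | p.2 < mollify ρ (ε k) w p.1},
      divX (extendedFields X) φ p) atTop
      (𝓝 (∫ p in {p : E × ℝ | p.2 < w p.1}, divX (extendedFields X) φ p)) := by
    have bound_tendsto := ENNReal.Tendsto.const_mul
      (hρ.tendsto_lintegral_mollify_sub hw hwm hε0 hε)
      (a := ENNReal.ofReal C) (Or.inr ENNReal.ofReal_ne_top)
    rw [mul_zero] at bound_tendsto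
    rw [tendsto_iff_edist_tendsto_0]
    refine tendsto_of_tendsto_of_tendsto_of_le_of_le tendsto_const_nhds bound_tendsto
      (fun _ => zero_le) fun k => ?_
    simp only [edist_eq_enorm_sub]
    exact enorm_integral_lt_graph_sub_le hwm (smooth k).continuous.measurable hcont hcs hC
  refine tendsto_subgraph.neg.congr fun k => ?_
  rw [integral_lt_graph_divX hX (smooth k) hφ hc, neg_neg]

theorem IsGraphMeasure.exists_contDiff_approximation (h : IsGraphMeasure X Ω w M τ)
    (hΩ : IsOpen Ω) (hX : ∀ i, ContDiff ℝ 1 (X i)) (hw : Integrable w) (hwm : Measurable w) :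
    ∃ v : ℕ → E → ℝ, (∀ k, ContDiff ℝ 1 (v k)) ∧
      IsAsymptoticallyDominated Ω (fun k x => ‖graphGradient X (v k) x‖ₑ) M ∧
      ∀ φ : E × ℝ → EuclideanSpace ℝ (Fin (m + 1)), ContDiff ℝ 1 φ → HasCompactSupport φ →
        Tendsto (fun k => ∫ x, inner ℝ (φ (x, v k x)) (graphGradient X (v k) x)) atTop
          (𝓝 (-∫ p in {p : E × ℝ | p.2 < w p.1}, divX (extendedFields X) φ p)) := by
  obtain ⟨ρ, hρ⟩ := exists_isMollifier E
  obtain ⟨ε, -, hε01, hε⟩ := exists_seq_strictAnti_tendsto' (zero_lt_one (α := ℝ))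
  have hε0 k : 0 < ε k := (hε01 k).1
  exact ⟨fun k => mollify ρ (ε k) w, fun k => hρ.contDiff_mollify (hε0 k) hw,
    fun g hg δ hδ => h.eventually_lintegral_mul_enorm_graphGradient_mollify_le hΩ hρ hX hw hwm
      hε0 (fun k => (hε01 k).2.le) hε hg.continuous hg.hasCompactSupport hg.tsupport_subset hδ,
    fun φ hφ hc => hρ.tendsto_integral_graphGradient hX hw hwm hε0 hε hφ hc⟩

theorem IsGraphMeasure.exists_dominating_measure (h : IsGraphMeasure X Ω w M τ) (hΩ : IsOpen Ω)
    (hX : ∀ i, ContDiff ℝ 1 (X i)) (hw : Integrable w) (hwm : Measurable w) :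
    ∃ μ : Measure (E × ℝ), (∀ K, IsCompact K → K ⊆ Ω ×ˢ univ → μ K < ⊤) ∧
      (∀ K, IsCompact K → K ⊆ Ω → μ (K ×ˢ univ) ≤ M K) ∧
      ∀ φ : E × ℝ → EuclideanSpace ℝ (Fin (m + 1)), ContDiff ℝ 1 φ →
        IsCompactlySupportedIn (Ω ×ˢ univ) φ →
        -∫ p in {p : E × ℝ | p.2 < w p.1}, divX (extendedFields X) φ p ≤ ∫ p, ‖φ p‖ ∂μ := by
  obtain ⟨v, hv, dominated, tendsto_integral⟩ := h.exists_contDiff_approximation hΩ hX hw hwm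
  have hF : (Ultrafilter.of (atTop : Filter ℕ) : Filter ℕ) ≤ atTop := Ultrafilter.of_le _
  have continuous_gradient k := continuous_graphGradient hX (hv k)
  have enorm_le k x : ‖‖graphGradient X (v k) x‖‖ₑ ≤ ‖graphGradient X (v k) x‖ₑ := by
    rw [enorm_norm]
  obtain ⟨μ, -, hfin, hμ⟩ := dominated.exists_graph_limit_measure hΩ h.lt_top hF
    (fun k => (hv k).continuous) (fun k => (continuous_gradient k).norm)
    (fun k x => norm_nonneg _) enorm_le
  refine ⟨μ, hfin, fun K hK hKΩ =>
    dominated.measure_prod_univ_le hΩ h.lt_top hF enorm_le hfin hμ hK hKΩ, fun φ hφ hφc => ?_⟩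
  refine le_of_tendsto_of_tendsto ((tendsto_integral φ hφ hφc.hasCompactSupport).mono_left hF)
    (hμ _ hφc.comp_norm) (Eventually.of_forall fun k => ?_)
  have := (hv k).continuous
  have continuous_comp : Continuous fun x => φ (x, v k x) := hφ.continuous.comp (by fun_prop)
  have integrable : Integrable fun x => inner ℝ (φ (x, v k x)) (graphGradient X (v k) x) :=
    (continuous_comp.inner (continuous_gradient k)).integrable_of_hasCompactSupport <|
      (hasCompactSupport_slice hφc.hasCompactSupport (v k)).mono fun x hx h0 => hx <| by
        simp only [h0, inner_zero_left]
  exact integral_mono integrable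
    (integrable_graph_mul hφc.comp_norm this (continuous_gradient k).norm) fun x =>
      real_inner_le_norm _ _

end SubgraphLimit

theorem integrableOn_toReal_rnDeriv {E : Type*} [MeasurableSpace E] {κ P : Measure E}
    [SigmaFinite κ] [κ.HaveLebesgueDecomposition P] (hκ : κ ≪ P) {K : Set E}
    (hK : MeasurableSet K) (hκK : κ K < ⊤) :
    IntegrableOn (fun x => (κ.rnDeriv P x).toReal) K P := by
  have integrable_one : Integrable (K.indicator fun _ => (1 : ℝ)) κ :=
    (integrable_indicator_iff hK).2 (integrableOn_const hκK.ne)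
  rw [← integrable_rnDeriv_smul_iff hκ] at integrable_one
  rw [← integrable_indicator_iff hK]
  refine integrable_one.congr (Eventually.of_forall fun x => ?_)
  by_cases hx : x ∈ K <;> simp [hx]

namespace RadonVectorMeasure

variable {E : Type*} [TopologicalSpace E] [T2Space E] [MeasurableSpace E] [BorelSpace E]
  {U : Set E}

/-- The vector measure `h P`, for a density `h` which is integrable on compact subsets. -/
noncomputable def ofDensity {V : Type*} [NormedAddCommGroup V] [NormedSpace ℝ V] (P : Measure E)
    (h : E → V) (hh : ∀ K, IsCompact K → K ⊆ U → IntegrableOn h K P) : RadonVectorMeasure U V where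
  toFun B := ∫ x in B, h x ∂P
  hasSum_iUnion' K hK hKU _ hB hBK hd :=
    hasSum_integral_iUnion hB hd ((hh K hK hKU).mono_set (iUnion_subset hBK))

theorem ofDensity_integral {V : Type*} [NormedAddCommGroup V] [InnerProductSpace ℝ V]
    [CompleteSpace V] {P : Measure E} {h : E → V}
    (hh : ∀ K, IsCompact K → K ⊆ U → IntegrableOn h K P) {φ : E → V} (hφ : Continuous φ)
    (hc : HasCompactSupport φ) (hs : tsupport φ ⊆ U) :
    ((ofDensity P h hh).onCompact (tsupport φ) hc hs).integral φ (innerSL ℝ) =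
      ∫ x, inner ℝ (φ x) (h x) ∂P := by
  obtain ⟨C, hC⟩ := hc.exists_bound_of_continuous hφ
  rw [onCompact_integral_eq _ hc hs (hh _ hc hs) (fun B _ _ => rfl)
    (hφ.stronglyMeasurable_of_hasCompactSupport hc) hC]
  refine setIntegral_eq_integral_of_forall_compl_eq_zero fun x hx => ?_
  rw [image_eq_zero_of_notMem_tsupport hx, inner_zero_left]

theorem exists_integral_eq_sum_sub {d : ℕ}
    (μ ν : Fin d → Measure E) [∀ j, SigmaFinite (μ j)] [∀ j, SigmaFinite (ν j)]
    (hμ : ∀ j K, IsCompact K → K ⊆ U → μ j K < ⊤) (hν : ∀ j K, IsCompact K → K ⊆ U → ν j K < ⊤) :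
    ∃ D : RadonVectorMeasure U (EuclideanSpace ℝ (Fin d)),
      ∀ φ : E → EuclideanSpace ℝ (Fin d), Continuous φ →
        ∀ (hc : HasCompactSupport φ) (hs : tsupport φ ⊆ U),
          (D.onCompact (tsupport φ) hc hs).integral φ (innerSL ℝ) =
            ∑ j, ((∫ x, φ x j ∂μ j) - ∫ x, φ x j ∂ν j) := by
  set P : Measure E := Measure.sum fun j => μ j + ν j
  have hμP j : μ j ≪ P :=
    (Measure.le_add_right le_rfl |>.trans (Measure.le_sum _ j)).absolutelyContinuous
  have hνP j : ν j ≪ P :=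
    (Measure.le_add_left le_rfl |>.trans (Measure.le_sum _ j)).absolutelyContinuous
  set h : E → EuclideanSpace ℝ (Fin d) := fun x => WithLp.toLp 2 fun j =>
    ((μ j).rnDeriv P x).toReal - ((ν j).rnDeriv P x).toReal
  have integrableOn_h K (hK : IsCompact K) (hKU : K ⊆ U) : IntegrableOn h K P :=
    Integrable.of_eval_piLp fun j =>
      (integrableOn_toReal_rnDeriv (hμP j) hK.measurableSet (hμ j K hK hKU)).sub
        (integrableOn_toReal_rnDeriv (hνP j) hK.measurableSet (hν j K hK hKU))
  refine ⟨ofDensity P h integrableOn_h, fun φ hφ hc hs => ?_⟩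
  rw [ofDensity_integral integrableOn_h hφ hc hs]
  have component j : IsCompactlySupportedIn U fun x => φ x j :=
    IsCompactlySupportedIn.apply ⟨hφ, hc, hs⟩ j
  have integrable_μ j := (integrable_rnDeriv_smul_iff (hμP j)).2 ((component j).integrable (hμ j))
  have integrable_ν j := (integrable_rnDeriv_smul_iff (hνP j)).2 ((component j).integrable (hν j))
  have inner_eq x : inner ℝ (φ x) (h x) = ∑ j, (((μ j).rnDeriv P x).toReal • φ x j -
      ((ν j).rnDeriv P x).toReal • φ x j) := by
    rw [PiLp.inner_apply]
    refine Finset.sum_congr rfl fun j _ => ?_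
    simp only [h, smul_eq_mul, RCLike.inner_apply, conj_trivial]
    ring
  simp_rw [inner_eq]
  refine (integral_finsetSum _ fun j _ => (integrable_μ j).sub (integrable_ν j)).trans ?_
  refine Finset.sum_congr rfl fun j _ => ?_
  rw [integral_sub' (integrable_μ j) (integrable_ν j), integral_rnDeriv_smul (hμP j),
    integral_rnDeriv_smul (hνP j)]

end RadonVectorMeasure

section SubgraphDerivative

theorem subgraph_ae_eq {E : Type*} [MeasureSpace E] {Ω : Set E} (hΩ : MeasurableSet Ω)
    {u w : E → ℝ} (huw : u =ᵐ[volume.restrict Ω] w) :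
    subgraph Ω u =ᵐ[(volume : Measure (E × ℝ))] subgraph Ω w := by
  have ae_eq : ∀ᵐ p : E × ℝ, p.1 ∈ Ω → u p.1 = w p.1 :=
    Measure.quasiMeasurePreserving_fst.ae ((ae_restrict_iff' hΩ).1 huw)
  filter_upwards [ae_eq] with p hp
  exact propext (and_congr_right fun h => by rw [hp h])

theorem measurableSet_subgraph {E : Type*} [MeasurableSpace E] {Ω : Set E} (hΩ : MeasurableSet Ω)
    {w : E → ℝ} (hw : Measurable w) : MeasurableSet (subgraph Ω w) :=
  (measurable_fst hΩ).inter (measurableSet_lt_graph hw)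

theorem locallyIntegrable_indicator_subgraph {E : Type*} [TopologicalSpace E] [MeasureSpace E]
    [IsLocallyFiniteMeasure (volume : Measure (E × ℝ))] {Ω : Set E} (hΩ : MeasurableSet Ω)
    {u w : E → ℝ} (huw : u =ᵐ[volume.restrict Ω] w) (hw : Measurable w) :
    LocallyIntegrable ((subgraph Ω u).indicator fun _ => (1 : ℝ))
      (volume : Measure (E × ℝ)) := by
  have nullMeasurableSet : NullMeasurableSet (subgraph Ω u) (volume : Measure (E × ℝ)) :=
    (measurableSet_subgraph hΩ hw).nullMeasurableSet.congr (subgraph_ae_eq hΩ huw).symm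
  refine (locallyIntegrable_const (1 : ℝ)).mono
    (aestronglyMeasurable_const.indicator₀ nullMeasurableSet) (Eventually.of_forall fun p => ?_)
  by_cases hp : p ∈ subgraph Ω u <;> simp [hp]

theorem integral_indicator_subgraph_mul {E : Type*} [MeasureSpace E] {Ω : Set E}
    (hΩ : MeasurableSet Ω) {u w : E → ℝ} (huw : u =ᵐ[volume.restrict Ω] w) (hw : Measurable w)
    {H : E × ℝ → ℝ} (hH : ∀ p : E × ℝ, p ∉ Ω ×ˢ (univ : Set ℝ) → H p = 0) :
    ∫ p in Ω ×ˢ univ, (subgraph Ω u).indicator (fun _ => (1 : ℝ)) p * H p =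
      ∫ p in {p : E × ℝ | p.2 < w p.1}, H p := by
  rw [setIntegral_eq_integral_of_forall_compl_eq_zero fun p hp => by rw [hH p hp, mul_zero],
    ← integral_indicator (measurableSet_lt_graph hw)]
  refine integral_congr_ae ?_
  filter_upwards [subgraph_ae_eq hΩ huw] with p hp
  have mem_iff : p ∈ subgraph Ω u ↔ p.1 ∈ Ω ∧ p.2 < w p.1 := iff_of_eq hp
  by_cases hpΩ : p.1 ∈ Ω
  · by_cases hpw : p.2 < w p.1 <;> simp [indicator, mem_iff, hpΩ, hpw]
  · simp [hH p fun h => hpΩ h.1, indicator]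

theorem integral_inner_eq_sum_integral_max {ι E : Type*} [Fintype ι] [TopologicalSpace E]
    [T2Space E] [MeasureSpace E] [OpensMeasurableSpace E]
    [IsFiniteMeasureOnCompacts (volume : Measure E)] {Ω : Set E}
    {φ : E × ℝ → EuclideanSpace ℝ ι} (hφ : IsCompactlySupportedIn (Ω ×ˢ univ) φ) {v : E → ℝ}
    (hv : Continuous v) {G : E → EuclideanSpace ℝ ι} (hG : Continuous G) :
    ∫ x, inner ℝ (φ (x, v x)) (G x) =
      ∑ j, ((∫ x, φ (x, v x) j * max (1 * G x j) 0) - ∫ x, φ (x, v x) j * max (-1 * G x j) 0) := by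
  have integrable (s : ℝ) j : Integrable fun x => φ (x, v x) j * max (s * G x j) 0 :=
    integrable_graph_mul (hφ.apply j) hv (by fun_prop)
  simp_rw [← integral_sub (integrable 1 _) (integrable (-1) _)]
  refine Eq.trans ?_ (integral_finsetSum _ fun j _ => (integrable 1 j).sub (integrable (-1) j))
  refine integral_congr_ae (Eventually.of_forall fun x => ?_)
  simp only [PiLp.inner_apply, RCLike.inner_apply, conj_trivial]
  refine Finset.sum_congr rfl fun j _ => ?_
  rw [← mul_sub, one_mul, neg_one_mul, max_zero_sub_max_neg_zero_eq_self, mul_comm]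

variable {E : Type*} [NormedAddCommGroup E] [NormedSpace ℝ E] [MeasureSpace E] [BorelSpace E]
  {m : ℕ} {X : Fin m → E → E} {Ω : Set E} {u w : E → ℝ}

theorem isHDerivative_subgraph_iff (hΩ : MeasurableSet Ω)
    (huw : u =ᵐ[volume.restrict Ω] w) (hw : Measurable w)
    (D : RadonVectorMeasure (Ω ×ˢ (univ : Set ℝ)) (EuclideanSpace ℝ (Fin (m + 1)))) :
    IsHDerivative (extendedFields X) (Ω ×ˢ univ)
        ((subgraph Ω u).indicator (fun _ => (1 : ℝ))) D ↔
      ∀ φ : E × ℝ → EuclideanSpace ℝ (Fin (m + 1)), ContDiff ℝ 1 φ →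
        ∀ (hc : HasCompactSupport φ) (hs : tsupport φ ⊆ Ω ×ˢ univ),
          (D.onCompact (tsupport φ) hc hs).integral φ (innerSL ℝ) =
            -∫ p in {p : E × ℝ | p.2 < w p.1}, divX (extendedFields X) φ p := by
  refine forall_congr' fun φ => forall_congr' fun _ => forall_congr' fun hc =>
    forall_congr' fun hs => ?_
  rw [integral_indicator_subgraph_mul hΩ huw hw fun p hp =>
    divX_of_notMem_tsupport fun h => hp (hs h)]

variable [FiniteDimensional ℝ E] [(volume : Measure E).IsAddHaarMeasure] {M : Measure E}
  {τ : E → EuclideanSpace ℝ (Fin (m + 1))}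

theorem IsAsymptoticallyDominated.exists_graph_limit_measure_max {ι : Type*} [Fintype ι]
    {v : ℕ → E → ℝ} {G : ℕ → E → EuclideanSpace ℝ ι}
    (hG : IsAsymptoticallyDominated Ω (fun k x => ‖G k x‖ₑ) M) (hΩ : IsOpen Ω)
    (hM : ∀ K, IsCompact K → K ⊆ Ω → M K < ⊤) {F : Ultrafilter ℕ} (hF : (F : Filter ℕ) ≤ atTop)
    (hv : ∀ k, Continuous (v k)) (hGc : ∀ k, Continuous (G k)) {s : ℝ} (hs : |s| = 1) (j : ι) :
    ∃ μ : Measure (E × ℝ), SigmaFinite μ ∧ (∀ K, IsCompact K → K ⊆ Ω ×ˢ univ → μ K < ⊤) ∧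
      ∀ φ, IsCompactlySupportedIn (Ω ×ˢ univ) φ →
        Tendsto (fun k => ∫ x, φ (x, v k x) * max (s * G k x j) 0) F (𝓝 (∫ p, φ p ∂μ)) := by
  refine hG.exists_graph_limit_measure hΩ hM hF hv (fun k => ?_) (fun k x => le_max_right _ _)
    fun k x => ?_
  · have := hGc k
    fun_prop
  · have abs_max_le : |max (s * G k x j) 0| ≤ |G k x j| := by
      rw [abs_of_nonneg (le_max_right _ _), ← one_mul |G k x j|, ← hs, ← abs_mul]
      exact max_le (le_abs_self _) (abs_nonneg _)
    rw [← ofReal_norm, ← ofReal_norm]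
    exact ENNReal.ofReal_le_ofReal (abs_max_le.trans (PiLp.norm_apply_le (G k x) j))

theorem IsGraphMeasure.exists_integral_eq_neg_integral_divX (h : IsGraphMeasure X Ω w M τ)
    (hΩ : IsOpen Ω) (hX : ∀ i, ContDiff ℝ 1 (X i)) (hw : Integrable w) (hwm : Measurable w) :
    ∃ D : RadonVectorMeasure (Ω ×ˢ (univ : Set ℝ)) (EuclideanSpace ℝ (Fin (m + 1))),
      ∀ φ : E × ℝ → EuclideanSpace ℝ (Fin (m + 1)), ContDiff ℝ 1 φ →
        ∀ (hc : HasCompactSupport φ) (hs : tsupport φ ⊆ Ω ×ˢ univ),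
          (D.onCompact (tsupport φ) hc hs).integral φ (innerSL ℝ) =
            -∫ p in {p : E × ℝ | p.2 < w p.1}, divX (extendedFields X) φ p := by
  have := FiniteDimensional.proper_real E
  obtain ⟨v, hv, dominated, tendsto_integral⟩ := h.exists_contDiff_approximation hΩ hX hw hwm
  have hF : (Ultrafilter.of (atTop : Filter ℕ) : Filter ℕ) ≤ atTop := Ultrafilter.of_le _
  have continuous_v k := (hv k).continuous
  have continuous_gradient k := continuous_graphGradient hX (hv k)
  choose μ _ hμfin hμ using dominated.exists_graph_limit_measure_max hΩ h.lt_top hF continuous_v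
    continuous_gradient (s := 1) (by simp)
  choose ν _ hνfin hν using dominated.exists_graph_limit_measure_max hΩ h.lt_top hF continuous_v
    continuous_gradient (s := -1) (by simp)
  obtain ⟨D, hD⟩ := RadonVectorMeasure.exists_integral_eq_sum_sub μ ν hμfin hνfin
  refine ⟨D, fun φ hφ hc hs => ?_⟩
  have hφc : IsCompactlySupportedIn (Ω ×ˢ univ) φ := ⟨hφ.continuous, hc, hs⟩
  rw [hD φ hφ.continuous hc hs]
  refine tendsto_nhds_unique ?_ ((tendsto_integral φ hφ hc).mono_left hF)
  refine (tendsto_finsetSum Finset.univ fun j _ =>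
    (hμ j _ (hφc.apply j)).sub (hν j _ (hφc.apply j))).congr fun k => ?_
  exact (integral_inner_eq_sum_integral_max hφc (continuous_v k) (continuous_gradient k)).symm

end SubgraphDerivative

theorem exists_tendsto_contDiff {Z V : Type*} [NormedAddCommGroup Z] [NormedSpace ℝ Z]
    [FiniteDimensional ℝ Z] [MeasurableSpace Z] [BorelSpace Z] [NormedAddCommGroup V]
    [NormedSpace ℝ V] {U K : Set Z} (hU : IsOpen U) {P : Measure Z}
    (hP : ∀ K, IsCompact K → K ⊆ U → P K < ⊤) (hK : IsCompact K) (hKU : K ⊆ U)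
    {h : Z → V} (hm : StronglyMeasurable h) {C : ℝ} (hC : ∀ z, ‖h z‖ ≤ C)
    (h0 : ∀ z, z ∉ K → h z = 0) :
    ∃ φ : ℕ → Z → V, (∀ k, ContDiff ℝ 1 (φ k)) ∧ (∀ k, IsCompactlySupportedIn U (φ k)) ∧
      Tendsto (fun k => ∫⁻ z, ‖φ k z - h z‖ₑ ∂P) atTop (𝓝 0) := by
  obtain ⟨χ, hχ, hχc, hχ1, hχ01⟩ := exists_contDiff_cutoff hK hU hKU
  have : IsFiniteMeasure (P.restrict (tsupport χ)) :=
    ⟨by simpa using hP _ hχc.hasCompactSupport hχc.tsupport_subset⟩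
  have memLp : MemLp h 1 (P.restrict (tsupport χ)) :=
    MemLp.of_bound hm.aestronglyMeasurable C (Eventually.of_forall hC)
  obtain ⟨ε, -, hε0, hε⟩ := exists_seq_strictAnti_tendsto (0 : ℝ)
  choose g _ hg hgh using fun k =>
    memLp.exist_eLpNorm_sub_le ENNReal.one_ne_top le_rfl (hε0 k)
  refine ⟨fun k z => χ z • g k z, fun k =>
    (hχ.of_le (mod_cast le_top)).smul ((hg k).of_le (mod_cast le_top)), fun k =>
    ⟨hχc.continuous.smul (hg k).continuous, hχc.hasCompactSupport.smul_right,
      (tsupport_smul_subset_left _ _).trans hχc.tsupport_subset⟩, ?_⟩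
  have tendsto_ofReal : Tendsto (fun k => ENNReal.ofReal (ε k)) atTop (𝓝 0) := by
    simpa using ENNReal.tendsto_ofReal hε
  refine tendsto_of_tendsto_of_tendsto_of_le_of_le tendsto_const_nhds tendsto_ofReal
    (fun _ => zero_le) fun k => le_trans ?_ (hgh k)
  rw [eLpNorm_one_eq_lintegral_enorm, ← lintegral_indicator (isClosed_tsupport χ).measurableSet]
  refine lintegral_mono fun z => ?_
  have smul_eq : χ z • h z = h z := by
    by_cases hz : z ∈ K
    · rw [hχ1 z hz, one_smul]
    · rw [h0 z hz, smul_zero]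
  by_cases hz : z ∈ tsupport χ
  · have sub_eq : χ z • g k z - h z = χ z • (g k z - h z) := by rw [smul_sub, smul_eq]
    rw [indicator_of_mem hz, sub_eq, enorm_smul, Pi.sub_apply, enorm_sub_rev (h z)]
    refine mul_le_of_le_one_left zero_le ?_
    rw [← ofReal_norm, Real.norm_of_nonneg (hχ01 z).1]
    exact ENNReal.ofReal_le_one.2 (hχ01 z).2
  · rw [image_eq_zero_of_notMem_tsupport hz, zero_smul] at smul_eq
    simp [← smul_eq, image_eq_zero_of_notMem_tsupport hz]

section TotalVariation

variable {Z : Type*} [MeasurableSpace Z]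

theorem tendsto_integral_of_enorm_sub_le {V W : Type*} [NormedAddCommGroup V]
    [NormedAddCommGroup W] [NormedSpace ℝ W] {P Q : Measure Z} (hQP : Q ≤ P) {F : ℕ → Z → W}
    {G : Z → W} (hG : AEStronglyMeasurable G Q) (hF : ∀ k, Integrable (F k) Q) {φ : ℕ → Z → V}
    {h : Z → V} (hφ : Tendsto (fun k => ∫⁻ z, ‖φ k z - h z‖ₑ ∂P) atTop (𝓝 0))
    (hle : ∀ k z, ‖F k z - G z‖ ≤ ‖φ k z - h z‖) :
    Tendsto (fun k => ∫ z, F k z ∂Q) atTop (𝓝 (∫ z, G z ∂Q)) := by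
  refine tendsto_integral_of_L1 _ hG (Eventually.of_forall hF) ?_
  refine tendsto_of_tendsto_of_tendsto_of_le_of_le tendsto_const_nhds hφ (fun _ => zero_le)
    fun k => (lintegral_mono fun z => ?_).trans (lintegral_mono' hQP le_rfl)
  exact enorm_le_iff_norm_le.2 (hle k z)

variable {V : Type*} [NormedAddCommGroup V]

theorem integrable_indicator_of_norm_le {P : Measure Z} {s : Set Z} (hs : MeasurableSet s)
    (hP : P s < ⊤) {f : Z → V} (hf : AEStronglyMeasurable f P) {C : ℝ} (hC : ∀ z, ‖f z‖ ≤ C) :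
    Integrable (s.indicator f) P :=
  (integrable_indicator_iff hs).2
    (Measure.integrableOn_of_bounded hP.ne hf (Eventually.of_forall hC))

variable [InnerProductSpace ℝ V]

theorem integral_inner_indicator_self {P : Measure Z} {ν : Z → V} (hν : ∀ᵐ z ∂P, ‖ν z‖ = 1)
    {s : Set Z} (hs : MeasurableSet s) : ∫ z, inner ℝ (s.indicator ν z) (ν z) ∂P = P.real s := by
  rw [← integral_indicator_one hs]
  refine integral_congr_ae ?_
  filter_upwards [hν] with z hz
  by_cases hzs : z ∈ s <;> simp [hzs, hz]

theorem tendsto_integral_inner {P Q : Measure Z} (hQP : Q ≤ P) {ν : Z → V}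
    (hν : AEStronglyMeasurable ν Q) (hν1 : ∀ z, ‖ν z‖ ≤ 1) {h : Z → V} (hh : Integrable h Q)
    {φ : ℕ → Z → V} (hφ : ∀ k, Integrable (φ k) Q)
    (hφh : Tendsto (fun k => ∫⁻ z, ‖φ k z - h z‖ₑ ∂P) atTop (𝓝 0)) :
    Tendsto (fun k => ∫ z, inner ℝ (φ k z) (ν z) ∂Q) atTop (𝓝 (∫ z, inner ℝ (h z) (ν z) ∂Q)) := by
  refine tendsto_integral_of_enorm_sub_le hQP (hh.aestronglyMeasurable.inner hν) (fun k => ?_)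
    hφh fun k z => ?_
  · simpa only [real_inner_comm] using integrable_inner_of_norm_le (hφ k) hν hν1
  · rw [← inner_sub_left]
    exact (norm_inner_le_norm _ _).trans (mul_le_of_le_one_right (norm_nonneg _) (hν1 z))

theorem measure_le_of_integral_inner_le {Z : Type*} [NormedAddCommGroup Z] [NormedSpace ℝ Z]
    [FiniteDimensional ℝ Z] [MeasurableSpace Z] [BorelSpace Z] {U : Set Z} (hU : IsOpen U)
    {Q μ : Measure Z} (hQ : ∀ K, IsCompact K → K ⊆ U → Q K < ⊤)
    (hμ : ∀ K, IsCompact K → K ⊆ U → μ K < ⊤)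
    {ν : Z → V} (hν : StronglyMeasurable ν) (hν1 : ∀ z, ‖ν z‖ ≤ 1) (hν2 : ∀ᵐ z ∂Q, ‖ν z‖ = 1)
    (hle : ∀ φ : Z → V, ContDiff ℝ 1 φ → IsCompactlySupportedIn U φ →
      ∫ z, inner ℝ (φ z) (ν z) ∂Q ≤ ∫ z, ‖φ z‖ ∂μ)
    {K : Set Z} (hK : IsCompact K) (hKU : K ⊆ U) : Q K ≤ μ K := by
  obtain ⟨φ, hφ, hφc, hφt⟩ := exists_tendsto_contDiff (P := Q + μ) hU
    (fun L hL hLU => ENNReal.add_lt_top.2 ⟨hQ L hL hLU, hμ L hL hLU⟩) hK hKU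
    (hν.indicator hK.measurableSet) (fun z => (norm_indicator_le_norm_self _ _).trans (hν1 z))
    fun z hz => indicator_of_notMem hz ν
  have integrable_indicator {R : Measure Z} (hR : R K < ⊤) : Integrable (K.indicator ν) R :=
    integrable_indicator_of_norm_le hK.measurableSet hR hν.aestronglyMeasurable hν1
  have tendsto_inner := tendsto_integral_inner (Measure.le_add_right le_rfl)
    hν.aestronglyMeasurable hν1 (integrable_indicator (hQ K hK hKU))
    (fun k => (hφc k).integrable hQ) hφt
  have tendsto_norm : Tendsto (fun k => ∫ z, ‖φ k z‖ ∂μ) atTop (𝓝 (∫ z, ‖K.indicator ν z‖ ∂μ)) :=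
    tendsto_integral_of_enorm_sub_le (Measure.le_add_left le_rfl)
      (integrable_indicator (hμ K hK hKU)).norm.aestronglyMeasurable
      (fun k => ((hφc k).integrable hμ).norm) hφt fun k z => abs_norm_sub_norm_le _ _
  have norm_le : ∫ z, ‖K.indicator ν z‖ ∂μ ≤ μ.real K := by
    simp_rw [norm_indicator_eq_indicator_norm]
    rw [integral_indicator hK.measurableSet, ← one_mul (μ.real K)]
    exact (Real.le_norm_self _).trans
      (norm_setIntegral_le_of_norm_le_const (hμ K hK hKU) fun z _ => by simpa using hν1 z)
  have limit_le :=
    le_of_tendsto_of_tendsto' tendsto_inner tendsto_norm fun k => hle _ (hφ k) (hφc k)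
  rw [integral_inner_indicator_self hν2 hK.measurableSet] at limit_le
  exact (ENNReal.toReal_le_toReal (hQ K hK hKU).ne (hμ K hK hKU).ne).1 (limit_le.trans norm_le)

end TotalVariation

section VerticalCutoff

variable {E : Type*} [NormedAddCommGroup E] [NormedSpace ℝ E]
  {m : ℕ} {X : Fin m → E → E} {g : E → EuclideanSpace ℝ (Fin (m + 1))}

theorem horizontalDiv_of_notMem_tsupport {x : E} (hx : x ∉ tsupport g) :
    horizontalDiv X g x = 0 :=
  Finset.sum_eq_zero fun i _ => by
    have tsupport_subset : tsupport (fun y => g y i.castSucc • X i y) ⊆ tsupport g :=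
      closure_mono (Function.support_subset_iff'.2 fun y hy => by
        simp [Function.notMem_support.1 hy])
    exact fieldDiv_of_notMem_tsupport (notMem_subset tsupport_subset hx)

theorem hasCompactSupport_horizontalDiv (hc : HasCompactSupport g) :
    HasCompactSupport (horizontalDiv X g) :=
  HasCompactSupport.intro hc fun _ hx => horizontalDiv_of_notMem_tsupport hx

theorem contDiff_apply_smul (hX : ∀ i, ContDiff ℝ 1 (X i)) (hg : ContDiff ℝ 1 g) (i : Fin m) :
    ContDiff ℝ 1 fun y => g y i.castSucc • X i y := by
  have := hX i
  fun_prop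

/-- The integral of `div (η g)` over the column `{x} × (-∞, w x)`, up to a multiple of
`horizontalDiv X g x` by a constant independent of `x`, which disappears after integration
in `x`. -/
noncomputable def columnIntegral (X : Fin m → E → E) (g : E → EuclideanSpace ℝ (Fin (m + 1)))
    (η : ℝ → ℝ) (w : E → ℝ) (x : E) : ℝ :=
  horizontalDiv X g x * (∫ t in (0 : ℝ)..w x, η t) + g x (Fin.last m) * η (w x)

theorem columnIntegral_eq_of_eq_one {η : ℝ → ℝ} {w : E → ℝ} {x : E}
    (hη : ∀ t, |t| ≤ |w x| → η t = 1) :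
    columnIntegral X g η w x = w x * horizontalDiv X g x + g x (Fin.last m) := by
  have primitive_eq : ∫ t in (0 : ℝ)..w x, η t = ∫ _ in (0 : ℝ)..w x, (1 : ℝ) :=
    intervalIntegral.integral_congr fun t ht => hη t <| by
      simpa using abs_sub_left_of_mem_uIcc ht
  rw [columnIntegral, primitive_eq, hη _ le_rfl]
  simp [mul_comm]

variable [FiniteDimensional ℝ E]

theorem divX_extendedFields_smul (hX : ∀ i, ContDiff ℝ 1 (X i)) (hg : ContDiff ℝ 1 g)
    {η : ℝ → ℝ} (hη : ContDiff ℝ 1 η) (x : E) (t : ℝ) :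
    divX (extendedFields X) (fun p => η p.2 • g p.1) (x, t) =
      horizontalDiv X g x * η t + g x (Fin.last m) * deriv η t := by
  have hηt : HasFDerivAt (fun q : E × ℝ => η q.2)
      ((fderiv ℝ η t).comp (ContinuousLinearMap.snd ℝ E ℝ)) (x, t) :=
    (hη.differentiable one_ne_zero t).hasFDerivAt.comp (x, t) hasFDerivAt_snd
  have horizontal (i : Fin m) :
      fieldDiv (fun q : E × ℝ => (η q.2 • g q.1) i.castSucc • (X i q.1, (0 : ℝ))) (x, t) =
        η t * fieldDiv (fun y => g y i.castSucc • X i y) x := by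
    have hY := (contDiff_apply_smul hX hg i).differentiable one_ne_zero x
    have assoc : (fun q : E × ℝ => (η q.2 • g q.1) i.castSucc • (X i q.1, (0 : ℝ))) =
        fun q => η q.2 • (g q.1 i.castSucc • X i q.1, (0 : ℝ)) := by
      ext q <;> simp [mul_smul]
    rw [assoc, fieldDiv_smul_prodMk_zero hηt.differentiableAt hY, hηt.fderiv]
    simp
  have vertical :
      fieldDiv (fun q : E × ℝ => (η q.2 • g q.1) (Fin.last m) • ((0 : E), (1 : ℝ))) (x, t) =
        g x (Fin.last m) * deriv η t := by
    have hgl : DifferentiableAt ℝ (fun y => g y (Fin.last m)) x := by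
      have := hg.differentiable one_ne_zero x
      fun_prop
    have hglt : HasFDerivAt (fun q : E × ℝ => g q.1 (Fin.last m)) _ (x, t) :=
      hgl.hasFDerivAt.comp (f := Prod.fst) (x, t) hasFDerivAt_fst
    have product := hηt.fun_mul hglt
    rw [show (fun q : E × ℝ => (η q.2 • g q.1) (Fin.last m) • ((0 : E), (1 : ℝ))) =
      fun q => (η q.2 * g q.1 (Fin.last m)) • ((0 : E), (1 : ℝ)) from rfl,
      fieldDiv_smul_const product.differentiableAt, product.fderiv]
    simp
  rw [divX_extendedFields, vertical, Finset.sum_congr rfl fun i _ => horizontal i,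
    ← Finset.mul_sum, mul_comm (η t)]
  rfl

theorem continuous_horizontalDiv (hX : ∀ i, ContDiff ℝ 1 (X i)) (hg : ContDiff ℝ 1 g) :
    Continuous (horizontalDiv X g) :=
  continuous_finsetSum _ fun i _ => continuous_fieldDiv (contDiff_apply_smul hX hg i)

theorem integral_Iio_divX_smul (hX : ∀ i, ContDiff ℝ 1 (X i)) (hg : ContDiff ℝ 1 g) {η : ℝ → ℝ}
    (hη : ContDiff ℝ 1 η) (hηc : HasCompactSupport η) (w : E → ℝ) (x : E) :
    ∫ t in Iio (w x), divX (extendedFields X) (fun p => η p.2 • g p.1) (x, t) =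
      horizontalDiv X g x * (∫ t in Iio 0, η t) + columnIntegral X g η w x := by
  have hηi : Integrable η := hη.continuous.integrable_of_hasCompactSupport hηc
  have hdi : Integrable (deriv η) :=
    (hη.continuous_deriv le_rfl).integrable_of_hasCompactSupport hηc.deriv
  simp_rw [divX_extendedFields_smul hX hg hη]
  rw [integral_add (hηi.integrableOn.const_mul _) (hdi.integrableOn.const_mul _),
    integral_const_mul, integral_const_mul, ← integral_Iic_eq_integral_Iio,
    ← integral_Iic_eq_integral_Iio, ← integral_Iic_eq_integral_Iio,
    hηc.integral_Iic_deriv_eq hη, columnIntegral, ← intervalIntegral.integral_Iic_sub_Iic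
      hηi.integrableOn hηi.integrableOn]
  ring

variable [MeasureSpace E] [BorelSpace E]

theorem aestronglyMeasurable_columnIntegral (hX : ∀ i, ContDiff ℝ 1 (X i))
    (hg : ContDiff ℝ 1 g) {η : ℝ → ℝ} (hη : Continuous η) {w : E → ℝ} (hw : Measurable w) :
    AEStronglyMeasurable (columnIntegral X g η w) := by
  have := (continuous_horizontalDiv hX hg).measurable
  have := hη.measurable
  have := hg.continuous
  have : Measurable fun x => g x (Fin.last m) := by fun_prop
  have : Measurable fun s => ∫ t in (0 : ℝ)..s, η t :=
    (intervalIntegral.continuous_primitive (fun a b => hη.intervalIntegrable a b) 0).measurable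
  unfold columnIntegral
  fun_prop

variable [(volume : Measure E).IsAddHaarMeasure]

theorem exists_integrable_bound_columnIntegral (hX : ∀ i, ContDiff ℝ 1 (X i))
    (hg : ContDiff ℝ 1 g) (hc : HasCompactSupport g) {w : E → ℝ} (hw : Integrable w) :
    ∃ F : E → ℝ, Integrable F ∧
      ∀ η : ℝ → ℝ, (∀ t, |η t| ≤ 1) → ∀ x, ‖columnIntegral X g η w x‖ ≤ F x := by
  obtain ⟨C, hC⟩ := (continuous_horizontalDiv hX hg).bounded_above_of_compact_support
    (hasCompactSupport_horizontalDiv hc)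
  have := hg.continuous
  have integrable_last : Integrable fun x => g x (Fin.last m) :=
    Continuous.integrable_of_hasCompactSupport (by fun_prop) (hasCompactSupport_apply hc _)
  refine ⟨fun x => C * ‖w x‖ + ‖g x (Fin.last m)‖, (hw.norm.const_mul C).add integrable_last.norm,
    fun η hη x => (norm_add_le _ _).trans (add_le_add ?_ ?_)⟩
  · have primitive_le : ‖∫ t in (0 : ℝ)..w x, η t‖ ≤ ‖w x‖ := by
      simpa using intervalIntegral.norm_integral_le_of_norm_le_const (f := η) (a := 0)
        (b := w x) fun t _ => hη t
    rw [norm_mul]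
    exact mul_le_mul (hC x) primitive_le (norm_nonneg _) ((norm_nonneg _).trans (hC x))
  · rw [norm_mul]
    exact mul_le_of_le_one_right (norm_nonneg _) (hη _)

theorem integrable_horizontalDiv (hX : ∀ i, ContDiff ℝ 1 (X i)) (hg : ContDiff ℝ 1 g)
    (hc : HasCompactSupport g) : Integrable (horizontalDiv X g) :=
  (continuous_horizontalDiv hX hg).integrable_of_hasCompactSupport
    (hasCompactSupport_horizontalDiv hc)

theorem integral_horizontalDiv_eq_zero (hX : ∀ i, ContDiff ℝ 1 (X i)) (hg : ContDiff ℝ 1 g)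
    (hc : HasCompactSupport g) : ∫ x, horizontalDiv X g x = 0 := by
  have hc' (i : Fin m) : HasCompactSupport fun y => g y i.castSucc • X i y :=
    (hasCompactSupport_apply hc _).smul_right
  simp only [horizontalDiv]
  rw [integral_finsetSum _ fun i _ => (continuous_fieldDiv (contDiff_apply_smul hX hg i)
    ).integrable_of_hasCompactSupport (hasCompactSupport_fieldDiv (hc' i))]
  exact Finset.sum_eq_zero fun i _ =>
    integral_fieldDiv_eq_zero (contDiff_apply_smul hX hg i) (hc' i)

theorem integral_lt_graph_divX_smul (hX : ∀ i, ContDiff ℝ 1 (X i)) (hg : ContDiff ℝ 1 g)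
    (hc : HasCompactSupport g) {η : ℝ → ℝ} (hη : ContDiff ℝ 1 η) (hηc : HasCompactSupport η)
    (hη1 : ∀ t, |η t| ≤ 1) {w : E → ℝ} (hwm : Measurable w) (hw : Integrable w) :
    ∫ p in {p : E × ℝ | p.2 < w p.1}, divX (extendedFields X) (fun p => η p.2 • g p.1) p =
      ∫ x, columnIntegral X g η w x := by
  have := FiniteDimensional.proper_real E
  have hφ : ContDiff ℝ 1 fun p : E × ℝ => η p.2 • g p.1 := by fun_prop
  have hφc : HasCompactSupport fun p : E × ℝ => η p.2 • g p.1 :=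
    (IsCompactlySupportedIn.smul_prod ⟨hg.continuous, hc, subset_univ _⟩
      ⟨hη.continuous, hηc, subset_univ _⟩).hasCompactSupport
  obtain ⟨F, hF, hFη⟩ := exists_integrable_bound_columnIntegral hX hg hc hw
  have integrable_column : Integrable (columnIntegral X g η w) :=
    hF.mono' (aestronglyMeasurable_columnIntegral hX hg hη.continuous hwm)
      (Eventually.of_forall (hFη η hη1))
  rw [integral_lt_graph hwm ((continuous_divX (contDiff_extendedFields hX) hφ
    ).integrable_of_hasCompactSupport (hasCompactSupport_divX hφc))]
  simp_rw [integral_Iio_divX_smul hX hg hη hηc]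
  rw [integral_add ((integrable_horizontalDiv hX hg hc).mul_const _) integrable_column,
    integral_mul_const, integral_horizontalDiv_eq_zero hX hg hc, zero_mul, zero_add]

theorem exists_vertical_cutoff : ∃ η : ℕ → ℝ → ℝ, (∀ k, ContDiff ℝ 1 (η k)) ∧
    (∀ k, HasCompactSupport (η k)) ∧ (∀ k t, |η k t| ≤ 1) ∧
    ∀ r : ℝ, ∀ᶠ k in atTop, ∀ t, |t| ≤ r → η k t = 1 := by
  choose η hη hηc hη1 hη01 using fun k : ℕ =>
    exists_contDiff_cutoff (isCompact_Icc (a := -(k : ℝ)) (b := k)) isOpen_univ (subset_univ _)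
  refine ⟨η, fun k => (hη k).of_le (mod_cast le_top), fun k => (hηc k).hasCompactSupport,
    fun k t => (abs_of_nonneg (hη01 k t).1).trans_le (hη01 k t).2, fun r => ?_⟩
  filter_upwards [eventually_ge_atTop ⌈r⌉₊] with k hk t ht
  exact hη1 k t (abs_le.1 (ht.trans (Nat.ceil_le.1 hk)))

theorem tendsto_integral_lt_graph_divX_smul (hX : ∀ i, ContDiff ℝ 1 (X i)) (hg : ContDiff ℝ 1 g)
    (hc : HasCompactSupport g) {w : E → ℝ} (hwm : Measurable w) (hw : Integrable w)
    {η : ℕ → ℝ → ℝ} (hη : ∀ k, ContDiff ℝ 1 (η k)) (hηc : ∀ k, HasCompactSupport (η k))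
    (hη1 : ∀ k t, |η k t| ≤ 1) (hηt : ∀ r : ℝ, ∀ᶠ k in atTop, ∀ t, |t| ≤ r → η k t = 1) :
    Tendsto (fun k => ∫ p in {p : E × ℝ | p.2 < w p.1},
        divX (extendedFields X) (fun p => η k p.2 • g p.1) p) atTop
      (𝓝 ((∫ x, w x * horizontalDiv X g x) + ∫ x, g x (Fin.last m))) := by
  obtain ⟨C, hC⟩ := (continuous_horizontalDiv hX hg).bounded_above_of_compact_support
    (hasCompactSupport_horizontalDiv hc)
  have integrable_mul : Integrable fun x => w x * horizontalDiv X g x :=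
    hw.mul_bdd (continuous_horizontalDiv hX hg).aestronglyMeasurable (Eventually.of_forall hC)
  have := hg.continuous
  have integrable_last : Integrable fun x => g x (Fin.last m) :=
    Continuous.integrable_of_hasCompactSupport (by fun_prop) (hasCompactSupport_apply hc _)
  obtain ⟨F, hF, hFη⟩ := exists_integrable_bound_columnIntegral hX hg hc hw
  rw [← integral_add integrable_mul integrable_last]
  simp_rw [fun k => integral_lt_graph_divX_smul hX hg hc (hη k) (hηc k) (hη1 k) hwm hw]
  refine tendsto_integral_of_dominated_convergence F
    (fun k => aestronglyMeasurable_columnIntegral hX hg (hη k).continuous hwm) hF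
    (fun k => Eventually.of_forall (hFη _ (hη1 k))) (Eventually.of_forall fun x => ?_)
  refine tendsto_const_nhds.congr' ?_
  filter_upwards [hηt |w x|] with k hk
  exact (columnIntegral_eq_of_eq_one hk).symm

end VerticalCutoff

section SubgraphDerivative

variable {E : Type*} [NormedAddCommGroup E] [NormedSpace ℝ E] [MeasureSpace E]
  {m : ℕ} {X : Fin m → E → E} {Ω : Set E} {w : E → ℝ} {Q : Measure (E × ℝ)}
  {ν : E × ℝ → EuclideanSpace ℝ (Fin (m + 1))}

/-- `ν Q` is the polar decomposition of the horizontal derivative in `Ω × ℝ` of the indicator of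
the subgraph of `w`. The density `ν` is normalized to be measurable with `|ν| ≤ 1` everywhere. -/
structure IsSubgraphDerivative (X : Fin m → E → E) (Ω : Set E) (w : E → ℝ) (Q : Measure (E × ℝ))
    (ν : E × ℝ → EuclideanSpace ℝ (Fin (m + 1))) : Prop where
  measurable : Measurable ν
  norm_le_one : ∀ p, ‖ν p‖ ≤ 1
  norm_eq_one : ∀ᵐ p ∂Q, ‖ν p‖ = 1
  lt_top : ∀ K, IsCompact K → K ⊆ Ω ×ˢ univ → Q K < ⊤
  measure_compl : Q (Ω ×ˢ univ)ᶜ = 0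
  integral_inner : ∀ φ : E × ℝ → EuclideanSpace ℝ (Fin (m + 1)), ContDiff ℝ 1 φ →
    IsCompactlySupportedIn (Ω ×ˢ univ) φ →
    ∫ p, inner ℝ (φ p) (ν p) ∂Q = -∫ p in {p : E × ℝ | p.2 < w p.1}, divX (extendedFields X) φ p

namespace IsSubgraphDerivative

variable [FiniteDimensional ℝ E] [BorelSpace E] [(volume : Measure E).IsAddHaarMeasure]
  {M : Measure E} {τ : E → EuclideanSpace ℝ (Fin (m + 1))}

theorem prod_le (hQ : IsSubgraphDerivative X Ω w Q ν) (h : IsGraphMeasure X Ω w M τ)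
    (hΩ : IsOpen Ω) (hX : ∀ i, ContDiff ℝ 1 (X i)) (hw : Integrable w) (hwm : Measurable w)
    {K : Set E} (hK : IsCompact K) (hKΩ : K ⊆ Ω) : Q (K ×ˢ univ) ≤ M K := by
  have := FiniteDimensional.proper_real E
  obtain ⟨μ, hμ, hμM, hμφ⟩ := h.exists_dominating_measure hΩ hX hw hwm
  refine measure_prod_univ_le_of_forall_isCompact fun L hL => ?_
  have le_dominating : Q (K ×ˢ L) ≤ μ (K ×ˢ L) :=
    measure_le_of_integral_inner_le (hΩ.prod isOpen_univ) hQ.lt_top hμ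
      hQ.measurable.stronglyMeasurable hQ.norm_le_one hQ.norm_eq_one
      (fun φ hφ hφc => (hQ.integral_inner φ hφ hφc).trans_le (hμφ φ hφ hφc))
      (hK.prod hL) (prod_mono hKΩ (subset_univ _))
  exact (le_dominating.trans (measure_mono (prod_mono_right (subset_univ _)))).trans (hμM K hK hKΩ)

theorem integrable_comp_fst (hQ : IsSubgraphDerivative X Ω w Q ν) (h : IsGraphMeasure X Ω w M τ)
    (hΩ : IsOpen Ω) (hX : ∀ i, ContDiff ℝ 1 (X i)) (hw : Integrable w) (hwm : Measurable w)
    {g : E → EuclideanSpace ℝ (Fin (m + 1))} (hg : IsCompactlySupportedIn Ω g) :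
    Integrable (fun p : E × ℝ => g p.1) Q := by
  obtain ⟨C, hC⟩ := hg.continuous.bounded_above_of_compact_support hg.hasCompactSupport
  have finite_column : Q (tsupport g ×ˢ univ) < ⊤ :=
    (hQ.prod_le h hΩ hX hw hwm hg.hasCompactSupport hg.tsupport_subset).trans_lt
      (h.lt_top _ hg.hasCompactSupport hg.tsupport_subset)
  have integrableOn_column : IntegrableOn (fun p : E × ℝ => g p.1) (tsupport g ×ˢ univ) Q :=
    Measure.integrableOn_of_bounded finite_column.ne
      (hg.continuous.measurable.comp measurable_fst).aestronglyMeasurable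
      (Eventually.of_forall fun p => hC p.1)
  have support_subset : Function.support (fun p : E × ℝ => g p.1) ⊆ tsupport g ×ˢ univ :=
    fun _ hp => ⟨subset_tsupport g hp, trivial⟩
  exact (integrableOn_iff_integrable_of_support_subset support_subset).1 integrableOn_column

theorem integral_inner_fst (hQ : IsSubgraphDerivative X Ω w Q ν) (h : IsGraphMeasure X Ω w M τ)
    (hΩ : IsOpen Ω) (hX : ∀ i, ContDiff ℝ 1 (X i)) (hw : Integrable w) (hwm : Measurable w)
    {g : E → EuclideanSpace ℝ (Fin (m + 1))} (hg : ContDiff ℝ 1 g)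
    (hgc : IsCompactlySupportedIn Ω g) :
    ∫ p, inner ℝ (g p.1) (ν p) ∂Q = ∫ x, inner ℝ (g x) (τ x) ∂M := by
  have := FiniteDimensional.proper_real E
  have hc := hgc.hasCompactSupport
  obtain ⟨η, hη, hηc, hη1, hηt⟩ := exists_vertical_cutoff
  have truncated (k : ℕ) : IsCompactlySupportedIn (Ω ×ˢ univ) fun p => η k p.2 • g p.1 :=
    hgc.smul_prod ⟨(hη k).continuous, hηc k, subset_univ _⟩
  have integral_truncated (k : ℕ) : ∫ p, inner ℝ (η k p.2 • g p.1) (ν p) ∂Q =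
      -∫ p in {p : E × ℝ | p.2 < w p.1},
        divX (extendedFields X) (fun p => η k p.2 • g p.1) p :=
    hQ.integral_inner _ (((hη k).comp contDiff_snd).smul (hg.comp contDiff_fst)) (truncated k)
  have tendsto_divX :=
    (tendsto_integral_lt_graph_divX_smul hX hg hc hwm hw hη hηc hη1 hηt).neg
  rw [h.integral_inner g hg hc hgc.tsupport_subset, ← neg_add']
  refine tendsto_nhds_unique ?_ (tendsto_divX.congr fun k => (integral_truncated k).symm)
  refine tendsto_integral_of_dominated_convergence (fun p => ‖g p.1‖) (fun k => ?_)
    (hQ.integrable_comp_fst h hΩ hX hw hwm hgc).norm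
    (fun k => Eventually.of_forall fun p => ?_) (Eventually.of_forall fun p => ?_)
  · exact ((truncated k).continuous.measurable.inner hQ.measurable).aestronglyMeasurable
  · rw [inner_smul_left, norm_mul]
    exact (mul_le_of_le_one_left (norm_nonneg _) (by simpa using hη1 k p.2)).trans
      ((norm_inner_le_norm _ _).trans
        (mul_le_of_le_one_right (norm_nonneg _) (hQ.norm_le_one p)))
  · refine tendsto_const_nhds.congr' ?_
    filter_upwards [hηt |p.2|] with k hk
    rw [hk _ le_rfl, one_smul]

end IsSubgraphDerivative

end SubgraphDerivative

section PolarLift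

/-- The vector measure `ν Q` on `Z` lifts the vector measure `τ M` on `Ω` through `π`: they agree
on functions of `π`, and the total mass of the lift is not larger. Both densities are normalized to
be measurable with norm at most one everywhere. -/
structure IsPolarLift {Z E V : Type*} [MeasurableSpace Z] [NormedAddCommGroup E]
    [NormedSpace ℝ E] [MeasurableSpace E] [NormedAddCommGroup V] [InnerProductSpace ℝ V]
    [MeasurableSpace V] (Ω : Set E) (π : Z → E) (Q : Measure Z) (ν : Z → V) (M : Measure E)
    (τ : E → V) : Prop where
  measurable_proj : Measurable π
  measurable : Measurable ν
  measurable_base : Measurable τ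
  norm_le_one : ∀ z, ‖ν z‖ ≤ 1
  norm_base_le_one : ∀ x, ‖τ x‖ ≤ 1
  norm_eq_one : ∀ᵐ z ∂Q, ‖ν z‖ = 1
  norm_base_eq_one : ∀ᵐ x ∂M, ‖τ x‖ = 1
  base_lt_top : ∀ K, IsCompact K → K ⊆ Ω → M K < ⊤
  measure_compl : Q (π ⁻¹' Ω)ᶜ = 0
  measure_preimage_le : ∀ K, IsCompact K → K ⊆ Ω → Q (π ⁻¹' K) ≤ M K
  integral_inner_comp : ∀ g : E → V, ContDiff ℝ 1 g → IsCompactlySupportedIn Ω g →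
    ∫ z, inner ℝ (g (π z)) (ν z) ∂Q = ∫ x, inner ℝ (g x) (τ x) ∂M

theorem IsSubgraphDerivative.isPolarLift {E : Type*} [NormedAddCommGroup E] [NormedSpace ℝ E]
    [FiniteDimensional ℝ E] [MeasureSpace E] [BorelSpace E]
    [(volume : Measure E).IsAddHaarMeasure] {m : ℕ} {X : Fin m → E → E} {Ω : Set E} {w : E → ℝ}
    {Q : Measure (E × ℝ)} {ν : E × ℝ → EuclideanSpace ℝ (Fin (m + 1))} {M : Measure E}
    {τ : E → EuclideanSpace ℝ (Fin (m + 1))} (hQ : IsSubgraphDerivative X Ω w Q ν)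
    (h : IsGraphMeasure X Ω w M τ) (hτ : ∀ᵐ x ∂M, ‖τ x‖ = 1) (hΩ : IsOpen Ω)
    (hX : ∀ i, ContDiff ℝ 1 (X i)) (hw : Integrable w) (hwm : Measurable w) :
    IsPolarLift Ω Prod.fst Q ν M τ where
  measurable_proj := measurable_fst
  measurable := hQ.measurable
  measurable_base := h.measurable
  norm_le_one := hQ.norm_le_one
  norm_base_le_one := h.norm_le_one
  norm_eq_one := hQ.norm_eq_one
  norm_base_eq_one := hτ
  base_lt_top := h.lt_top
  measure_compl := by simpa only [prod_univ] using hQ.measure_compl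
  measure_preimage_le K hK hKΩ := by simpa only [prod_univ] using hQ.prod_le h hΩ hX hw hwm hK hKΩ
  integral_inner_comp _ hg hgc := hQ.integral_inner_fst h hΩ hX hw hwm hg hgc

theorem exists_compact_cover {E : Type*} [TopologicalSpace E] [LocallyCompactSpace E]
    [SecondCountableTopology E] {Ω : Set E} (hΩ : IsOpen Ω) :
    ∃ K : ℕ → Set E, (∀ j, IsCompact (K j)) ∧ (∀ j, K j ⊆ Ω) ∧ Ω ⊆ ⋃ j, K j := by
  have := hΩ.locallyCompactSpace
  refine ⟨fun j => Subtype.val '' compactCovering Ω j, fun j =>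
    (isCompact_compactCovering Ω j).image continuous_subtype_val,
    fun j => Subtype.coe_image_subset _ _, ?_⟩
  rw [← image_iUnion, iUnion_compactCovering, Subtype.coe_image_univ]

namespace IsPolarLift

variable {Z E V : Type*} [MeasurableSpace Z] [NormedAddCommGroup E] [NormedSpace ℝ E]
  [MeasurableSpace E] [BorelSpace E] [NormedAddCommGroup V] [InnerProductSpace ℝ V]
  [MeasurableSpace V]
  {Ω : Set E} {π : Z → E} {Q : Measure Z} {ν : Z → V} {M : Measure E} {τ : E → V}

theorem map_lt_top (h : IsPolarLift Ω π Q ν M τ) {K : Set E} (hK : IsCompact K) (hKΩ : K ⊆ Ω) :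
    Q.map π K < ⊤ := by
  rw [Measure.map_apply h.measurable_proj hK.measurableSet]
  exact (h.measure_preimage_le K hK hKΩ).trans_lt (h.base_lt_top K hK hKΩ)

variable [FiniteDimensional ℝ E]

theorem ae_of_ae_restrict (h : IsPolarLift Ω π Q ν M τ) (hΩ : IsOpen Ω) {p : Z → Prop}
    (hp : ∀ K, IsCompact K → K ⊆ Ω → ∀ᵐ z ∂Q.restrict (π ⁻¹' K), p z) : ∀ᵐ z ∂Q, p z := by
  have := FiniteDimensional.proper_real E
  obtain ⟨K, hK, hKΩ, hcov⟩ := exists_compact_cover hΩ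
  have ae_pieces : ∀ᵐ z ∂Q, ∀ j, z ∈ π ⁻¹' K j → p z := ae_all_iff.2 fun j =>
    (ae_restrict_iff' (h.measurable_proj (hK j).measurableSet)).1 (hp _ (hK j) (hKΩ j))
  have ae_mem : ∀ᵐ z ∂Q, π z ∈ Ω := h.measure_compl
  filter_upwards [ae_pieces, ae_mem] with z hz hzΩ
  obtain ⟨j, hj⟩ := mem_iUnion.1 (hcov hzΩ)
  exact hz j hj

variable [FiniteDimensional ℝ V] [BorelSpace V]

theorem setIntegral_inner (h : IsPolarLift Ω π Q ν M τ) (hΩ : IsOpen Ω) {B : Set E}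
    (hB : IsRelCompactBorel Ω B) : ∫ z in π ⁻¹' B, inner ℝ (τ (π z)) (ν z) ∂Q = M.real B := by
  obtain ⟨hBm, K, hK, hKΩ, hBK⟩ := hB
  have measurable_indicator : Measurable (B.indicator τ) := h.measurable_base.indicator hBm
  obtain ⟨φ, hφ, hφc, hφt⟩ := exists_tendsto_contDiff (P := M + Q.map π) hΩ
    (fun K hK hKΩ => ENNReal.add_lt_top.2 ⟨h.base_lt_top K hK hKΩ, h.map_lt_top hK hKΩ⟩) hK hKΩ
    measurable_indicator.stronglyMeasurable
    (fun x => (norm_indicator_le_norm_self _ _).trans (h.norm_base_le_one x))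
    fun x hx => indicator_of_notMem (fun hxB => hx (hBK hxB)) τ
  have integrable_indicator {R : Measure E} (hR : R K < ⊤) : Integrable (B.indicator τ) R :=
    integrable_indicator_of_norm_le hBm ((measure_mono hBK).trans_lt hR)
      h.measurable_base.aestronglyMeasurable h.norm_base_le_one
  have tendsto_base := tendsto_integral_inner (Measure.le_add_right le_rfl)
    h.measurable_base.aestronglyMeasurable h.norm_base_le_one
    (integrable_indicator (h.base_lt_top K hK hKΩ))
    (fun k => (hφc k).integrable h.base_lt_top) hφt
  have tendsto_comp :
      Tendsto (fun k => ∫⁻ z, ‖φ k (π z) - B.indicator τ (π z)‖ₑ ∂Q) atTop (𝓝 0) := by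
    refine tendsto_of_tendsto_of_tendsto_of_le_of_le tendsto_const_nhds hφt (fun _ => zero_le)
      fun k => le_of_eq_of_le ?_ (lintegral_mono' (Measure.le_add_left le_rfl) le_rfl)
    exact (lintegral_map ((hφ k).continuous.measurable.sub measurable_indicator).enorm
      h.measurable_proj).symm
  have tendsto_lift := tendsto_integral_inner le_rfl h.measurable.aestronglyMeasurable
    h.norm_le_one ((integrable_indicator (h.map_lt_top hK hKΩ)).comp_measurable h.measurable_proj)
    (fun k => ((hφc k).integrable fun _ => h.map_lt_top).comp_measurable h.measurable_proj)
    tendsto_comp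
  rw [← integral_inner_indicator_self h.norm_base_eq_one hBm, tendsto_nhds_unique
    (tendsto_base.congr fun k => (h.integral_inner_comp _ (hφ k) (hφc k)).symm) tendsto_lift,
    ← integral_indicator (h.measurable_proj hBm)]
  refine integral_congr_ae (Eventually.of_forall fun z => ?_)
  by_cases hz : π z ∈ B <;> simp [hz, indicator]

theorem ae_restrict_eq (h : IsPolarLift Ω π Q ν M τ) (hΩ : IsOpen Ω) {K : Set E}
    (hK : IsCompact K) (hKΩ : K ⊆ Ω) : ∀ᵐ z ∂Q.restrict (π ⁻¹' K), ν z = τ (π z) := by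
  have hle := h.measure_preimage_le K hK hKΩ
  have hfin := h.base_lt_top K hK hKΩ
  have : IsFiniteMeasure (Q.restrict (π ⁻¹' K)) := ⟨by simpa using hle.trans_lt hfin⟩
  have norm_inner_le (z : Z) : ‖inner ℝ (τ (π z)) (ν z)‖ ≤ 1 :=
    (norm_inner_le_norm _ _).trans
      (mul_le_one₀ (h.norm_base_le_one _) (norm_nonneg _) (h.norm_le_one z))
  have integrable_inner :
      Integrable (fun z => inner ℝ (τ (π z)) (ν z)) (Q.restrict (π ⁻¹' K)) :=
    Integrable.of_bound ((h.measurable_base.comp h.measurable_proj).inner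
      h.measurable).aestronglyMeasurable 1 (Eventually.of_forall norm_inner_le)
  have defect_nonneg (z : Z) : 0 ≤ 1 - inner ℝ (τ (π z)) (ν z) :=
    sub_nonneg.2 ((le_abs_self _).trans (norm_inner_le z))
  have integral_defect : ∫ z in π ⁻¹' K, (1 - inner ℝ (τ (π z)) (ν z)) ∂Q = 0 := by
    refine le_antisymm ?_ (integral_nonneg defect_nonneg)
    rw [integral_sub (integrable_const _) integrable_inner,
      h.setIntegral_inner hΩ (.of_isCompact hK hKΩ)]
    have real_le : Q.real (π ⁻¹' K) ≤ M.real K := ENNReal.toReal_mono hfin.ne hle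
    simpa using real_le
  have defect_eq_zero := (integral_eq_zero_iff_of_nonneg defect_nonneg
    ((integrable_const (1 : ℝ)).sub integrable_inner)).1 integral_defect
  filter_upwards [defect_eq_zero, ae_restrict_of_ae h.norm_eq_one] with z inner_eq_one norm_eq_one
  have norm_sub_sq := norm_sub_sq_real (τ (π z)) (ν z)
  rw [← sub_eq_zero.1 inner_eq_one, norm_eq_one] at norm_sub_sq
  have norm_sq_le : ‖τ (π z)‖ ^ 2 ≤ 1 :=
    pow_le_one₀ (norm_nonneg _) (h.norm_base_le_one _)
  have norm_sub_eq_zero : ‖τ (π z) - ν z‖ = 0 := by nlinarith [norm_nonneg (τ (π z) - ν z)]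
  exact (sub_eq_zero.1 (norm_eq_zero.1 norm_sub_eq_zero)).symm

theorem measure_preimage (h : IsPolarLift Ω π Q ν M τ) (hΩ : IsOpen Ω) {B : Set E}
    (hB : IsRelCompactBorel Ω B) : Q (π ⁻¹' B) = M B := by
  have integral_eq := h.setIntegral_inner hΩ hB
  obtain ⟨-, K, hK, hKΩ, hBK⟩ := hB
  have inner_eq_one : ∀ᵐ z ∂Q.restrict (π ⁻¹' B), inner ℝ (τ (π z)) (ν z) = 1 := by
    filter_upwards [ae_restrict_of_ae_restrict_of_subset (preimage_mono hBK)
      (h.ae_restrict_eq hΩ hK hKΩ), ae_restrict_of_ae h.norm_eq_one] with z hz norm_eq_one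
    rw [← hz, real_inner_self_eq_norm_sq, norm_eq_one, one_pow]
  rw [integral_congr_ae inner_eq_one, integral_const, smul_eq_mul, mul_one,
    measureReal_restrict_apply_univ] at integral_eq
  have hfin := h.base_lt_top K hK hKΩ
  exact (ENNReal.toReal_eq_toReal_iff'
    (((measure_mono (preimage_mono hBK)).trans (h.measure_preimage_le K hK hKΩ)).trans_lt hfin).ne
    ((measure_mono hBK).trans_lt hfin).ne).1 integral_eq

theorem map_restrict (h : IsPolarLift Ω π Q ν M τ) (hΩ : IsOpen Ω) {B : Set E}
    (hB : IsRelCompactBorel Ω B) : (Q.restrict (π ⁻¹' B)).map π = M.restrict B := by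
  ext A hA
  rw [Measure.map_apply h.measurable_proj hA, Measure.restrict_apply (h.measurable_proj hA),
    Measure.restrict_apply hA, ← preimage_inter,
    h.measure_preimage hΩ (hB.mono (hA.inter hB.1) inter_subset_right)]

theorem ae_eq (h : IsPolarLift Ω π Q ν M τ) (hΩ : IsOpen Ω) : ∀ᵐ z ∂Q, ν z = τ (π z) :=
  h.ae_of_ae_restrict hΩ fun _ => h.ae_restrict_eq hΩ

theorem ae_comp (h : IsPolarLift Ω π Q ν M τ) (hΩ : IsOpen Ω) {p : E → Prop}
    (hp : ∀ᵐ x ∂M, p x) : ∀ᵐ z ∂Q, p (π z) := by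
  refine h.ae_of_ae_restrict hΩ fun K hK hKΩ => ?_
  refine ae_of_ae_map h.measurable_proj.aemeasurable ?_
  rw [h.map_restrict hΩ (.of_isCompact hK hKΩ)]
  exact ae_restrict_of_ae hp

end IsPolarLift

end PolarLift

section Pushforward

theorem tendsto_setIntegral_inter_isCompact {Z V : Type*} [TopologicalSpace Z] [T2Space Z]
    [MeasurableSpace Z] [OpensMeasurableSpace Z] [NormedAddCommGroup V] [NormedSpace ℝ V]
    {U A : Set Z} {Q : Measure Z} {f : Z → V} (hf : IntegrableOn f A Q) (hA : MeasurableSet A)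
    {K : ℕ → Set Z} (hK : ∀ j, IsCompact (K j)) (hKU : ∀ j, K j ⊆ U) (hmono : Monotone K)
    (hAK : A ⊆ ⋃ j, K j) :
    Tendsto (fun C : {C : Set Z // IsCompact C ∧ C ⊆ U} => ∫ z in A ∩ C, f z ∂Q) atTop
      (𝓝 (∫ z in A, f z ∂Q)) := by
  have integrableOn_norm : IntegrableOn (fun z => ‖f z‖) A Q := hf.norm
  have tendsto_norm_diff : Tendsto (fun j => ∫ z in A \ K j, ‖f z‖ ∂Q) atTop (𝓝 0) := by
    have tendsto_inter := tendsto_setIntegral_of_antitone (s := fun j => A \ K j)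
      (fun j => hA.diff (hK j).measurableSet) (fun i j hij => sdiff_subset_sdiff_right (hmono hij))
      ⟨0, integrableOn_norm.mono_set sdiff_subset⟩
    rwa [← sdiff_iUnion, sdiff_eq_empty.2 hAK, Measure.restrict_empty,
      integral_zero_measure] at tendsto_inter
  refine Metric.tendsto_nhds.2 fun ε hε => ?_
  obtain ⟨j, hj⟩ := ((tendsto_order.1 tendsto_norm_diff).2 ε hε).exists
  filter_upwards [eventually_ge_atTop ⟨K j, hK j, hKU j⟩] with C hC
  rw [dist_comm, dist_eq_norm, ← integral_inter_add_sdiff C.2.1.measurableSet hf,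
    add_sub_cancel_left]
  refine (norm_integral_le_integral_norm _).trans_lt (lt_of_le_of_lt ?_ hj)
  exact setIntegral_mono_set (integrableOn_norm.mono_set sdiff_subset)
    (Eventually.of_forall fun z => norm_nonneg _)
    (Eventually.of_forall (sdiff_subset_sdiff_right hC))

namespace RadonVectorMeasure.IsPolar

variable {Z V : Type*} [TopologicalSpace Z] [T2Space Z] [MeasurableSpace Z] [BorelSpace Z]
  [NormedAddCommGroup V] [NormedSpace ℝ V] {U : Set Z} {D : RadonVectorMeasure U V} {σ : Z → V}

theorem integrableOn (hσ : D.IsPolar σ) {A : Set Z} (hA : D.variation A < ⊤) :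
    IntegrableOn σ A D.variation :=
  Measure.integrableOn_of_bounded (M := 1) hA.ne hσ.aestronglyMeasurable
    (ae_restrict_of_ae (hσ.norm_eq_one.mono fun _ hx => hx.le))

theorem exists_measurable_norm_le_one [MeasurableSpace V] [BorelSpace V] (hσ : D.IsPolar σ) :
    ∃ σ' : Z → V, Measurable σ' ∧ (∀ x, ‖σ' x‖ ≤ 1) ∧ σ =ᵐ[D.variation] σ' ∧ D.IsPolar σ' := by
  set ρ := hσ.aestronglyMeasurable.mk σ
  have ρ_measurable : Measurable ρ := hσ.aestronglyMeasurable.stronglyMeasurable_mk.measurable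
  have ae_eq : σ =ᵐ[D.variation] {x | ‖ρ x‖ ≤ 1}.indicator ρ := by
    filter_upwards [hσ.aestronglyMeasurable.ae_eq_mk, hσ.norm_eq_one] with x hx norm_eq_one
    have mem : x ∈ {x | ‖ρ x‖ ≤ 1} := (hx ▸ norm_eq_one).le
    rw [hx, indicator_of_mem mem]
  refine ⟨_, ρ_measurable.indicator (measurableSet_le ρ_measurable.norm measurable_const),
    fun x => ?_, ae_eq, hσ.aestronglyMeasurable.congr ae_eq, ?_, fun B hB => ?_⟩
  · by_cases hx : ‖ρ x‖ ≤ 1 <;> simp [indicator, hx]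
  · filter_upwards [ae_eq, hσ.norm_eq_one] with x hx norm_eq_one
    rw [← hx, norm_eq_one]
  · rw [hσ.eq_integral B hB, integral_congr_ae (ae_restrict_of_ae ae_eq)]

end RadonVectorMeasure.IsPolar

namespace IsPolarLift

variable {Z E V : Type*} [MeasurableSpace Z] [NormedAddCommGroup E] [NormedSpace ℝ E]
  [FiniteDimensional ℝ E] [MeasurableSpace E] [BorelSpace E] [NormedAddCommGroup V]
  [InnerProductSpace ℝ V] [FiniteDimensional ℝ V] [MeasurableSpace V] [BorelSpace V]
  {Ω : Set E} {M : Measure E} {τ : E → V}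

theorem setIntegral_preimage {π : Z → E} {Q : Measure Z} {ν : Z → V}
    (h : IsPolarLift Ω π Q ν M τ) (hΩ : IsOpen Ω) {B : Set E} (hB : IsRelCompactBorel Ω B) :
    ∫ z in π ⁻¹' B, ν z ∂Q = ∫ x in B, τ x ∂M := by
  rw [integral_congr_ae (ae_restrict_of_ae (h.ae_eq hΩ)), ← h.map_restrict hΩ hB,
    integral_map h.measurable_proj.aemeasurable h.measurable_base.aestronglyMeasurable]

theorem isPushforward_restrict {F : Type*} [TopologicalSpace F] [T2Space F]
    [SigmaCompactSpace F] [MeasurableSpace F] [BorelSpace F]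
    {D : RadonVectorMeasure (Ω ×ˢ (univ : Set F)) V} {ν : E × F → V}
    (h : IsPolarLift Ω Prod.fst D.variation ν M τ) (hν : D.IsPolar ν) (hΩ : IsOpen Ω)
    {S : Set (E × F)} (hS : MeasurableSet S) {N : Set E} (hN : MeasurableSet N)
    (hSN : ∀ᵐ p ∂D.variation, p ∈ S ↔ p.1 ∈ N) {lam : RadonVectorMeasure Ω V}
    (hlam : ∀ B, IsRelCompactBorel Ω B → ∫ x in B ∩ N, τ x ∂M = lam B) :
    RadonVectorMeasure.IsPushforward Prod.fst (D.restrict S) lam := by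
  intro B hB
  have finite_preimage : D.variation (Prod.fst ⁻¹' B) < ⊤ :=
    (h.measure_preimage hΩ hB).trans_lt (hB.measure_lt_top h.base_lt_top)
  refine ⟨(D.variation_restrict_le hS (measurable_fst hB.1)).trans_lt finite_preimage, ?_⟩
  have cylinder_ae_eq :
      (Prod.fst ⁻¹' B ∩ S : Set (E × F)) =ᵐ[D.variation] Prod.fst ⁻¹' (B ∩ N) := by
    filter_upwards [hSN] with p hp using propext (and_congr_right fun _ => hp)
  have lam_eq : ∫ p in Prod.fst ⁻¹' B ∩ S, ν p ∂D.variation = lam B := by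
    rw [setIntegral_congr_set cylinder_ae_eq, h.setIntegral_preimage hΩ
      (hB.mono (hB.1.inter hN) inter_subset_left), hlam B hB]
  have measurable_inter : MeasurableSet (Prod.fst ⁻¹' B ∩ S : Set (E × F)) :=
    (measurable_fst hB.1).inter hS
  obtain ⟨-, K, hK, hKΩ, hBK⟩ := hB
  have covered : (Prod.fst ⁻¹' B ∩ S : Set (E × F)) ⊆ ⋃ j, K ×ˢ compactCovering F j :=
    fun p hp => (exists_mem_compactCovering p.2).elim fun j hj => mem_iUnion.2 ⟨j, hBK hp.1, hj⟩
  have tendsto_integral := tendsto_setIntegral_inter_isCompact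
    (hν.integrableOn ((measure_mono inter_subset_left).trans_lt finite_preimage))
    measurable_inter (fun j => hK.prod (isCompact_compactCovering F j))
    (fun j => prod_mono hKΩ (subset_univ _))
    (fun i j hij => prod_mono_right (compactCovering_subset F hij)) covered
  rw [← lam_eq]
  refine tendsto_integral.congr fun C => ?_
  rw [← hν.eq_integral _ ⟨measurable_inter.inter C.2.1.measurableSet, C, C.2.1, C.2.2,
    inter_subset_right⟩, D.restrict_apply hS, inter_right_comm]

end IsPolarLift

end Pushforward

section EuclideanSnoc

variable {m : ℕ}

theorem norm_sq_euclideanSnoc (v : EuclideanSpace ℝ (Fin m)) (t : ℝ) :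
    ‖euclideanSnoc v t‖ ^ 2 = ‖v‖ ^ 2 + t ^ 2 := by
  rw [EuclideanSpace.norm_sq_eq, EuclideanSpace.norm_sq_eq, Fin.sum_univ_castSucc]
  simp

theorem norm_euclideanSnoc_zero (v : EuclideanSpace ℝ (Fin m)) : ‖euclideanSnoc v 0‖ = ‖v‖ := by
  have norm_sq := norm_sq_euclideanSnoc v 0
  rwa [zero_pow two_ne_zero, add_zero, sq_eq_sq₀ (norm_nonneg _) (norm_nonneg _)] at norm_sq

theorem norm_euclideanSnoc_neg_one (v : EuclideanSpace ℝ (Fin m)) :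
    ‖euclideanSnoc v (-1)‖ = √(1 + ‖v‖ ^ 2) := by
  rw [← Real.sqrt_sq (norm_nonneg (euclideanSnoc v (-1))), norm_sq_euclideanSnoc, neg_one_sq,
    add_comm]

theorem measurable_euclideanSnoc {Y : Type*} [MeasurableSpace Y]
    {f : Y → EuclideanSpace ℝ (Fin m)} {c : Y → ℝ} (hf : Measurable f) (hc : Measurable c) :
    Measurable fun y => euclideanSnoc (f y) (c y) := by
  refine (WithLp.measurable_toLp 2 _).comp (measurable_pi_lambda _ fun j => ?_)
  refine Fin.lastCases ?_ (fun i => ?_) j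
  · simpa using hc
  · simp only [Fin.snoc_castSucc]
    fun_prop

theorem integral_euclideanSnoc {Y : Type*} [MeasurableSpace Y] {μ : Measure Y}
    {f : Y → EuclideanSpace ℝ (Fin m)} {c : Y → ℝ} (hf : Integrable f μ) (hc : Integrable c μ) :
    ∫ y, euclideanSnoc (f y) (c y) ∂μ = euclideanSnoc (∫ y, f y ∂μ) (∫ y, c y ∂μ) := by
  ext j
  rw [eval_integral_piLp]
  · refine Fin.lastCases ?_ (fun i => ?_) j
    · simp
    · simp only [euclideanSnoc_castSucc]
      rw [eval_integral_piLp fun i => hf.eval_piLp i]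
  · refine Fin.lastCases ?_ fun i => ?_
    · simpa using hc
    · simpa using hf.eval_piLp i

/-- The projection `(v, t) ↦ v` from `ℝᵐ⁺¹` to `ℝᵐ`. -/
noncomputable def euclideanInit : EuclideanSpace ℝ (Fin (m + 1)) →L[ℝ] EuclideanSpace ℝ (Fin m) :=
  (EuclideanSpace.equiv (Fin m) ℝ).symm.toContinuousLinearMap ∘L
    ContinuousLinearMap.pi fun i => EuclideanSpace.proj i.castSucc

theorem euclideanInit_apply (v : EuclideanSpace ℝ (Fin (m + 1))) (i : Fin m) :
    euclideanInit v i = v i.castSucc :=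
  rfl

theorem euclideanInit_euclideanSnoc (v : EuclideanSpace ℝ (Fin m)) (t : ℝ) :
    euclideanInit (euclideanSnoc v t) = v := by
  ext i
  rw [euclideanInit_apply, euclideanSnoc_castSucc]

theorem inner_euclideanInit_add (v w : EuclideanSpace ℝ (Fin (m + 1))) :
    inner ℝ (euclideanInit v) (euclideanInit w) + inner ℝ (v (Fin.last m)) (w (Fin.last m)) =
      inner ℝ v w := by
  simp only [PiLp.inner_apply, Fin.sum_univ_castSucc, euclideanInit_apply]

end EuclideanSnoc

section GraphMass

/-- The direction of the measure `(D_H u, -ℒⁿ)`, where `D_H u` has density `f` outside the null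
set `N` and polar vector `σ` on `N`. -/
noncomputable def graphDirection {E : Type*} {m : ℕ} (N : Set E)
    (σ f : E → EuclideanSpace ℝ (Fin m)) (x : E) : EuclideanSpace ℝ (Fin (m + 1)) := by
  classical exact
  if x ∈ N then euclideanSnoc (σ x) 0
  else (√(1 + ‖f x‖ ^ 2))⁻¹ • euclideanSnoc (f x) (-1)

/-- The total variation on `Ω` of the measure `(D_H u, -ℒⁿ)`, where `D_H u` has density `f` outside
the null set `N` and total variation `μ`. -/
noncomputable def graphMass {E : Type*} [MeasureSpace E] {m : ℕ} (Ω N : Set E)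
    (f : E → EuclideanSpace ℝ (Fin m)) (μ : Measure E) : Measure E :=
  ((volume.restrict Ω).withDensity fun x => ENNReal.ofReal √(1 + ‖f x‖ ^ 2)) + μ.restrict N

variable {E : Type*} {m : ℕ} {N : Set E} {σ f : E → EuclideanSpace ℝ (Fin m)}

theorem graphDirection_of_mem {x : E} (hx : x ∈ N) :
    graphDirection N σ f x = euclideanSnoc (σ x) 0 :=
  if_pos hx

theorem graphDirection_of_notMem {x : E} (hx : x ∉ N) :
    graphDirection N σ f x = (√(1 + ‖f x‖ ^ 2))⁻¹ • euclideanSnoc (f x) (-1) :=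
  if_neg hx

theorem sqrt_one_add_sq_pos (r : ℝ) : 0 < √(1 + r ^ 2) :=
  Real.sqrt_pos.2 (by positivity)

theorem norm_graphDirection_of_mem {x : E} (hx : x ∈ N) : ‖graphDirection N σ f x‖ = ‖σ x‖ := by
  rw [graphDirection_of_mem hx, norm_euclideanSnoc_zero]

theorem norm_graphDirection_of_notMem {x : E} (hx : x ∉ N) : ‖graphDirection N σ f x‖ = 1 := by
  have sqrt_pos := sqrt_one_add_sq_pos ‖f x‖
  rw [graphDirection_of_notMem hx, norm_smul, norm_euclideanSnoc_neg_one, norm_inv,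
    Real.norm_of_nonneg sqrt_pos.le, inv_mul_cancel₀ sqrt_pos.ne']

theorem norm_graphDirection_le_one (hσ : ∀ x, ‖σ x‖ ≤ 1) (x : E) :
    ‖graphDirection N σ f x‖ ≤ 1 := by
  by_cases hx : x ∈ N
  · exact (norm_graphDirection_of_mem hx).trans_le (hσ x)
  · exact (norm_graphDirection_of_notMem hx).le

theorem measurable_graphDirection [MeasurableSpace E] (hN : MeasurableSet N) (hσ : Measurable σ)
    (hf : Measurable f) : Measurable (graphDirection N σ f) := by
  classical
  have measurable_scale : Measurable fun x => (√(1 + ‖f x‖ ^ 2))⁻¹ := by fun_prop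
  exact Measurable.ite hN (measurable_euclideanSnoc hσ measurable_const)
    (measurable_scale.smul (measurable_euclideanSnoc hf measurable_const))

variable [MeasureSpace E] {Ω : Set E} {μ : Measure E}

theorem ae_graphMass_of_mem (hN0 : volume N = 0) {p : E → Prop} (h : ∀ᵐ x ∂μ, p x) :
    ∀ᵐ x ∂graphMass Ω N f μ, x ∈ N → p x := by
  refine ae_add_measure_iff.2 ⟨(withDensity_absolutelyContinuous _ _).ae_le ?_, ?_⟩
  · filter_upwards [ae_restrict_of_ae (measure_eq_zero_iff_ae_notMem.1 hN0)] with x hx hxN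
    exact absurd hxN hx
  · filter_upwards [ae_restrict_of_ae h] with x hx _ using hx

theorem ae_graphMass_of_notMem (hN : MeasurableSet N)
    {p : E → Prop} (h : ∀ᵐ x ∂volume.restrict Ω, p x) :
    ∀ᵐ x ∂graphMass Ω N f μ, x ∉ N → p x := by
  refine ae_add_measure_iff.2 ⟨(withDensity_absolutelyContinuous _ _).ae_le ?_, ?_⟩
  · filter_upwards [h] with x hx _ using hx
  · filter_upwards [ae_restrict_mem hN] with x hx hxN using absurd hx hxN

theorem restrict_graphMass_inter (hN0 : volume N = 0) (hN : MeasurableSet N) {B : Set E}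
    (hB : MeasurableSet B) : (graphMass Ω N f μ).restrict (B ∩ N) = μ.restrict (B ∩ N) := by
  have null : volume (B ∩ N ∩ Ω) = 0 :=
    measure_mono_null (inter_subset_left.trans inter_subset_right) hN0
  rw [graphMass, Measure.restrict_add, restrict_withDensity (hB.inter hN),
    Measure.restrict_restrict (hB.inter hN), Measure.restrict_restrict (hB.inter hN),
    Measure.restrict_eq_zero.2 null, withDensity_zero_left, zero_add, inter_assoc, inter_self]

theorem restrict_graphMass_diff (hN0 : volume N = 0) (hN : MeasurableSet N) {B : Set E}
    (hB : MeasurableSet B) (hBΩ : B ⊆ Ω) : (graphMass Ω N f μ).restrict (B \ N) =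
      (volume.restrict B).withDensity fun x => ENNReal.ofReal √(1 + ‖f x‖ ^ 2) := by
  have diff_ae_eq : (B \ N ∩ Ω : Set E) =ᵐ[volume] B := by
    rw [inter_eq_left.2 (sdiff_subset.trans hBΩ)]
    exact sdiff_null_ae_eq_self hN0
  rw [graphMass, Measure.restrict_add, restrict_withDensity (hB.diff hN),
    Measure.restrict_restrict (hB.diff hN), Measure.restrict_restrict (hB.diff hN),
    disjoint_sdiff_left.inter_eq, Measure.restrict_empty, add_zero,
    Measure.restrict_congr_set diff_ae_eq]

theorem setIntegral_graphDirection_inter (hN0 : volume N = 0) (hN : MeasurableSet N) {B : Set E}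
    (hB : MeasurableSet B) (hσ : IntegrableOn σ (B ∩ N) μ) :
    ∫ x in B ∩ N, graphDirection N σ f x ∂graphMass Ω N f μ =
      euclideanSnoc (∫ x in B ∩ N, σ x ∂μ) 0 := by
  rw [restrict_graphMass_inter hN0 hN hB,
    setIntegral_congr_fun (hB.inter hN) fun x hx => graphDirection_of_mem hx.2,
    integral_euclideanSnoc (c := fun _ => 0) hσ (integrable_zero _ _ _), integral_zero]

theorem setIntegral_graphDirection_diff (hN0 : volume N = 0) (hN : MeasurableSet N) {B : Set E}
    (hB : MeasurableSet B) (hBΩ : B ⊆ Ω) (hBfin : volume B < ⊤) (hfm : Measurable f)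
    (hf : IntegrableOn f B) :
    ∫ x in B \ N, graphDirection N σ f x ∂graphMass Ω N f μ =
      euclideanSnoc (∫ x in B, f x) (-(volume : Measure E).real B) := by
  have : IsFiniteMeasure (volume.restrict B) := ⟨by simpa using hBfin⟩
  have density_smul_direction : ∀ᵐ x ∂volume.restrict B,
      (ENNReal.ofReal √(1 + ‖f x‖ ^ 2)).toReal • graphDirection N σ f x =
        euclideanSnoc (f x) (-1) := by
    filter_upwards [ae_restrict_of_ae (measure_eq_zero_iff_ae_notMem.1 hN0)] with x hx
    rw [graphDirection_of_notMem hx, ENNReal.toReal_ofReal (Real.sqrt_nonneg _), smul_smul,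
      mul_inv_cancel₀ (sqrt_one_add_sq_pos _).ne', one_smul]
  rw [restrict_graphMass_diff hN0 hN hB hBΩ,
    integral_withDensity_eq_integral_toReal_smul (by fun_prop)
      (Eventually.of_forall fun _ => ENNReal.ofReal_lt_top),
    integral_congr_ae density_smul_direction, integral_euclideanSnoc hf (integrable_const _)]
  simp

theorem graphMass_lt_top {K : Set E} (hK : MeasurableSet K) (hKΩ : K ⊆ Ω)
    (hKfin : volume K < ⊤) (hf : IntegrableOn f K) (hμ : μ K < ⊤) :
    graphMass Ω N f μ K < ⊤ := by
  rw [graphMass, Measure.add_apply]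
  refine ENNReal.add_lt_top.2 ⟨?_, (Measure.restrict_apply_le _ _).trans_lt hμ⟩
  have : IsFiniteMeasure (volume.restrict K) := ⟨by simpa using hKfin⟩
  rw [withDensity_apply _ hK, Measure.restrict_restrict hK, inter_eq_left.2 hKΩ]
  have sqrt_le (x : E) : √(1 + ‖f x‖ ^ 2) ≤ 1 + ‖f x‖ :=
    Real.sqrt_le_iff.2 ⟨by positivity, by nlinarith [norm_nonneg (f x)]⟩
  exact (lintegral_mono fun x => ENNReal.ofReal_le_ofReal (sqrt_le x)).trans_lt
    ((integrable_const (1 : ℝ)).add hf.norm).lintegral_lt_top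

end GraphMass

section GraphDecomposition

/-- `τ M` is the polar decomposition of the measure `(D_H u, -ℒⁿ)` on `Ω`, where `D_H u` has the
absolutely continuous part `Dau = Xu ℒⁿ`, the singular part `Dsu` and the polar vector `σ`. The
singular part of `τ M` is carried by `N`. The density `τ` is normalized to be measurable with
`|τ| ≤ 1` everywhere. -/
structure IsGraphDecomposition {E : Type*} [TopologicalSpace E] [MeasureSpace E]
    [IsFiniteMeasureOnCompacts (volume : Measure E)] {m : ℕ} {Ω : Set E}
    (Dau Dsu : RadonVectorMeasure Ω (EuclideanSpace ℝ (Fin m)))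
    (σ Xu : E → EuclideanSpace ℝ (Fin m)) (N : Set E) (M : Measure E)
    (τ : E → EuclideanSpace ℝ (Fin (m + 1))) : Prop where
  measurableSet : MeasurableSet N
  measurable : Measurable τ
  norm_le_one : ∀ x, ‖τ x‖ ≤ 1
  norm_eq_one : ∀ᵐ x ∂M, ‖τ x‖ = 1
  lt_top : ∀ K, IsCompact K → K ⊆ Ω → M K < ⊤
  ae_eq_of_mem : ∀ᵐ x ∂M, x ∈ N → τ x = euclideanSnoc (σ x) 0
  ae_eq_of_notMem :
    ∀ᵐ x ∂M, x ∉ N → τ x = (√(1 + ‖Xu x‖ ^ 2))⁻¹ • euclideanSnoc (Xu x) (-1)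
  setIntegral_inter : ∀ B, IsRelCompactBorel Ω B → ∫ x in B ∩ N, τ x ∂M = Dsu.snoc 0 B
  setIntegral_inter_compl : ∀ B, IsRelCompactBorel Ω B →
    ∫ x in B ∩ Nᶜ, τ x ∂M = Dau.snoc (-RadonVectorMeasure.ofMeasure Ω volume) B

namespace IsGraphDecomposition

variable {E : Type*} [TopologicalSpace E] [MeasureSpace E]
  [IsFiniteMeasureOnCompacts (volume : Measure E)] {m : ℕ} {Ω N : Set E}
  {Dau Dsu : RadonVectorMeasure Ω (EuclideanSpace ℝ (Fin m))}
  {σ Xu : E → EuclideanSpace ℝ (Fin m)} {M : Measure E} {τ : E → EuclideanSpace ℝ (Fin (m + 1))}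

theorem integrableOn (h : IsGraphDecomposition Dau Dsu σ Xu N M τ) {B : Set E}
    (hB : IsRelCompactBorel Ω B) : IntegrableOn τ B M :=
  Measure.integrableOn_of_bounded (hB.measure_lt_top h.lt_top).ne
    h.measurable.aestronglyMeasurable (Eventually.of_forall h.norm_le_one)

theorem ae_last_eq_zero_iff (h : IsGraphDecomposition Dau Dsu σ Xu N M τ) :
    ∀ᵐ x ∂M, τ x (Fin.last m) = 0 ↔ x ∈ N := by
  filter_upwards [h.ae_eq_of_mem, h.ae_eq_of_notMem] with x hx_mem hx_notMem
  by_cases hx : x ∈ N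
  · simp [hx_mem hx, hx]
  · simp [hx_notMem hx, hx, (sqrt_one_add_sq_pos _).ne']

variable [T2Space E] [BorelSpace E]

theorem setIntegral_eq (h : IsGraphDecomposition Dau Dsu σ Xu N M τ)
    {D : RadonVectorMeasure Ω (EuclideanSpace ℝ (Fin m))} {ρ : Measure E}
    (hD : D.IsLebesgueDecomposition Dau Dsu ρ) {B : Set E} (hB : IsRelCompactBorel Ω B) :
    ∫ x in B, τ x ∂M = D.snoc (-RadonVectorMeasure.ofMeasure Ω volume) B := by
  rw [← integral_inter_add_sdiff h.measurableSet (h.integrableOn hB), sdiff_eq,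
    h.setIntegral_inter B hB, h.setIntegral_inter_compl B hB]
  change euclideanSnoc (Dsu B) 0 + euclideanSnoc (Dau B) (-(volume : Measure E).real B) =
    euclideanSnoc (D B) (-(volume : Measure E).real B)
  rw [hD.eq_add B hB]
  ext j
  refine Fin.lastCases ?_ (fun i => ?_) j
  · simp
  · simp [add_comm]

end IsGraphDecomposition

theorem RadonVectorMeasure.IsLebesgueDecomposition.exists_null_set {E V : Type*}
    [TopologicalSpace E] [T2Space E] [MeasurableSpace E] [BorelSpace E] [NormedAddCommGroup V]
    {Ω : Set E} {ρ : Measure E} {D Da Ds : RadonVectorMeasure Ω V}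
    (h : D.IsLebesgueDecomposition Da Ds ρ) :
    ∃ N : Set E, MeasurableSet N ∧ ρ N = 0 ∧
      ∀ B, IsRelCompactBorel Ω B → Ds B = D (B ∩ N) := by
  obtain ⟨S, hS, hS0, hSc⟩ := h.mutuallySingular
  refine ⟨Sᶜ, hS.compl, hSc, fun B hB => ?_⟩
  have inter_S := hB.mono (hB.1.inter hS) inter_subset_left
  have inter_compl := hB.mono (hB.1.inter hS.compl) inter_subset_left
  have apply_split := Ds.apply_union inter_S inter_compl
    (disjoint_compl_right.mono inter_subset_right inter_subset_right)
  rw [inter_union_compl, Ds.apply_eq_zero inter_S (measure_mono_null inter_subset_right hS0),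
    zero_add] at apply_split
  rw [apply_split, h.eq_add _ inter_compl, Da.apply_eq_zero inter_compl
    (h.absolutelyContinuous (measure_mono_null inter_subset_right hSc)), zero_add]

theorem RadonVectorMeasure.HasDensity.exists_measurable {E V : Type*} [TopologicalSpace E]
    [SecondCountableTopology E] [MeasurableSpace E] [NormedAddCommGroup V] [NormedSpace ℝ V]
    [MeasurableSpace V] [BorelSpace V] {Ω : Set E} {ρ : Measure E} {D : RadonVectorMeasure Ω V}
    {f : E → V} (h : D.HasDensity f ρ) :
    ∃ g : E → V, Measurable g ∧ f =ᵐ[ρ.restrict Ω] g ∧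
      ∀ B, IsRelCompactBorel Ω B → IntegrableOn g B ρ ∧ D B = ∫ x in B, g x ∂ρ := by
  have hf := h.1.aestronglyMeasurable
  refine ⟨hf.mk f, hf.stronglyMeasurable_mk.measurable, hf.ae_eq_mk, fun B hB => ?_⟩
  have ae_eq_on := ae_restrict_of_ae_restrict_of_subset hB.subset hf.ae_eq_mk
  exact ⟨(hB.integrableOn h.1).congr ae_eq_on, (h.2 B hB).trans (integral_congr_ae ae_eq_on)⟩

variable {E : Type*} [TopologicalSpace E] [T2Space E] [MeasureSpace E] [BorelSpace E]
  [IsFiniteMeasureOnCompacts (volume : Measure E)] {m : ℕ} {Ω : Set E}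
  {D Dau Dsu : RadonVectorMeasure Ω (EuclideanSpace ℝ (Fin m))}
  {σ f Xu : E → EuclideanSpace ℝ (Fin m)}

theorem isGraphDecomposition_graphMass {N : Set E} (hN : MeasurableSet N) (hN0 : volume N = 0)
    (hDsu : ∀ B, IsRelCompactBorel Ω B → Dsu B = D (B ∩ N)) (hσ : D.IsPolar σ)
    (hσm : Measurable σ) (hσ1 : ∀ x, ‖σ x‖ ≤ 1) (hfm : Measurable f)
    (hf : ∀ B, IsRelCompactBorel Ω B → IntegrableOn f B ∧ Dau B = ∫ x in B, f x) :
    IsGraphDecomposition Dau Dsu σ f N (graphMass Ω N f D.variation) (graphDirection N σ f) where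
  measurableSet := hN
  measurable := measurable_graphDirection hN hσm hfm
  norm_le_one := norm_graphDirection_le_one hσ1
  norm_eq_one := by
    filter_upwards [ae_graphMass_of_mem hN0 hσ.norm_eq_one] with x hx
    by_cases hxN : x ∈ N
    · exact (norm_graphDirection_of_mem hxN).trans (hx hxN)
    · exact norm_graphDirection_of_notMem hxN
  lt_top K hK hKΩ := graphMass_lt_top hK.measurableSet hKΩ hK.measure_lt_top
    (hf K (.of_isCompact hK hKΩ)).1 (D.variation_lt_top hK hKΩ)
  ae_eq_of_mem := Eventually.of_forall fun _ => graphDirection_of_mem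
  ae_eq_of_notMem := Eventually.of_forall fun _ => graphDirection_of_notMem
  setIntegral_inter B hB := by
    have hBN := hB.mono (hB.1.inter hN) inter_subset_left
    rw [setIntegral_graphDirection_inter hN0 hN hB.1 (hσ.integrableOn
      (hBN.measure_lt_top fun _ => D.variation_lt_top)), ← hσ.eq_integral _ hBN, ← hDsu B hB]
    rfl
  setIntegral_inter_compl B hB := by
    rw [← Set.sdiff_eq, setIntegral_graphDirection_diff hN0 hN hB.1 hB.subset
      (hB.measure_lt_top fun _ hK _ => hK.measure_lt_top) hfm (hf B hB).1, ← (hf B hB).2]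
    rfl

theorem RadonVectorMeasure.IsLebesgueDecomposition.exists_isGraphDecomposition
    [SecondCountableTopology E] (hD : D.IsLebesgueDecomposition Dau Dsu volume)
    (hσ : D.IsPolar σ) (hXu : Dau.HasDensity Xu volume) :
    ∃ N M τ, IsGraphDecomposition Dau Dsu σ Xu N M τ := by
  obtain ⟨N, hN, hN0, hDsu⟩ := hD.exists_null_set
  obtain ⟨σ', hσ'm, hσ'1, hσσ', hσ'⟩ := hσ.exists_measurable_norm_le_one
  obtain ⟨f, hfm, hXuf, hf⟩ := hXu.exists_measurable
  have h := isGraphDecomposition_graphMass hN hN0 hDsu hσ' hσ'm hσ'1 hfm hf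
  refine ⟨_, _, _, { h with ae_eq_of_mem := ?_, ae_eq_of_notMem := ?_ }⟩
  · filter_upwards [ae_graphMass_of_mem hN0 hσσ'] with x hx hxN
    rw [hx hxN, graphDirection_of_mem hxN]
  · filter_upwards [ae_graphMass_of_notMem hN hXuf] with x hx hxN
    rw [hx hxN, graphDirection_of_notMem hxN]

end GraphDecomposition

section SubgraphNormal

theorem exists_measurable_integrable_ae_eq {Y V : Type*} [MeasurableSpace Y]
    [NormedAddCommGroup V] [MeasurableSpace V] [BorelSpace V] {μ : Measure Y} {A : Set Y}
    (hA : MeasurableSet A) {u : Y → V} (hu : IntegrableOn u A μ) :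
    ∃ w : Y → V, Measurable w ∧ Integrable w μ ∧ u =ᵐ[μ.restrict A] w := by
  refine ⟨A.indicator (hu.1.mk u), hu.1.stronglyMeasurable_mk.measurable.indicator hA,
    (integrable_indicator_iff hA).2 (hu.congr hu.1.ae_eq_mk), ?_⟩
  exact hu.1.ae_eq_mk.trans (indicator_ae_eq_restrict hA).symm

section Pairing

variable {Z V : Type*} [TopologicalSpace Z] [T2Space Z] [MeasurableSpace Z] [BorelSpace Z]
  [NormedAddCommGroup V] [InnerProductSpace ℝ V] {U : Set Z} {P : Measure Z} {h φ : Z → V}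

theorem IsCompactlySupportedIn.integrable_inner (hφ : IsCompactlySupportedIn U φ)
    (hh : ∀ B, IsRelCompactBorel U B → IntegrableOn h B P) :
    Integrable (fun x => inner ℝ (φ x) (h x)) P := by
  obtain ⟨C, hC⟩ := hφ.hasCompactSupport.exists_bound_of_continuous hφ.continuous
  refine (integrableOn_iff_integrable_of_support_subset fun x hx => ?_).1
    (integrable_inner_of_norm_le (hh _ (.of_isCompact hφ.hasCompactSupport hφ.tsupport_subset))
      (hφ.continuous.stronglyMeasurable_of_hasCompactSupport
        hφ.hasCompactSupport).aestronglyMeasurable hC)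
  exact subset_tsupport φ fun hφx => hx (by simp only [hφx, inner_zero_left])

theorem RadonVectorMeasure.integral_eq_integral_inner [CompleteSpace V]
    (μ : RadonVectorMeasure U V) (hh : ∀ B, IsRelCompactBorel U B → IntegrableOn h B P)
    (hμ : ∀ B, IsRelCompactBorel U B → μ B = ∫ x in B, h x ∂P)
    (hφ : IsCompactlySupportedIn U φ) :
    (μ.onCompact (tsupport φ) hφ.hasCompactSupport hφ.tsupport_subset).integral φ (innerSL ℝ) =
      ∫ x, inner ℝ (φ x) (h x) ∂P := by
  have hK := IsRelCompactBorel.of_isCompact hφ.hasCompactSupport hφ.tsupport_subset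
  obtain ⟨C, hC⟩ := hφ.hasCompactSupport.exists_bound_of_continuous hφ.continuous
  refine (μ.onCompact_integral_eq hφ.hasCompactSupport hφ.tsupport_subset (hh _ hK)
    (fun B hB hBK => hμ B (hK.mono hB hBK))
    (hφ.continuous.stronglyMeasurable_of_hasCompactSupport hφ.hasCompactSupport) hC).trans ?_
  exact setIntegral_eq_integral_of_forall_compl_eq_zero fun x hx => by
    rw [image_eq_zero_of_notMem_tsupport hx, inner_zero_left]

end Pairing

variable {E : Type*} [NormedAddCommGroup E] [MeasureSpace E] [BorelSpace E] {m : ℕ} {Ω N : Set E}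
  {u w : E → ℝ} {M : Measure E} {τ : E → EuclideanSpace ℝ (Fin (m + 1))}
  {Du Dau Dsu : RadonVectorMeasure Ω (EuclideanSpace ℝ (Fin m))}
  {σ Xu : E → EuclideanSpace ℝ (Fin m)} {g : E → EuclideanSpace ℝ (Fin (m + 1))}
  {D : RadonVectorMeasure (Ω ×ˢ (univ : Set ℝ)) (EuclideanSpace ℝ (Fin (m + 1)))}
  {ν : E × ℝ → EuclideanSpace ℝ (Fin (m + 1))}

section Decomposition

variable [IsFiniteMeasureOnCompacts (volume : Measure E)]

namespace IsGraphDecomposition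

theorem integral_inner_last (h : IsGraphDecomposition Dau Dsu σ Xu N M τ)
    (hdec : Du.IsLebesgueDecomposition Dau Dsu volume) (hgc : IsCompactlySupportedIn Ω g) :
    ∫ x, inner ℝ (g x (Fin.last m)) (τ x (Fin.last m)) ∂M = -∫ x, g x (Fin.last m) := by
  have last_compactlySupported := hgc.apply (Fin.last m)
  rw [← (-RadonVectorMeasure.ofMeasure Ω (volume : Measure E)).integral_eq_integral_inner
      (fun B hB => (h.integrableOn hB).eval_piLp (Fin.last m)) (fun B hB => ?_)
      last_compactlySupported,
    (-RadonVectorMeasure.ofMeasure Ω (volume : Measure E)).integral_eq_integral_inner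
      (P := volume) (h := fun _ => -1) (fun B hB => ?_) (fun B _ => ?_) last_compactlySupported]
  · simp [integral_neg]
  · exact integrableOn_const (hB.measure_lt_top fun _ hK _ => hK.measure_lt_top).ne
  · rw [setIntegral_const, smul_eq_mul, mul_neg_one]
    rfl
  · rw [← eval_integral_piLp fun i => (h.integrableOn hB).eval_piLp i, h.setIntegral_eq hdec hB]
    exact (euclideanSnoc_last _ _).symm

variable [NormedSpace ℝ E] {X : Fin m → E → E}

theorem integral_inner_euclideanInit (h : IsGraphDecomposition Dau Dsu σ Xu N M τ)
    (hdec : Du.IsLebesgueDecomposition Dau Dsu volume) (hDu : IsHDerivative X Ω u Du)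
    (hg : ContDiff ℝ 1 g) (hgc : IsCompactlySupportedIn Ω g) :
    ∫ x, inner ℝ (euclideanInit (g x)) (euclideanInit (τ x)) ∂M =
      -∫ x in Ω, u x * horizontalDiv X g x := by
  have init_compactlySupported := hgc.comp_clm euclideanInit
  rw [← Du.integral_eq_integral_inner
    (fun B hB => euclideanInit.integrable_comp (h.integrableOn hB)) (fun B hB => ?_)
    init_compactlySupported]
  · exact hDu _ (euclideanInit.contDiff.comp hg) init_compactlySupported.hasCompactSupport
      init_compactlySupported.tsupport_subset
  · rw [euclideanInit.integral_comp_comm (h.integrableOn hB), h.setIntegral_eq hdec hB]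
    exact (euclideanInit_euclideanSnoc _ _).symm

theorem isGraphMeasure (h : IsGraphDecomposition Dau Dsu σ Xu N M τ)
    (hdec : Du.IsLebesgueDecomposition Dau Dsu volume) (hDu : IsHDerivative X Ω u Du)
    (huw : u =ᵐ[volume.restrict Ω] w) : IsGraphMeasure X Ω w M τ where
  measurable := h.measurable
  norm_le_one := h.norm_le_one
  lt_top := h.lt_top
  integral_inner g hg hc hs := by
    have hgc : IsCompactlySupportedIn Ω g := ⟨hg.continuous, hc, hs⟩
    have integral_eq : ∫ x in Ω, u x * horizontalDiv X g x = ∫ x, w x * horizontalDiv X g x := by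
      refine (integral_congr_ae (huw.mul (ae_eq_refl (horizontalDiv X g)))).trans ?_
      exact setIntegral_eq_integral_of_forall_compl_eq_zero fun x hx => by
        simp [horizontalDiv_of_notMem_tsupport fun h => hx (hs h)]
    simp_rw [← inner_euclideanInit_add (g _)]
    rw [integral_add
      ((hgc.comp_clm euclideanInit).integrable_inner
        fun B hB => euclideanInit.integrable_comp (h.integrableOn hB))
      ((hgc.apply (Fin.last m)).integrable_inner
        fun B hB => (h.integrableOn hB).eval_piLp (Fin.last m)),
      h.integral_inner_euclideanInit hdec hDu hg hgc, h.integral_inner_last hdec hgc,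
      integral_eq, sub_eq_add_neg]

end IsGraphDecomposition

theorem IsPolarLift.ae_last_eq_zero_iff [NormedSpace ℝ E] [FiniteDimensional ℝ E]
    {Q : Measure (E × ℝ)} (hL : IsPolarLift Ω Prod.fst Q ν M τ) (hΩ : IsOpen Ω)
    (h : IsGraphDecomposition Dau Dsu σ Xu N M τ) :
    ∀ᵐ p ∂Q, p.1 ∈ Ω ∧ (ν p (Fin.last m) = 0 ↔ p.1 ∈ N) := by
  have ae_fst_mem : ∀ᵐ p ∂Q, p.1 ∈ Ω := hL.measure_compl
  filter_upwards [ae_fst_mem, hL.ae_eq hΩ, hL.ae_comp hΩ h.ae_last_eq_zero_iff]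
    with p fst_mem hp last_iff
  exact ⟨fst_mem, by rw [hp, last_iff]⟩

end Decomposition

variable [NormedSpace ℝ E] {X : Fin m → E → E}

theorem RadonVectorMeasure.IsPolar.isSubgraphDerivative (hν : D.IsPolar ν) (hνm : Measurable ν)
    (hν1 : ∀ p, ‖ν p‖ ≤ 1) (hΩ : MeasurableSet Ω)
    (hD : IsHDerivative (extendedFields X) (Ω ×ˢ univ)
      ((subgraph Ω u).indicator fun _ => (1 : ℝ)) D)
    (huw : u =ᵐ[volume.restrict Ω] w) (hwm : Measurable w) :
    IsSubgraphDerivative X Ω w D.variation ν where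
  measurable := hνm
  norm_le_one := hν1
  norm_eq_one := hν.norm_eq_one
  lt_top _ hK hKΩ := D.variation_lt_top hK hKΩ
  measure_compl := D.variation_compl (hΩ.prod .univ)
  integral_inner φ hφ hφc := by
    rw [← D.integral_eq_integral_inner (fun B hB => hν.integrableOn
      (hB.measure_lt_top fun _ hK hKΩ => D.variation_lt_top hK hKΩ)) hν.eq_integral hφc]
    exact (isHDerivative_subgraph_iff hΩ huw hwm D).1 hD φ hφ hφc.hasCompactSupport
      hφc.tsupport_subset

variable [FiniteDimensional ℝ E] [(volume : Measure E).IsAddHaarMeasure]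

theorem IsGraphMeasure.memBVHLoc_indicator_subgraph (h : IsGraphMeasure X Ω w M τ)
    (hΩ : IsOpen Ω) (hX : ∀ i, ContDiff ℝ 1 (X i)) (huw : u =ᵐ[volume.restrict Ω] w)
    (hw : Integrable w) (hwm : Measurable w) :
    MemBVHLoc (extendedFields X) (Ω ×ˢ univ) ((subgraph Ω u).indicator fun _ => (1 : ℝ)) := by
  obtain ⟨D, hD⟩ := h.exists_integral_eq_neg_integral_divX hΩ hX hw hwm
  exact ⟨(locallyIntegrable_indicator_subgraph hΩ.measurableSet huw hwm).locallyIntegrableOn _,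
    D, (isHDerivative_subgraph_iff hΩ.measurableSet huw hwm D).2 hD⟩

end SubgraphNormal

theorem theorem4_general {E : Type*} [NormedAddCommGroup E] [NormedSpace ℝ E]
    [FiniteDimensional ℝ E] [MeasureSpace E] [BorelSpace E] [(volume : Measure E).IsAddHaarMeasure]
    {m : ℕ} {X : Fin m → E → E} (hX : ∀ i, ContDiff ℝ 1 (X i)) {Ω : Set E} (hΩ : IsOpen Ω)
    {u : E → ℝ} (hu : IntegrableOn u Ω)
    {Du Dau Dsu : RadonVectorMeasure Ω (EuclideanSpace ℝ (Fin m))}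
    (hDu : IsHDerivative X Ω u Du) {σ Xu : E → EuclideanSpace ℝ (Fin m)} (hσ : Du.IsPolar σ)
    (hdec : Du.IsLebesgueDecomposition Dau Dsu volume) (hXu : Dau.HasDensity Xu volume) :
    MemBVHLoc (extendedFields X) (Ω ×ˢ univ) ((subgraph Ω u).indicator (fun _ => (1 : ℝ))) ∧
    ∀ (Dχ : RadonVectorMeasure (Ω ×ˢ (univ : Set ℝ)) (EuclideanSpace ℝ (Fin (m + 1))))
      (_ : IsHDerivative (extendedFields X) (Ω ×ˢ univ)
        ((subgraph Ω u).indicator (fun _ => (1 : ℝ))) Dχ)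
      (ν : E × ℝ → EuclideanSpace ℝ (Fin (m + 1)))
      (_ : Measurable ν) (_ : Dχ.IsPolar ν)
      (S T : Set (E × ℝ))
      (_ : S = {p | p.1 ∈ Ω ∧ ν p (Fin.last m) = 0})
      (_ : T = {p | p.1 ∈ Ω ∧ ν p (Fin.last m) ≠ 0}),
      (∀ᵐ p ∂Dχ.variation, p ∈ S → ν p = euclideanSnoc (σ p.1) 0) ∧
      (∀ᵐ p ∂Dχ.variation, p ∈ T →
        ν p = (√(1 + ‖Xu p.1‖ ^ 2))⁻¹ • euclideanSnoc (Xu p.1) (-1)) ∧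
      RadonVectorMeasure.IsPushforward Prod.fst (Dχ.restrict S) (Dsu.snoc 0) ∧
      RadonVectorMeasure.IsPushforward Prod.fst (Dχ.restrict T)
        (Dau.snoc (-RadonVectorMeasure.ofMeasure Ω volume)) := by
  have := FiniteDimensional.proper_real E
  obtain ⟨w, hwm, hw, huw⟩ := exists_measurable_integrable_ae_eq hΩ.measurableSet hu
  obtain ⟨N, M, τ, hG⟩ := hdec.exists_isGraphDecomposition hσ hXu
  have hM := hG.isGraphMeasure hdec hDu huw
  refine ⟨hM.memBVHLoc_indicator_subgraph hΩ hX huw hw hwm, ?_⟩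
  rintro Dχ hDχ ν hνm hν _ _ rfl rfl
  obtain ⟨ν', hν'm, hν'1, hνν', hν'⟩ := hν.exists_measurable_norm_le_one
  have hL : IsPolarLift Ω Prod.fst Dχ.variation ν' M τ :=
    (hν'.isSubgraphDerivative hν'm hν'1 hΩ.measurableSet hDχ huw hwm).isPolarLift
      hM hG.norm_eq_one hΩ hX hw hwm
  have normal_eq : ∀ᵐ p ∂Dχ.variation, ν p = τ p.1 := hνν'.trans (hL.ae_eq hΩ)
  have last_eq_zero_iff : ∀ᵐ p ∂Dχ.variation, p.1 ∈ Ω ∧ (ν p (Fin.last m) = 0 ↔ p.1 ∈ N) := by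
    filter_upwards [hνν', hL.ae_last_eq_zero_iff hΩ hG] with p hp last_iff using hp ▸ last_iff
  have last_measurable : Measurable fun p => ν p (Fin.last m) := by fun_prop
  have hS := (measurable_fst hΩ.measurableSet).inter
    (last_measurable (measurableSet_singleton 0))
  have hT := (measurable_fst hΩ.measurableSet).inter
    (last_measurable (measurableSet_singleton 0).compl)
  refine ⟨?_, ?_, hL.isPushforward_restrict hν' hΩ hS hG.measurableSet ?_ hG.setIntegral_inter,
    hL.isPushforward_restrict hν' hΩ hT hG.measurableSet.compl ?_ hG.setIntegral_inter_compl⟩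
  · filter_upwards [normal_eq, last_eq_zero_iff, hL.ae_comp hΩ hG.ae_eq_of_mem]
      with p hp last_iff hN hpS
    rw [hp, hN (last_iff.2.1 hpS.2)]
  · filter_upwards [normal_eq, last_eq_zero_iff, hL.ae_comp hΩ hG.ae_eq_of_notMem]
      with p hp last_iff hN hpT
    rw [hp, hN (mt last_iff.2.2 hpT.2)]
  · filter_upwards [last_eq_zero_iff] with p last_iff
    exact (and_iff_right last_iff.1).trans last_iff.2
  · filter_upwards [last_eq_zero_iff] with p last_iff
    exact (and_iff_right last_iff.1).trans (not_congr last_iff.2)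

theorem theorem4 {n m : ℕ}
    (X : Fin m → EuclideanSpace ℝ (Fin n) → EuclideanSpace ℝ (Fin n))
    (hX : ∀ i, ContDiff ℝ ∞ (X i))
    (hXli : ∀ x, LinearIndependent ℝ (fun i => X i x))
    (Ω : Set (EuclideanSpace ℝ (Fin n))) (hΩ : IsOpen Ω)
    (u : EuclideanSpace ℝ (Fin n) → ℝ) (hu : MemBVH X Ω u)
    -- the horizontal derivative `D_H u`, its polar vector `σ_u`
    (Du : RadonVectorMeasure Ω (EuclideanSpace ℝ (Fin m))) (hDu : IsHDerivative X Ω u Du)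
    (σ : EuclideanSpace ℝ (Fin n) → EuclideanSpace ℝ (Fin m)) (hσ : Du.IsPolar σ)
    -- the parts `D_H^a u = Xu L^n` and `D_H^s u`
    (Dau Dsu : RadonVectorMeasure Ω (EuclideanSpace ℝ (Fin m)))
    (hdec : Du.IsLebesgueDecomposition Dau Dsu volume)
    (Xu : EuclideanSpace ℝ (Fin n) → EuclideanSpace ℝ (Fin m)) (hXu : Dau.HasDensity Xu volume) :
    -- the subgraph has locally finite perimeter in `Ω × ℝ`
    MemBVHLoc (extendedFields X) (Ω ×ˢ univ) ((subgraph Ω u).indicator (fun _ => (1 : ℝ))) ∧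
    -- `Dχ` is the horizontal derivative of the characteristic function of the subgraph,
    -- `ν` is the horizontal inner normal
    ∀ (Dχ : RadonVectorMeasure (Ω ×ˢ (univ : Set ℝ)) (EuclideanSpace ℝ (Fin (m + 1))))
      (_ : IsHDerivative (extendedFields X) (Ω ×ˢ univ)
        ((subgraph Ω u).indicator (fun _ => (1 : ℝ))) Dχ)
      (ν : EuclideanSpace ℝ (Fin n) × ℝ → EuclideanSpace ℝ (Fin (m + 1)))
      (_ : Measurable ν) (_ : Dχ.IsPolar ν)
      (S T : Set (EuclideanSpace ℝ (Fin n) × ℝ))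
      (_ : S = {p | p.1 ∈ Ω ∧ ν p (Fin.last m) = 0})
      (_ : T = {p | p.1 ∈ Ω ∧ ν p (Fin.last m) ≠ 0}),
      (∀ᵐ p ∂Dχ.variation, p ∈ S → ν p = euclideanSnoc (σ p.1) 0) ∧
      (∀ᵐ p ∂Dχ.variation, p ∈ T →
        ν p = (√(1 + ‖Xu p.1‖ ^ 2))⁻¹ • euclideanSnoc (Xu p.1) (-1)) ∧
      RadonVectorMeasure.IsPushforward Prod.fst (Dχ.restrict S) (Dsu.snoc 0) ∧
      RadonVectorMeasure.IsPushforward Prod.fst (Dχ.restrict T)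
        (Dau.snoc (-RadonVectorMeasure.ofMeasure Ω volume)) :=
  theorem4_general (fun i => (hX i).of_le (mod_cast le_top)) hΩ hu.1 hDu hσ hdec hXu
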